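/- Let $\mathbb{D}$ be the open unit disk, $\mathbb{T}$ the unit circle, and let $H^2(\mathbb{D}^2)$ be the Hardy space of all holomorphic functions $f$ on $\mathbb{D}^2$ with $\|f\|^2=\sup_{0\le r<1}\int_{\mathbb{T}^2}|f(rz,rw)|^2\,dm<\infty$, where $m$ is normalized Lebesgue measure on $\mathbb{T}^2$. A function $\theta\in H^2(\mathbb{D}^2)$ is called inner if its radial boundary values have modulus $1$ almost everywhere on $\mathbb{T}^2$, and rational inner if it is moreover a rational function of $(z,w)$. For an inner function $\theta$ put $\mathcal{K}_\theta=H^2(\mathbb{D}^2)\ominus\theta H^2(\mathbb{D}^2)$, let $P$ be the orthogonal projection of $H^2(\mathbb{D}^2)$ onto $\mathcal{K}_\theta$, and let $S_z f=P(zf)$ for $f\in\mathcal{K}_\theta$. Write $\sigma(S_z)$ for the spectrum of $S_z$ and $\sigma_e(S_z)$ for its essential spectrum, the set of $\lambda\in\mathbb{C}$ for which $S_z-\lambda$ is not Fredholm. For $E\subseteq\mathbb{C}$ let $E^*=\{\bar\lambda:\lambda\in E\}$. Let $\Omega\subseteq\mathbb{C}$ be a nonempty bounded open set with distinct connected components $\Omega_i$,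 and let $\alpha=(\alpha_i)$ be a family of positive integers with the same index set. A bounded linear operator $T$ on a separable complex Hilbert space $\mathcal{H}$ belongs to the generalized Cowen–Douglas class $\mathfrak{B}_\alpha(\Omega)$ if (1) $\operatorname{Ran}(T-\lambda)=\mathcal{H}$ for all $\lambda\in\Omega$; (2) the closed linear span of $\bigcup_{\lambda\in\Omega}\ker(T-\lambda)$ is $\mathcal{H}$; (3) $\dim\ker(T-\lambda)=\alpha_i$ for all $i$ and all $\lambda\in\Omega_i$. **Theorem.** Let $\theta$ be a nonconstant rational inner function on $\mathbb{D}^2$ that has no nonconstant inner factor depending only on $z$; that is, $\theta$ is not a product $\varphi\psi$ of inner functions with $\varphi$ nonconstant and depending only on $z$. Let $\Omega=\sigma(S_z)\setminus\sigma_e(S_z)$ and let $\Omega_i$ be the distinct connected components of $\Omega$. Then, for every $i$, the number $\alpha_i$ of zeros of $\theta(\lambda,\cdot)$ in $\mathbb{D}$, counted with multiplicity, is finite, positive and the same for all $\lambda\in\Omega_i$, and, with $\alpha=(\alpha_i)$, the operator $S_z^*$ on $\mathcal{K}_\theta$ belongs to $\mathfrak{B}_\alpha(\Omega^*)$, where $\alpha_i$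 is attached to the component $\Omega_i^*$ of $\Omega^*$. -/

import Mathlib

noncomputable section

open MeasureTheory Set Filter Topology
open scoped ComplexConjugate

namespace HardyBidisk

/-- The open unit bidisk `𝔻²`. -/
def bidisk : Set (ℂ × ℂ) := Metric.ball 0 1 ×ˢ Metric.ball 0 1

/-- The point `(r₁ e^{2πi s}, r₂ e^{2πi t})`. -/
def torusPoint (r₁ r₂ : ℝ) (t : UnitAddCircle × UnitAddCircle) : ℂ × ℂ :=
  ((r₁ : ℂ) * (AddCircle.toCircle t.1 : ℂ), (r₂ : ℂ) * (AddCircle.toCircle t.2 : ℂ))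

/-- Normalized Lebesgue measure on the torus `𝕋²`, parametrized by `(s, t) ↦ (e^{2πi s}, e^{2πi t})`. -/
def torusMeasure : Measure (UnitAddCircle × UnitAddCircle) :=
  (AddCircle.haarAddCircle : Measure UnitAddCircle).prod AddCircle.haarAddCircle

instance : IsProbabilityMeasure torusMeasure := by
  unfold torusMeasure; infer_instance

/-- `∫_{𝕋²} |f(rz, rw)|² dm`. -/
def torusMean (f : ℂ × ℂ → ℂ) (r : ℝ) : ℝ :=
  ∫ t, ‖f (torusPoint r r t)‖ ^ 2 ∂torusMeasure

theorem isOpen_bidisk : IsOpen bidisk := Metric.isOpen_ball.prod Metric.isOpen_ball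

theorem mem_bidisk {x : ℂ × ℂ} : x ∈ bidisk ↔ ‖x.1‖ < 1 ∧ ‖x.2‖ < 1 := by
  simp [bidisk]

theorem torusPoint_mem {r₁ r₂ : ℝ} (h₁ : r₁ ∈ Ico (0 : ℝ) 1) (h₂ : r₂ ∈ Ico (0 : ℝ) 1)
    (t : UnitAddCircle × UnitAddCircle) : torusPoint r₁ r₂ t ∈ bidisk := by
  rw [mem_bidisk]
  simpa [torusPoint, abs_of_nonneg h₁.1, abs_of_nonneg h₂.1, Circle.norm_coe] using ⟨h₁.2, h₂.2⟩

theorem continuous_torusPoint (r₁ r₂ : ℝ) : Continuous (torusPoint r₁ r₂) := by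
  unfold torusPoint; fun_prop

theorem continuous_comp_torusPoint {f : ℂ × ℂ → ℂ} (hf : DifferentiableOn ℂ f bidisk) {r₁ r₂ : ℝ}
    (h₁ : r₁ ∈ Ico (0 : ℝ) 1) (h₂ : r₂ ∈ Ico (0 : ℝ) 1) :
    Continuous fun t => f (torusPoint r₁ r₂ t) :=
  hf.continuousOn.comp_continuous (continuous_torusPoint r₁ r₂) (torusPoint_mem h₁ h₂)

theorem integrable_of_continuous {E : Type*} [NormedAddCommGroup E]
    {g : UnitAddCircle × UnitAddCircle → E} (hg : Continuous g) :
    Integrable g torusMeasure :=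
  hg.integrable_of_hasCompactSupport (HasCompactSupport.of_compactSpace g)

theorem integral_fourier_mul (m n : ℤ) :
    ∫ t : UnitAddCircle, fourier (-m) t * fourier n t ∂AddCircle.haarAddCircle
      = if m = n then 1 else 0 := by
  have := (orthonormal_iff_ite.mp (orthonormal_fourier (T := 1))) m n
  rw [ContinuousMap.inner_toLp] at this
  rw [← this]
  refine integral_congr_ae (ae_of_all _ fun t => ?_)
  simp only [fourier_neg, mul_comm]

theorem toCircle_pow (k : ℕ) (t : UnitAddCircle) :
    (AddCircle.toCircle t : ℂ) ^ k = fourier (k : ℤ) t := by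
  rw [fourier_apply, natCast_zsmul, AddCircle.toCircle_nsmul, Circle.coe_pow]

/-- Fourier coefficients on the circle of radius `r` of a holomorphic function on the disk. -/
theorem hasSum_circle {g : ℂ → ℂ} (hg : DifferentiableOn ℂ g (Metric.ball 0 1)) {r : ℝ}
    (hr : r ∈ Ico (0 : ℝ) 1) (n : ℤ) :
    ∫ t : UnitAddCircle, fourier (-n) t * g (r * (AddCircle.toCircle t : ℂ))
        ∂AddCircle.haarAddCircle
      = if 0 ≤ n then ((n.toNat.factorial : ℂ)⁻¹ * iteratedDeriv n.toNat g 0) * (r : ℂ) ^ n.toNat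
        else 0 := by
  set b : ℕ → ℂ := fun k => (k.factorial : ℂ)⁻¹ * iteratedDeriv k g 0 with hb
  have hs : ∀ z : ℂ, ‖z‖ < 1 → HasSum (fun k => b k * z ^ k) (g z) := by
    intro z hz
    have := Complex.hasSum_taylorSeries_on_ball hg (z := z) (by simpa using hz)
    refine this.congr_fun fun k => ?_
    simp [hb]; ring
  have hsum : Summable fun k => ‖b k * (r : ℂ) ^ k‖ :=
    (hs r (by simpa [abs_of_nonneg hr.1] using hr.2)).summable.norm
  let F : ℕ → UnitAddCircle → ℂ := fun k t => (b k * (r : ℂ) ^ k) * (fourier (-n) t * fourier k t)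
  have hF : ∀ t : UnitAddCircle, ∑' k, F k t =
      fourier (-n) t * g (r * (AddCircle.toCircle t : ℂ)) := by
    intro t
    have := (hs (r * (AddCircle.toCircle t : ℂ))
      (by simpa [abs_of_nonneg hr.1, Circle.norm_coe] using hr.2)).mul_left (fourier (-n) t)
    rw [← this.tsum_eq]
    refine tsum_congr fun k => ?_
    simp only [F]
    rw [mul_pow, toCircle_pow]; ring
  have hcont : ∀ k, Continuous (F k) := fun k => by simp only [F]; fun_prop
  have hnorm : ∀ k t, ‖F k t‖ = ‖b k * (r : ℂ) ^ k‖ := by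
    intro k t
    simp [F, fourier_apply, Circle.norm_coe]
  have key := hasSum_integral_of_summable_integral_norm (μ := AddCircle.haarAddCircle) (F := F)
    (fun k => (hcont k).integrable_of_hasCompactSupport (HasCompactSupport.of_compactSpace _))
    (by simpa [hnorm] using hsum)
  simp_rw [hF] at key
  have hval : ∀ k : ℕ, ∫ t, F k t ∂AddCircle.haarAddCircle
      = if n = k then b k * (r : ℂ) ^ k else 0 := by
    intro k
    simp only [F]
    rw [integral_const_mul, integral_fourier_mul]
    split_ifs <;> simp
  simp_rw [hval] at key
  rw [← key.tsum_eq]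
  split_ifs with h
  · rw [tsum_eq_single n.toNat]
    · rw [if_pos (by omega)]
    · intro k hk
      rw [if_neg (by omega)]
  · convert tsum_zero with k
    rw [if_neg (by omega)]

/-- The Fourier coefficient of index `(m, n)` of `f` on the torus of radii `(r₁, r₂)`. -/
def torusCoeff (f : ℂ × ℂ → ℂ) (r₁ r₂ : ℝ) (m n : ℤ) : ℂ :=
  ∫ t, fourier (-m) t.1 * fourier (-n) t.2 * f (torusPoint r₁ r₂ t) ∂torusMeasure

theorem torusCoeff_eq₂ {f : ℂ × ℂ → ℂ} (hf : DifferentiableOn ℂ f bidisk) {r₁ : ℝ}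
    (h₁ : r₁ ∈ Ico (0 : ℝ) 1) (m n : ℤ) : ∃ G : ℂ, ∀ r₂ ∈ Ico (0 : ℝ) 1,
    torusCoeff f r₁ r₂ m n = if 0 ≤ n then G * (r₂ : ℂ) ^ n.toNat else 0 := by
  refine ⟨∫ s : UnitAddCircle, fourier (-m) s * ((n.toNat.factorial : ℂ)⁻¹ *
    iteratedDeriv n.toNat (fun w => f (r₁ * (AddCircle.toCircle s : ℂ), w)) 0)
      ∂AddCircle.haarAddCircle, fun r₂ h₂ => ?_⟩
  have hc := continuous_comp_torusPoint hf h₁ h₂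
  have hi : Integrable (fun t : UnitAddCircle × UnitAddCircle =>
      fourier (-m) t.1 * fourier (-n) t.2 * f (torusPoint r₁ r₂ t)) torusMeasure :=
    integrable_of_continuous ((((fourier (-m)).continuous.comp continuous_fst).mul
      ((fourier (-n)).continuous.comp continuous_snd)).mul hc)
  have hd : ∀ s : UnitAddCircle, DifferentiableOn ℂ
      (fun w => f (r₁ * (AddCircle.toCircle s : ℂ), w)) (Metric.ball 0 1) := by
    intro s
    refine hf.comp (by fun_prop) fun w hw => ?_
    rw [mem_bidisk]
    exact ⟨by simpa [abs_of_nonneg h₁.1, Circle.norm_coe] using h₁.2, by simpa using hw⟩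
  unfold torusCoeff torusMeasure at *
  rw [integral_prod _ hi]
  simp only [torusPoint, mul_assoc, integral_const_mul, hasSum_circle (hd _) h₂]
  split_ifs
  · simp_rw [← mul_assoc]
    rw [integral_mul_const]
  · simp

theorem torusCoeff_eq₁ {f : ℂ × ℂ → ℂ} (hf : DifferentiableOn ℂ f bidisk) {r₂ : ℝ}
    (h₂ : r₂ ∈ Ico (0 : ℝ) 1) (m n : ℤ) : ∃ G : ℂ, ∀ r₁ ∈ Ico (0 : ℝ) 1,
    torusCoeff f r₁ r₂ m n = if 0 ≤ m then G * (r₁ : ℂ) ^ m.toNat else 0 := by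
  have hf' : DifferentiableOn ℂ (fun x : ℂ × ℂ => f x.swap) bidisk := by
    refine hf.comp (t := bidisk) (f := Prod.swap) (by unfold Prod.swap; fun_prop) fun x hx => ?_
    rw [mem_bidisk] at hx ⊢
    exact hx.symm
  obtain ⟨G, hG⟩ := torusCoeff_eq₂ hf' h₂ n m
  refine ⟨G, fun r₁ h₁ => ?_⟩
  rw [← hG r₁ h₁]
  unfold torusCoeff torusMeasure
  rw [← integral_prod_swap]
  refine integral_congr_ae (ae_of_all _ fun t => ?_)
  simp only [torusPoint, Prod.swap]
  ring_nf

/-- The Taylor coefficient of `z ^ m w ^ n`, computed on the torus of radius `1 / 2`. -/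
def taylorCoeff (f : ℂ × ℂ → ℂ) (k : ℕ × ℕ) : ℂ :=
  2 ^ (k.1 + k.2) * torusCoeff f (1 / 2) (1 / 2) k.1 k.2

theorem torusCoeff_eq {f : ℂ × ℂ → ℂ} (hf : DifferentiableOn ℂ f bidisk) {r₁ r₂ : ℝ}
    (h₁ : r₁ ∈ Ico (0 : ℝ) 1) (h₂ : r₂ ∈ Ico (0 : ℝ) 1) (k : ℕ × ℕ) :
    torusCoeff f r₁ r₂ k.1 k.2 = taylorCoeff f k * (r₁ : ℂ) ^ k.1 * (r₂ : ℂ) ^ k.2 := by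
  have hh : (1 / 2 : ℝ) ∈ Ico (0 : ℝ) 1 := by constructor <;> norm_num
  obtain ⟨G, hG⟩ := torusCoeff_eq₂ hf h₁ k.1 k.2
  obtain ⟨G', hG'⟩ := torusCoeff_eq₁ hf hh k.1 k.2
  have e1 := hG r₂ h₂
  have e2 := hG _ hh
  have e3 := hG' r₁ h₁
  have e4 := hG' _ hh
  simp only [Int.natCast_nonneg, if_true, Int.toNat_natCast] at e1 e2 e3 e4
  have hp : ∀ j : ℕ, (((1 / 2 : ℝ) : ℂ)) ^ j * 2 ^ j = 1 := fun j => by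
    rw [← mul_pow]; norm_num
  unfold taylorCoeff
  rw [e1, e4, pow_add]
  have : G = G' * (r₁ : ℂ) ^ k.1 * 2 ^ k.2 := by
    rw [← e3, e2, mul_assoc, hp, mul_one]
  rw [this]
  linear_combination -(G' * (r₁ : ℂ) ^ k.1 * 2 ^ k.2 * (r₂ : ℂ) ^ k.2) * hp k.1

theorem torusCoeff_eq_zero {f : ℂ × ℂ → ℂ} (hf : DifferentiableOn ℂ f bidisk) {r₁ r₂ : ℝ}
    (h₁ : r₁ ∈ Ico (0 : ℝ) 1) (h₂ : r₂ ∈ Ico (0 : ℝ) 1) {m n : ℤ} (h : m < 0 ∨ n < 0) :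
    torusCoeff f r₁ r₂ m n = 0 := by
  rcases h with h | h
  · obtain ⟨G, hG⟩ := torusCoeff_eq₁ hf h₂ m n
    rw [hG r₁ h₁, if_neg (by omega)]
  · obtain ⟨G, hG⟩ := torusCoeff_eq₂ hf h₁ m n
    rw [hG r₂ h₂, if_neg (by omega)]

/-- The measure on `UnitAddTorus (Fin 2)` used in Parseval's identity. -/
theorem integral_torus {E : Type*} [NormedAddCommGroup E] [NormedSpace ℝ E]
    (g : UnitAddCircle × UnitAddCircle → E) :
    ∫ x : Fin 2 → UnitAddCircle, g (x 0, x 1) ∂(Measure.pi fun _ => AddCircle.haarAddCircle)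
      = ∫ t, g t ∂torusMeasure :=
  (measurePreserving_finTwoArrow (AddCircle.haarAddCircle : Measure UnitAddCircle)).integral_comp'
    (g := g)

/-- `f` on the torus of radii `(r₁, r₂)`, as a continuous function. -/
def torusFun {f : ℂ × ℂ → ℂ} (hf : DifferentiableOn ℂ f bidisk) {r₁ r₂ : ℝ}
    (h₁ : r₁ ∈ Ico (0 : ℝ) 1) (h₂ : r₂ ∈ Ico (0 : ℝ) 1) : C(UnitAddTorus (Fin 2), ℂ) :=
  ⟨fun x => f (torusPoint r₁ r₂ (x 0, x 1)),
    (continuous_comp_torusPoint hf h₁ h₂).comp (by fun_prop)⟩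

theorem mFourierCoeff_torusFun {f : ℂ × ℂ → ℂ} (hf : DifferentiableOn ℂ f bidisk) {r₁ r₂ : ℝ}
    (h₁ : r₁ ∈ Ico (0 : ℝ) 1) (h₂ : r₂ ∈ Ico (0 : ℝ) 1) (n : Fin 2 → ℤ) :
    UnitAddTorus.mFourierCoeff (torusFun hf h₁ h₂) n = torusCoeff f r₁ r₂ (n 0) (n 1) := by
  unfold torusCoeff
  rw [← integral_torus]
  unfold UnitAddTorus.mFourierCoeff
  refine integral_congr_ae (ae_of_all _ fun x => ?_)
  simp [UnitAddTorus.mFourier, torusFun, Fin.prod_univ_two]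

/-- The embedding of `ℕ × ℕ` in the index set of double Fourier series. -/
def idx (k : ℕ × ℕ) : Fin 2 → ℤ := ![k.1, k.2]

theorem idx_injective : Function.Injective idx := by
  intro k l h
  have h0 := congrFun h 0
  have h1 := congrFun h 1
  simp [idx] at h0 h1
  exact Prod.ext h0 h1

theorem torusCoeff_eq_zero_of_notMem {f : ℂ × ℂ → ℂ} (hf : DifferentiableOn ℂ f bidisk)
    {r₁ r₂ : ℝ} (h₁ : r₁ ∈ Ico (0 : ℝ) 1) (h₂ : r₂ ∈ Ico (0 : ℝ) 1) (n : Fin 2 → ℤ)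
    (hn : n ∉ range idx) : torusCoeff f r₁ r₂ (n 0) (n 1) = 0 := by
  apply torusCoeff_eq_zero hf h₁ h₂
  by_contra! h
  refine hn ⟨((n 0).toNat, (n 1).toNat), ?_⟩
  ext i
  fin_cases i <;> simp [idx, h.1, h.2]

/-- Parseval's identity on the torus of radii `(r₁, r₂)`. -/
theorem hasSum_sq_torus {f : ℂ × ℂ → ℂ} (hf : DifferentiableOn ℂ f bidisk) {r₁ r₂ : ℝ}
    (h₁ : r₁ ∈ Ico (0 : ℝ) 1) (h₂ : r₂ ∈ Ico (0 : ℝ) 1) :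
    HasSum (fun k : ℕ × ℕ => ‖taylorCoeff f k * (r₁ : ℂ) ^ k.1 * (r₂ : ℂ) ^ k.2‖ ^ 2)
      (∫ t, ‖f (torusPoint r₁ r₂ t)‖ ^ 2 ∂torusMeasure) := by
  have key := UnitAddTorus.hasSum_sq_mFourierCoeff (d := Fin 2)
    (ContinuousMap.toLp (E := ℂ) 2 (Measure.pi fun _ => AddCircle.haarAddCircle) ℂ
      (torusFun hf h₁ h₂))
  have e : ∀ n, UnitAddTorus.mFourierCoeff (ContinuousMap.toLp (E := ℂ) 2
      (Measure.pi fun _ => AddCircle.haarAddCircle) ℂ (torusFun hf h₁ h₂)) n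
      = torusCoeff f r₁ r₂ (n 0) (n 1) := fun n =>
    (UnitAddTorus.mFourierCoeff_toLp (torusFun hf h₁ h₂) n).trans
      (mFourierCoeff_torusFun hf h₁ h₂ n)
  simp_rw [e] at key
  rw [← idx_injective.hasSum_iff (fun n hn => by
    rw [torusCoeff_eq_zero_of_notMem hf h₁ h₂ n hn]; simp)] at key
  convert key using 1
  · ext k
    rw [← torusCoeff_eq hf h₁ h₂ k]
    simp [idx]
  · rw [← integral_torus]
    refine integral_congr_ae ?_
    filter_upwards [ContinuousMap.coeFn_toLp (E := ℂ) (p := 2) (𝕜 := ℂ)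
      (Measure.pi fun _ => AddCircle.haarAddCircle) (torusFun hf h₁ h₂)] with x hx
    rw [hx]
    rfl

/-- A holomorphic function on the bidisk vanishes if its Taylor coefficients do. -/
theorem eq_zero_of_taylorCoeff {f : ℂ × ℂ → ℂ} (hf : DifferentiableOn ℂ f bidisk)
    (h : ∀ k, taylorCoeff f k = 0) {x : ℂ × ℂ} (hx : x ∈ bidisk) : f x = 0 := by
  rw [mem_bidisk] at hx
  have h₁ : ‖x.1‖ ∈ Ico (0 : ℝ) 1 := ⟨norm_nonneg _, hx.1⟩
  have h₂ : ‖x.2‖ ∈ Ico (0 : ℝ) 1 := ⟨norm_nonneg _, hx.2⟩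
  have hz : ∀ n, UnitAddTorus.mFourierCoeff (torusFun hf h₁ h₂) n = 0 := by
    intro n
    rw [mFourierCoeff_torusFun]
    by_cases hn : n ∈ range idx
    · obtain ⟨k, rfl⟩ := hn
      have := torusCoeff_eq hf h₁ h₂ k
      rw [h k, zero_mul, zero_mul] at this
      simpa [idx] using this
    · exact torusCoeff_eq_zero_of_notMem hf h₁ h₂ n hn
  have hs : Summable (UnitAddTorus.mFourierCoeff (torusFun hf h₁ h₂)) := by
    rw [funext hz]; exact summable_zero
  have harg : ∀ z : ℂ, ∃ t : UnitAddCircle, (‖z‖ : ℂ) * (AddCircle.toCircle t : ℂ) = z := by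
    intro z
    obtain ⟨t, ht⟩ := (AddCircle.homeomorphCircle (T := 1) one_ne_zero).surjective
      (Circle.exp z.arg)
    refine ⟨t, ?_⟩
    rw [AddCircle.homeomorphCircle_apply] at ht
    rw [ht, Circle.coe_exp]
    exact Complex.norm_mul_exp_arg_mul_I z
  obtain ⟨s, hs1⟩ := harg x.1
  obtain ⟨t, ht1⟩ := harg x.2
  have := UnitAddTorus.hasSum_mFourier_series_apply_of_summable hs ![s, t]
  simp_rw [hz, zero_smul] at this
  have h0 := this.unique hasSum_zero
  simpa [torusFun, torusPoint, hs1, ht1] using h0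

theorem sum_sq_taylorCoeff_le {f : ℂ × ℂ → ℂ} (hf : DifferentiableOn ℂ f bidisk) {C : ℝ}
    (hC : ∀ r ∈ Ico (0 : ℝ) 1, torusMean f r ≤ C) (s : Finset (ℕ × ℕ)) :
    ∑ k ∈ s, ‖taylorCoeff f k‖ ^ 2 ≤ C := by
  have hlim : Tendsto (fun r : ℝ => ∑ k ∈ s, ‖taylorCoeff f k * (r : ℂ) ^ k.1 * (r : ℂ) ^ k.2‖ ^ 2)
      (𝓝[<] 1) (𝓝 (∑ k ∈ s, ‖taylorCoeff f k‖ ^ 2)) := by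
    have hc : Continuous (fun r : ℝ =>
        ∑ k ∈ s, ‖taylorCoeff f k * (r : ℂ) ^ k.1 * (r : ℂ) ^ k.2‖ ^ 2) := by fun_prop
    have := (hc.tendsto 1).mono_left (nhdsWithin_le_nhds (s := Iio 1))
    simpa using this
  refine le_of_tendsto hlim ?_
  filter_upwards [Ico_mem_nhdsLT (zero_lt_one (α := ℝ))] with r hr
  exact (sum_le_hasSum s (fun _ _ => by positivity) (hasSum_sq_torus hf hr hr)).trans (hC r hr)

theorem summable_sq_taylorCoeff {f : ℂ × ℂ → ℂ} (hf : DifferentiableOn ℂ f bidisk) {C : ℝ}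
    (hC : ∀ r ∈ Ico (0 : ℝ) 1, torusMean f r ≤ C) : Summable fun k => ‖taylorCoeff f k‖ ^ 2 :=
  summable_of_sum_le (fun _ => by positivity) (sum_sq_taylorCoeff_le hf hC)

theorem torusMean_le {f : ℂ × ℂ → ℂ} (hf : DifferentiableOn ℂ f bidisk)
    (hs : Summable fun k => ‖taylorCoeff f k‖ ^ 2) {r : ℝ} (hr : r ∈ Ico (0 : ℝ) 1) :
    torusMean f r ≤ ∑' k, ‖taylorCoeff f k‖ ^ 2 := by
  refine hasSum_le (fun k => ?_) (hasSum_sq_torus hf hr hr) hs.hasSum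
  have h1 : ‖(r : ℂ)‖ ≤ 1 := by simpa [abs_of_nonneg hr.1] using hr.2.le
  rw [norm_mul, norm_mul, norm_pow, norm_pow]
  gcongr
  calc ‖taylorCoeff f k‖ * ‖(r : ℂ)‖ ^ k.1 * ‖(r : ℂ)‖ ^ k.2
      ≤ ‖taylorCoeff f k‖ * 1 * 1 := by
        gcongr
        · exact pow_le_one₀ (norm_nonneg _) h1
        · exact pow_le_one₀ (norm_nonneg _) h1
    _ = ‖taylorCoeff f k‖ := by ring

/-- The sum of a double power series on the bidisk, extended by zero. -/
def powerSum (a : ℕ × ℕ → ℂ) : ℂ × ℂ → ℂ :=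
  bidisk.indicator fun x => ∑' k : ℕ × ℕ, a k * (x.1 ^ k.1 * x.2 ^ k.2)

theorem summable_geom {ρ : ℝ} (h0 : 0 ≤ ρ) (h1 : ρ < 1) :
    Summable fun k : ℕ × ℕ => ρ ^ k.1 * ρ ^ k.2 :=
  (summable_geometric_of_lt_one h0 h1).mul_of_nonneg (summable_geometric_of_lt_one h0 h1)
    (fun _ => by positivity) (fun _ => by positivity)

theorem summable_geom' {ρ : ℝ} (h0 : 0 ≤ ρ) (h1 : ρ < 1) :
    Summable fun n : ℕ => (n : ℝ) * ρ ^ (n - 1) := by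
  rw [← summable_nat_add_iff 1]
  have h2 := summable_pow_mul_geometric_of_norm_lt_one 1
    (by rwa [Real.norm_of_nonneg h0] : ‖ρ‖ < 1)
  refine (h2.add (summable_geometric_of_lt_one h0 h1)).congr fun n => ?_
  push_cast
  simp
  ring

theorem differentiableOn_powerSum {a : ℕ × ℕ → ℂ} {C : ℝ} (hC : ∀ k, ‖a k‖ ≤ C) :
    DifferentiableOn ℂ (powerSum a) bidisk := by
  have hC0 : 0 ≤ C := (norm_nonneg _).trans (hC 0)
  intro x hx
  have hx' := mem_bidisk.1 hx
  have hxn : ‖x‖ < 1 := max_lt hx'.1 hx'.2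
  obtain ⟨ρ, hρ, hρ1⟩ := exists_between hxn
  have h0 : 0 ≤ ρ := (norm_nonneg _).trans hρ.le
  let f' : ℕ × ℕ → ℂ × ℂ → (ℂ × ℂ →L[ℂ] ℂ) := fun k y =>
    a k • ((y.1 ^ k.1) • (((k.2 : ℂ) * y.2 ^ (k.2 - 1)) • ContinuousLinearMap.snd ℂ ℂ ℂ)
      + (y.2 ^ k.2) • (((k.1 : ℂ) * y.1 ^ (k.1 - 1)) • ContinuousLinearMap.fst ℂ ℂ ℂ))
  have hd : ∀ k y, HasFDerivAt (fun y : ℂ × ℂ => a k * (y.1 ^ k.1 * y.2 ^ k.2)) (f' k y) y := by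
    intro k y
    have e1 : HasFDerivAt (fun y : ℂ × ℂ => y.1 ^ k.1)
        (((k.1 : ℂ) * y.1 ^ (k.1 - 1)) • ContinuousLinearMap.fst ℂ ℂ ℂ) y :=
      (hasDerivAt_pow k.1 y.1).comp_hasFDerivAt y hasFDerivAt_fst
    have e2 : HasFDerivAt (fun y : ℂ × ℂ => y.2 ^ k.2)
        (((k.2 : ℂ) * y.2 ^ (k.2 - 1)) • ContinuousLinearMap.snd ℂ ℂ ℂ) y :=
      (hasDerivAt_pow k.2 y.2).comp_hasFDerivAt y hasFDerivAt_snd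
    exact (e1.mul e2).const_mul (a k)
  let u : ℕ × ℕ → ℝ := fun k =>
    C * (ρ ^ k.1 * ((k.2 : ℝ) * ρ ^ (k.2 - 1)) + ((k.1 : ℝ) * ρ ^ (k.1 - 1)) * ρ ^ k.2)
  have hg := summable_geometric_of_lt_one h0 hρ1
  have hg' := summable_geom' h0 hρ1
  have hu : Summable u :=
    ((hg.mul_of_nonneg hg' (fun _ => by positivity) (fun _ => by positivity)).add
      (hg'.mul_of_nonneg hg (fun _ => by positivity) (fun _ => by positivity))).mul_left C
  have hb : ∀ k, ∀ y ∈ Metric.ball (0 : ℂ × ℂ) ρ, ‖f' k y‖ ≤ u k := by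
    intro k y hy
    rw [mem_ball_zero_iff] at hy
    have y1 : ‖y.1‖ ≤ ρ := (norm_fst_le y).trans hy.le
    have y2 : ‖y.2‖ ≤ ρ := (norm_snd_le y).trans hy.le
    simp only [f', u, norm_smul]
    refine mul_le_mul (hC k) ((norm_add_le _ _).trans (add_le_add ?_ ?_)) (norm_nonneg _) hC0
    · rw [norm_smul, norm_smul, norm_mul, norm_pow, norm_pow, Complex.norm_natCast]
      have := ContinuousLinearMap.norm_snd_le ℂ ℂ ℂ
      calc ‖y.1‖ ^ k.1 * ((k.2 : ℝ) * ‖y.2‖ ^ (k.2 - 1) * ‖ContinuousLinearMap.snd ℂ ℂ ℂ‖)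
          ≤ ρ ^ k.1 * ((k.2 : ℝ) * ρ ^ (k.2 - 1) * 1) := by gcongr
        _ = _ := by ring
    · rw [norm_smul, norm_smul, norm_mul, norm_pow, norm_pow, Complex.norm_natCast]
      have := ContinuousLinearMap.norm_fst_le ℂ ℂ ℂ
      calc ‖y.2‖ ^ k.2 * ((k.1 : ℝ) * ‖y.1‖ ^ (k.1 - 1) * ‖ContinuousLinearMap.fst ℂ ℂ ℂ‖)
          ≤ ρ ^ k.2 * ((k.1 : ℝ) * ρ ^ (k.1 - 1) * 1) := by gcongr
        _ = _ := by ring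
  have h00 : Summable fun k : ℕ × ℕ => a k * ((0 : ℂ × ℂ).1 ^ k.1 * (0 : ℂ × ℂ).2 ^ k.2) := by
    refine summable_of_ne_finset_zero (s := {0}) fun k hk => ?_
    have : k.1 ≠ 0 ∨ k.2 ≠ 0 := by
      by_contra! h
      exact hk (by simpa using Prod.ext h.1 h.2)
    rcases this with h | h <;> simp [h]
  have hρ0 : (0 : ℂ × ℂ) ∈ Metric.ball (0 : ℂ × ℂ) ρ :=
    Metric.mem_ball_self ((norm_nonneg _).trans_lt hρ)
  have key := hasFDerivAt_tsum_of_isPreconnected hu Metric.isOpen_ball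
    (convex_ball (0 : ℂ × ℂ) ρ).isPreconnected (fun k y _ => hd k y) hb hρ0 h00
    (x := x) (by simpa using hρ)
  have hev : powerSum a =ᶠ[𝓝 x] fun y => ∑' k : ℕ × ℕ, a k * (y.1 ^ k.1 * y.2 ^ k.2) := by
    filter_upwards [isOpen_bidisk.mem_nhds hx] with y hy
    simp [powerSum, hy]
  exact (key.congr_of_eventuallyEq hev).differentiableAt.differentiableWithinAt

theorem taylorCoeff_powerSum {a : ℕ × ℕ → ℂ} {C : ℝ} (hC : ∀ k, ‖a k‖ ≤ C) (k : ℕ × ℕ) :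
    taylorCoeff (powerSum a) k = a k := by
  have hC0 : 0 ≤ C := (norm_nonneg _).trans (hC 0)
  have hh : (1 / 2 : ℝ) ∈ Ico (0 : ℝ) 1 := by constructor <;> norm_num
  let h : ℂ := ((1 / 2 : ℝ) : ℂ)
  let F : ℕ × ℕ → UnitAddCircle × UnitAddCircle → ℂ := fun l t =>
    (a l * (h ^ l.1 * h ^ l.2)) * ((fourier (-(k.1 : ℤ)) t.1 * fourier (l.1 : ℤ) t.1) *
      (fourier (-(k.2 : ℤ)) t.2 * fourier (l.2 : ℤ) t.2))
  have hcont : ∀ l, Continuous (F l) := fun l =>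
    continuous_const.mul (((((fourier _).continuous.comp continuous_fst)).mul
      ((fourier _).continuous.comp continuous_fst)).mul
      ((((fourier _).continuous.comp continuous_snd)).mul
      ((fourier _).continuous.comp continuous_snd)))
  have hnorm : ∀ l t, ‖F l t‖ = ‖a l * (h ^ l.1 * h ^ l.2)‖ := by
    intro l t
    simp [F, fourier_apply, Circle.norm_coe]
  have hsum : Summable fun l => ‖a l * (h ^ l.1 * h ^ l.2)‖ := by
    refine Summable.of_nonneg_of_le (fun _ => norm_nonneg _) (fun l => ?_)
      ((summable_geom hh.1 hh.2).mul_left C)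
    rw [norm_mul]
    refine mul_le_mul (hC l) (le_of_eq ?_) (norm_nonneg _) hC0
    simp [h]
  have key := hasSum_integral_of_summable_integral_norm (μ := torusMeasure) (F := F)
    (fun l => integrable_of_continuous (hcont l)) (by simpa [hnorm] using hsum)
  have hF : ∀ t, ∑' l, F l t = fourier (-(k.1 : ℤ)) t.1 * fourier (-(k.2 : ℤ)) t.2 *
      powerSum a (torusPoint (1 / 2) (1 / 2) t) := by
    intro t
    rw [powerSum, indicator_of_mem (torusPoint_mem hh hh t), ← tsum_mul_left]
    refine tsum_congr fun l => ?_
    simp only [F, torusPoint, mul_pow, toCircle_pow, h]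
    ring
  have hval : ∀ l, ∫ t, F l t ∂torusMeasure =
      if l = k then a k * (h ^ k.1 * h ^ k.2) else 0 := by
    intro l
    simp only [F]
    rw [integral_const_mul, torusMeasure, integral_prod_mul
      (fun s : UnitAddCircle => fourier (-(k.1 : ℤ)) s * fourier (l.1 : ℤ) s)
      (fun s : UnitAddCircle => fourier (-(k.2 : ℤ)) s * fourier (l.2 : ℤ) s),
      integral_fourier_mul, integral_fourier_mul]
    by_cases hl : l = k
    · subst hl; simp
    · rw [if_neg hl]
      have : ¬ ((k.1 : ℤ) = l.1) ∨ ¬ ((k.2 : ℤ) = l.2) := by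
        by_contra! hc
        exact hl (Prod.ext (by exact_mod_cast hc.1.symm) (by exact_mod_cast hc.2.symm))
      rcases this with hc | hc <;> simp only [if_neg hc] <;> ring
  simp_rw [hF, hval] at key
  have e := key.unique (hasSum_ite_eq k _)
  have hp : ∀ j : ℕ, h ^ j * 2 ^ j = 1 := fun j => by
    rw [← mul_pow]; norm_num [h]
  unfold taylorCoeff torusCoeff
  rw [e, pow_add]
  linear_combination (a k * h ^ k.2 * 2 ^ k.2) * hp k.1 + a k * hp k.2

/-- The space of functions underlying `H²(𝔻²)`: all holomorphic `f` on `𝔻²` such that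
`sup_{0 ≤ r < 1} ∫_{𝕋²} |f(rz, rw)|² dm < ∞`.  A function on the bidisk is represented by its
extension by zero to `ℂ²`. -/
def hardySubmodule : Submodule ℂ (ℂ × ℂ → ℂ) where
  carrier := {f | DifferentiableOn ℂ f bidisk ∧ (∀ x ∉ bidisk, f x = 0) ∧
    ∃ C : ℝ, ∀ r ∈ Ico (0 : ℝ) 1, torusMean f r ≤ C}
  zero_mem' := ⟨differentiableOn_const 0, fun _ _ => rfl, 0, fun r _ => by simp [torusMean]⟩
  add_mem' := by
    rintro f g ⟨hf, hf0, C, hC⟩ ⟨hg, hg0, D, hD⟩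
    refine ⟨hf.add hg, fun x hx => by simp [hf0 x hx, hg0 x hx], 2 * C + 2 * D, fun r hr => ?_⟩
    have cf := continuous_comp_torusPoint hf hr hr
    have cg := continuous_comp_torusPoint hg hr hr
    have i1 : Integrable (fun t => ‖f (torusPoint r r t)‖ ^ 2) torusMeasure :=
      integrable_of_continuous (cf.norm.pow 2)
    have i2 : Integrable (fun t => ‖g (torusPoint r r t)‖ ^ 2) torusMeasure :=
      integrable_of_continuous (cg.norm.pow 2)
    calc torusMean (f + g) r
        ≤ ∫ t, (2 * ‖f (torusPoint r r t)‖ ^ 2 + 2 * ‖g (torusPoint r r t)‖ ^ 2)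
            ∂torusMeasure := by
          refine integral_mono (integrable_of_continuous ((cf.add cg).norm.pow 2))
            ((i1.const_mul 2).add (i2.const_mul 2)) fun t => ?_
          have := norm_add_le (f (torusPoint r r t)) (g (torusPoint r r t))
          have h3 := norm_nonneg (f (torusPoint r r t) + g (torusPoint r r t))
          simp only [Pi.add_apply]
          nlinarith [sq_nonneg (‖f (torusPoint r r t)‖ - ‖g (torusPoint r r t)‖)]
      _ = 2 * torusMean f r + 2 * torusMean g r := by
          rw [integral_add (i1.const_mul 2) (i2.const_mul 2), integral_const_mul,
            integral_const_mul]
          rfl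
      _ ≤ 2 * C + 2 * D := by linarith [hC r hr, hD r hr]
  smul_mem' := by
    rintro c f ⟨hf, hf0, C, hC⟩
    refine ⟨hf.const_smul c, fun x hx => by simp [hf0 x hx], ‖c‖ ^ 2 * C, fun r hr => ?_⟩
    have : torusMean (c • f) r = ‖c‖ ^ 2 * torusMean f r := by
      simp only [torusMean, Pi.smul_apply, norm_smul, mul_pow, integral_const_mul]
    rw [this]
    exact mul_le_mul_of_nonneg_left (hC r hr) (by positivity)

/-- The Hardy space `H²(𝔻²)` of holomorphic functions on the bidisk with
`‖f‖² = sup_{0 ≤ r < 1} ∫_{𝕋²} |f(rz, rw)|² dm < ∞`. -/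
def HardySpace : Type := hardySubmodule

namespace HardySpace

instance : AddCommGroup HardySpace := inferInstanceAs (AddCommGroup hardySubmodule)

instance : Module ℂ HardySpace := inferInstanceAs (Module ℂ hardySubmodule)

instance : CoeFun HardySpace fun _ => ℂ × ℂ → ℂ := ⟨Subtype.val⟩

theorem differentiableOn (f : HardySpace) : DifferentiableOn ℂ f bidisk := f.2.1

theorem eq_zero_of_notMem (f : HardySpace) {x : ℂ × ℂ} (hx : x ∉ bidisk) : f x = 0 := f.2.2.1 x hx

theorem add_apply (f g : HardySpace) (x : ℂ × ℂ) : (f + g) x = f x + g x := rfl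

theorem smul_apply (c : ℂ) (f : HardySpace) (x : ℂ × ℂ) : (c • f) x = c * f x := rfl

theorem zero_apply (x : ℂ × ℂ) : (0 : HardySpace) x = 0 := rfl

theorem ext {f g : HardySpace} (h : ∀ x ∈ bidisk, f x = g x) : f = g := by
  apply Subtype.ext
  funext x
  by_cases hx : x ∈ bidisk
  · exact h x hx
  · exact (f.eq_zero_of_notMem hx).trans (g.eq_zero_of_notMem hx).symm

theorem summable_sq (f : HardySpace) : Summable fun k => ‖taylorCoeff f k‖ ^ 2 :=
  let ⟨_, hC⟩ := f.2.2.2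
  summable_sq_taylorCoeff f.differentiableOn hC

theorem torusCoeff_add (f g : HardySpace) {r : ℝ} (hr : r ∈ Ico (0 : ℝ) 1) (m n : ℤ) :
    torusCoeff (f + g : HardySpace) r r m n = torusCoeff f r r m n + torusCoeff g r r m n := by
  have hi : ∀ f : HardySpace, Integrable (fun t : UnitAddCircle × UnitAddCircle =>
      fourier (-m) t.1 * fourier (-n) t.2 * f (torusPoint r r t)) torusMeasure := fun f =>
    integrable_of_continuous ((((fourier (-m)).continuous.comp continuous_fst).mul
      ((fourier (-n)).continuous.comp continuous_snd)).mul
      (continuous_comp_torusPoint f.differentiableOn hr hr))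
  unfold torusCoeff
  rw [← integral_add (hi f) (hi g)]
  simp only [add_apply, mul_add]

/-- The family of Taylor coefficients of `f`, as an element of `ℓ²(ℕ × ℕ)`. -/
def coeffSeq (f : HardySpace) : lp (fun _ : ℕ × ℕ => ℂ) 2 :=
  ⟨taylorCoeff f, memℓp_gen (by simpa using f.summable_sq)⟩

theorem coeffSeq_apply (f : HardySpace) (k : ℕ × ℕ) : coeffSeq f k = taylorCoeff f k := rfl

theorem coeffSeq_add (f g : HardySpace) : coeffSeq (f + g) = coeffSeq f + coeffSeq g := by
  ext k
  rw [lp.coeFn_add, Pi.add_apply, coeffSeq_apply, coeffSeq_apply, coeffSeq_apply]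
  unfold taylorCoeff
  rw [torusCoeff_add f g (by constructor <;> norm_num), mul_add]

theorem coeffSeq_smul (c : ℂ) (f : HardySpace) : coeffSeq (c • f) = c • coeffSeq f := by
  ext k
  rw [lp.coeFn_smul, Pi.smul_apply, coeffSeq_apply, coeffSeq_apply]
  simp only [taylorCoeff, torusCoeff, smul_apply, smul_eq_mul]
  simp_rw [mul_left_comm _ c]
  rw [integral_const_mul, mul_left_comm]

/-- The Taylor coefficients, as a linear bijection from `H²(𝔻²)` to `ℓ²(ℕ × ℕ)`. -/
def coeffEquiv : HardySpace ≃ₗ[ℂ] lp (fun _ : ℕ × ℕ => ℂ) 2 :=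
  LinearEquiv.ofBijective ⟨⟨coeffSeq, coeffSeq_add⟩, coeffSeq_smul⟩ <| by
    constructor
    · rw [← LinearMap.ker_eq_bot, LinearMap.ker_eq_bot']
      intro f hf
      refine ext fun x hx => eq_zero_of_taylorCoeff f.differentiableOn (fun k => ?_) hx
      exact congrFun (congrArg Subtype.val hf) k
    · intro a
      have hC : ∀ k, ‖a k‖ ≤ ‖a‖ := fun k => lp.norm_apply_le_norm two_ne_zero a k
      have hs : Summable fun k => ‖taylorCoeff (powerSum a) k‖ ^ 2 := by
        simp_rw [taylorCoeff_powerSum hC]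
        simpa using (lp.memℓp a).summable (by simp)
      refine ⟨⟨powerSum a, differentiableOn_powerSum hC, fun x hx => by simp [powerSum, hx],
        _, fun r hr => torusMean_le (differentiableOn_powerSum hC) hs hr⟩, ?_⟩
      ext k
      exact taylorCoeff_powerSum hC k

theorem coeffEquiv_apply (f : HardySpace) (k : ℕ × ℕ) : coeffEquiv f k = taylorCoeff f k := rfl

instance : Norm HardySpace := ⟨fun f => √(⨆ r : Ico (0 : ℝ) 1, torusMean f r)⟩

theorem norm_def (f : HardySpace) : ‖f‖ = √(⨆ r : Ico (0 : ℝ) 1, torusMean f r) := rfl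

theorem bddAbove_torusMean (f : HardySpace) :
    BddAbove (range fun r : Ico (0 : ℝ) 1 => torusMean f r) := by
  obtain ⟨C, hC⟩ := f.2.2.2
  exact ⟨C, by rintro _ ⟨r, rfl⟩; exact hC r r.2⟩

theorem norm_coeffEquiv (f : HardySpace) : ‖coeffEquiv f‖ = ‖f‖ := by
  have : Nonempty (Ico (0 : ℝ) 1) := ⟨⟨0, by simp⟩⟩
  have h1 : ‖coeffEquiv f‖ ^ 2 = ∑' k, ‖taylorCoeff f k‖ ^ 2 := by
    have := lp.norm_rpow_eq_tsum (p := 2) (by simp) (coeffEquiv f)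
    simpa [coeffEquiv_apply] using this
  have h2 : ⨆ r : Ico (0 : ℝ) 1, torusMean f r = ∑' k, ‖taylorCoeff f k‖ ^ 2 := by
    apply le_antisymm
    · exact ciSup_le fun r => torusMean_le f.differentiableOn f.summable_sq r.2
    · refine f.summable_sq.tsum_le_of_sum_le fun s => ?_
      exact sum_sq_taylorCoeff_le f.differentiableOn
        (fun r hr => le_ciSup f.bddAbove_torusMean ⟨r, hr⟩) s
  rw [norm_def, h2, ← h1, Real.sqrt_sq (norm_nonneg _)]

instance : NormedAddCommGroup HardySpace where
  dist f g := ‖-f + g‖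
  dist_self f := by simp [← norm_coeffEquiv]
  dist_comm f g := by
    rw [← norm_coeffEquiv, ← norm_coeffEquiv, ← norm_neg (coeffEquiv (-g + f)), ← map_neg]
    congr 2
    abel
  dist_triangle f g h := by
    rw [← norm_coeffEquiv, ← norm_coeffEquiv, ← norm_coeffEquiv]
    refine le_trans (le_of_eq ?_) (norm_add_le _ _)
    rw [← map_add]
    congr 2
    abel
  eq_of_dist_eq_zero {f g} h := by
    rw [← norm_coeffEquiv, norm_eq_zero, map_eq_zero_iff _ coeffEquiv.injective,
      neg_add_eq_zero] at h
    exact h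
  dist_eq _ _ := rfl

/-- The inner product of `H²(𝔻²)`, written through Taylor coefficients; the norm that it induces is
the norm `√(sup_r ∫ |f(rz, rw)|² dm)`. -/
instance : InnerProductSpace ℂ HardySpace where
  inner f g := inner ℂ (coeffEquiv f) (coeffEquiv g)
  norm_smul_le c f := by
    rw [← norm_coeffEquiv, ← norm_coeffEquiv, map_smul, norm_smul]
  norm_sq_eq_re_inner f := by
    rw [← norm_coeffEquiv]; exact norm_sq_eq_re_inner (𝕜 := ℂ) _
  conj_inner_symm f g := inner_conj_symm _ _
  add_left f g h := by rw [map_add, inner_add_left]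
  smul_left f g c := by rw [map_smul, inner_smul_left]

/-- `H²(𝔻²)` and `ℓ²(ℕ × ℕ)` are isometrically isomorphic through Taylor coefficients. -/
def coeffIsometry : HardySpace ≃ₗᵢ[ℂ] lp (fun _ : ℕ × ℕ => ℂ) 2 :=
  ⟨coeffEquiv, norm_coeffEquiv⟩

instance : CompleteSpace HardySpace :=
  (completeSpace_congr (e := coeffIsometry.toEquiv) coeffIsometry.isometry.isUniformEmbedding).2
    inferInstance

theorem torusMean_mul_fst_le (f : HardySpace) {r : ℝ} (hr : r ∈ Ico (0 : ℝ) 1) :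
    torusMean (fun x => x.1 * f x) r ≤ torusMean f r := by
  have hc := continuous_comp_torusPoint f.differentiableOn hr hr
  refine integral_mono (integrable_of_continuous
    (((continuous_fst.comp (continuous_torusPoint r r)).mul hc).norm.pow 2))
    (integrable_of_continuous (hc.norm.pow 2)) fun t => ?_
  have h1 := (mem_bidisk.1 (torusPoint_mem hr hr t)).1
  simp only [norm_mul]
  gcongr
  exact mul_le_of_le_one_left (norm_nonneg _) h1.le

theorem mul_fst_mem (f : HardySpace) : (fun x : ℂ × ℂ => x.1 * f x) ∈ hardySubmodule := by
  obtain ⟨C, hC⟩ := f.2.2.2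
  refine ⟨differentiableOn_fst.mul f.differentiableOn,
    fun x hx => by simp [f.eq_zero_of_notMem hx], C, fun r hr => (?_ : _ ≤ _).trans (hC r hr)⟩
  exact torusMean_mul_fst_le f hr

/-- Multiplication by the coordinate function `z` on `H²(𝔻²)`. -/
def shiftZ : HardySpace →L[ℂ] HardySpace :=
  LinearMap.mkContinuous
    { toFun := fun f => (⟨fun x => x.1 * f x, f.mul_fst_mem⟩ : hardySubmodule)
      map_add' := fun f g => ext fun x _ => mul_add _ _ _
      map_smul' := fun c f => ext fun x _ => mul_left_comm _ _ _ } 1 <| by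
    intro f
    rw [one_mul]
    exact Real.sqrt_le_sqrt (ciSup_mono f.bddAbove_torusMean
      fun r => torusMean_mul_fst_le f r.2)

theorem shiftZ_apply (f : HardySpace) (x : ℂ × ℂ) : shiftZ f x = x.1 * f x := rfl

end HardySpace

/-- The submodule `θ H²(𝔻²)` of `H²(𝔻²)`. -/
def multiples (θ : HardySpace) : Submodule ℂ HardySpace where
  carrier := {f | ∃ h : HardySpace, ∀ x ∈ bidisk, f x = θ x * h x}
  zero_mem' := ⟨0, fun x _ => by simp [HardySpace.zero_apply]⟩
  add_mem' := by
    rintro f g ⟨h, hh⟩ ⟨k, hk⟩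
    exact ⟨h + k, fun x hx => by
      rw [HardySpace.add_apply, HardySpace.add_apply, hh x hx, hk x hx, mul_add]⟩
  smul_mem' := by
    rintro c f ⟨h, hh⟩
    exact ⟨c • h, fun x hx => by
      rw [HardySpace.smul_apply, HardySpace.smul_apply, hh x hx, mul_left_comm]⟩

/-- The quotient module `K_θ = H²(𝔻²) ⊖ θ H²(𝔻²)`. -/
def quotientModule (θ : HardySpace) : Submodule ℂ HardySpace := (multiples θ)ᗮ

instance (θ : HardySpace) : CompleteSpace (quotientModule θ) :=
  inferInstanceAs (CompleteSpace ((multiples θ)ᗮ : Submodule ℂ HardySpace))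

/-- The compressed shift `S_z = P T_z |_{K_θ}`, where `P` is the orthogonal projection onto `K_θ`. -/
def compressedShift (θ : HardySpace) : quotientModule θ →L[ℂ] quotientModule θ :=
  (quotientModule θ).orthogonalProjectionOnto ∘L HardySpace.shiftZ ∘L (quotientModule θ).subtypeL

/-- `θ ∈ H²(𝔻²)` is inner if its radial boundary values on `𝕋²` are unimodular almost everywhere. -/
def IsInner (θ : HardySpace) : Prop :=
  ∀ᵐ t ∂torusMeasure, ∃ c : ℂ, ‖c‖ = 1 ∧
    Tendsto (fun r : ℝ => θ (torusPoint r r t)) (𝓝[<] 1) (𝓝 c)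

/-- `θ` is the restriction to `𝔻²` of a rational function `q / p` in two variables. -/
def IsRational (θ : HardySpace) : Prop :=
  ∃ p q : MvPolynomial (Fin 2) ℂ, p ≠ 0 ∧
    ∀ x ∈ bidisk, θ x * MvPolynomial.eval ![x.1, x.2] p = MvPolynomial.eval ![x.1, x.2] q

/-- `θ` is constant on `𝔻²`. -/
def IsConst (θ : HardySpace) : Prop := ∃ c : ℂ, ∀ x ∈ bidisk, θ x = c

/-- `θ` depends only on the variable `z`. -/
def DependsOnlyOnZ (θ : HardySpace) : Prop :=
  ∃ g : ℂ → ℂ, ∀ x ∈ bidisk, θ x = g x.1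

/-- `θ` has a (nonconstant) inner factor depending only on `z`. -/
def HasInnerFactorInZ (θ : HardySpace) : Prop :=
  ∃ φ ψ : HardySpace, IsInner φ ∧ IsInner ψ ∧ ¬ IsConst φ ∧ DependsOnlyOnZ φ ∧
    ∀ x ∈ bidisk, θ x = φ x * ψ x

/-- `f` has exactly `n` zeros in the open unit disk, counted with multiplicity. -/
def HasZeroCount (f : ℂ → ℂ) (n : ℕ) : Prop :=
  ∃ s : Finset ℂ, (∀ w, w ∈ s ↔ w ∈ Metric.ball (0 : ℂ) 1 ∧ f w = 0) ∧
    ∑ w ∈ s, analyticOrderAt f w = n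

/-- The essential spectrum: all `l` such that `T - l` is not a Fredholm operator. -/
def essentialSpectrum {H : Type*} [NormedAddCommGroup H] [InnerProductSpace ℂ H]
    (T : H →L[ℂ] H) : Set ℂ :=
  {l | ¬ (T - l • ContinuousLinearMap.id ℂ H).IsFredholm}

/-- The complex conjugate `Ω^*` of a set of complex numbers. -/
def conjSet (Ω : Set ℂ) : Set ℂ := (starRingEnd ℂ) '' Ω

/-- `(Ωᵢ)` lists the connected components of `Ω`, each exactly once. -/
def EnumeratesComponents {ι : Type*} (Ω : Set ℂ) (Ωc : ι → Set ℂ) : Prop :=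
  Function.Injective Ωc ∧ range Ωc = {C | ∃ x ∈ Ω, C = connectedComponentIn Ω x}

/-- The generalized Cowen–Douglas class `𝔅_α(Ω)`, where `Ω` is a nonempty bounded open set with
connected components `(Ωᵢ)` and `α = (αᵢ)` is a family of positive integers. -/
structure GeneralizedCowenDouglas {H : Type*} [NormedAddCommGroup H] [InnerProductSpace ℂ H]
    {ι : Type*} (Ω : Set ℂ) (Ωc : ι → Set ℂ) (α : ι → ℕ) (T : H →L[ℂ] H) : Prop where
  complete : CompleteSpace H
  separable : TopologicalSpace.SeparableSpace H
  isOpen : IsOpen Ω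
  isBounded : Bornology.IsBounded Ω
  nonempty : Ω.Nonempty
  components : EnumeratesComponents Ω Ωc
  index_pos : ∀ i, 0 < α i
  range_eq : ∀ l ∈ Ω, (T - l • ContinuousLinearMap.id ℂ H).range = ⊤
  span_ker : (⨆ l ∈ Ω, (T - l • ContinuousLinearMap.id ℂ H).ker).topologicalClosure = ⊤
  rank_ker : ∀ i, ∀ l ∈ Ωc i, Module.rank ℂ (T - l • ContinuousLinearMap.id ℂ H).ker = α i

end HardyBidisk

end

open HardyBidisk

/-
The eigenvectors of `S_z^*` for the eigenvalue `conj l` form the orthogonal complement of the range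
of `S_z - l`, so everything is read off from the operators `S_z - l`. For `|l| ≥ 1` such an operator
is bijective as soon as it is Fredholm, because `S_z` is a contraction and has no unimodular
eigenvalue. For `|l| < 1` it is injective, since `θ(l, ·)` is not identically zero (otherwise a
Blaschke factor in `z` divides `θ`), and its cokernel is the space `H²(𝔻²) / (θ H² + (z - l) H²)` of
functions on the line `z = l` modulo the multiples of `θ(l, ·)`. If finite, the dimension of this
space is the number of zeros of `θ(l, ·)`, and it is locally constant in `l` by stability of
injective Fredholm operators.

For the completeness of the eigenvectors, write `θ = q / p` with `|p| = |q|` on `𝕋²`. The cokernel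
is finite-dimensional whenever `q(l, ·)` has no zeros on `𝕋`, which holds for a dense set of `l`. An
element of `K_θ` orthogonal to all eigenvectors is then divisible by `θ` on a dense set of lines,
hence on `𝔻²`, where Cauchy's integral formula on circles avoiding the zeros of `θ` removes the
singularities of the quotient. The quotient is in `H²(𝔻²)` because `θ` is inner, so the element
lies in `K_θ ∩ θ H² = 0`.
-/

noncomputable section

open MeasureTheory Set Filter Topology
open scoped ComplexConjugate

namespace HardyBidisk

section ConjugatePolynomials

open Polynomial Complex

theorem mvPolynomial_eq_zero_of_eval_re_im {P : MvPolynomial (Fin 2) ℂ} {U : Set ℂ}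
    (hU : IsOpen U) (hne : U.Nonempty)
    (h : ∀ z ∈ U, MvPolynomial.eval ![(z.re : ℂ), (z.im : ℂ)] P = 0) : P = 0 := by
  obtain ⟨a, ha⟩ := hne
  have ha' : equivRealProdCLM.symm (a.re, a.im) ∈ U := by
    rwa [← equivRealProdCLM_apply, ContinuousLinearEquiv.symm_apply_apply]
  obtain ⟨A, B, hA, hB, haA, haB, hAB⟩ := isOpen_prod_iff.1
    (hU.preimage equivRealProdCLM.symm.continuous) a.re a.im ha'
  let S : Fin 2 → Set ℂ := ![ofReal '' A, ofReal '' B]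
  have hS : ∀ i, (S i).Infinite := Fin.forall_fin_two.2
    ⟨(infinite_of_mem_nhds _ (hA.mem_nhds haA)).image ofReal_injective.injOn,
      (infinite_of_mem_nhds _ (hB.mem_nhds haB)).image ofReal_injective.injOn⟩
  refine MvPolynomial.funext_set S hS fun x hx => ?_
  obtain ⟨u, hu, hux⟩ : x 0 ∈ ofReal '' A := hx 0 (mem_univ _)
  obtain ⟨v, hv, hvx⟩ : x 1 ∈ ofReal '' B := hx 1 (mem_univ _)
  have hmem : equivRealProdCLM.symm (u, v) ∈ U := hAB ⟨hu, hv⟩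
  have hx' : x = ![(u : ℂ), (v : ℂ)] := by
    ext i
    fin_cases i <;> simp [hux, hvx]
  simpa [hx'] using h _ hmem

theorem mvPolynomial_eval_eq_zero_of_eval_conj {R : MvPolynomial (Fin 2) ℂ} {U : Set ℂ}
    (hU : IsOpen U) (hne : U.Nonempty) (h : ∀ s ∈ U, MvPolynomial.eval ![s, conj s] R = 0)
    (s t : ℂ) : MvPolynomial.eval ![s, t] R = 0 := by
  let P : MvPolynomial (Fin 2) ℂ := MvPolynomial.bind₁
    ![MvPolynomial.X 0 + MvPolynomial.C I * MvPolynomial.X 1,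
      MvPolynomial.X 0 - MvPolynomial.C I * MvPolynomial.X 1] R
  have eval_P (x y : ℂ) : MvPolynomial.eval ![x, y] P =
      MvPolynomial.eval ![x + I * y, x - I * y] R := by
    simp only [P, MvPolynomial.eval, MvPolynomial.eval₂Hom_bind₁]
    congr 2
    ext i
    fin_cases i <;> simp
  have hP : P = 0 := mvPolynomial_eq_zero_of_eval_re_im hU hne fun z hz => by
    have hadd : (z.re : ℂ) + I * z.im = z := by rw [mul_comm, re_add_im]
    have hsub : (z.re : ℂ) - I * z.im = conj z := Complex.ext (by simp) (by simp)
    rw [eval_P, hadd, hsub, h z hz]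
  have hst := eval_P ((s + t) / 2) ((s - t) / (2 * I))
  have hs : (s + t) / 2 + I * ((s - t) / (2 * I)) = s := by field_simp; ring
  have ht : (s + t) / 2 - I * ((s - t) / (2 * I)) = t := by field_simp; ring
  rw [hs, ht, hP, map_zero] at hst
  exact hst.symm

theorem resultant_eq_zero_of_common_root {f g : ℂ[X]} {m n : ℕ} {w : ℂ} (hf : f.natDegree ≤ m)
    (hg : g.natDegree ≤ n) (hmn : m ≠ 0 ∨ n ≠ 0) (hfw : f.eval w = 0) (hgw : g.eval w = 0) :
    f.resultant g m n = 0 := by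
  obtain ⟨a, b, -, -, hab⟩ := exists_mul_add_mul_eq_C_resultant f g hf hg hmn
  simpa [hfw, hgw] using (congrArg (Polynomial.eval w) hab).symm

/-- For `q(z, w)` of degree `n` in `w`, the polynomial `wⁿ · conj (q (conj t, 1 / conj w))` in `w`;
the coefficients of `q` depend on `z`. On the unit circle it has the zeros of `q(conj t, ·)`. -/
def conjReflect (q : ℂ[X][X]) (t : ℂ) : ℂ[X] :=
  (q.map (eval₂RingHom (starRingEnd ℂ) t)).reflect q.natDegree

theorem natDegree_conjReflect_le (q : ℂ[X][X]) (t : ℂ) :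
    (conjReflect q t).natDegree ≤ q.natDegree :=
  natDegree_reflect_le.trans (max_le le_rfl natDegree_map_le)

theorem coeff_natDegree_conjReflect (q : ℂ[X][X]) (s : ℂ) :
    (conjReflect q (conj s)).coeff q.natDegree = conj ((q.coeff 0).eval s) := by
  rw [conjReflect, coeff_reflect, revAt_le le_rfl, Nat.sub_self, coeff_map, coe_eval₂RingHom,
    eval₂_hom]

theorem eval_conjReflect_eq_zero {q : ℂ[X][X]} {s w : ℂ} (hw : ‖w‖ = 1)
    (h : q.evalEval s w = 0) : (conjReflect q (conj s)).eval w = 0 := by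
  have hw0 : conj w ≠ 0 := by
    rw [ne_eq, map_eq_zero, ← norm_eq_zero, hw]
    exact one_ne_zero
  let : Invertible (conj w) := invertibleOfNonzero hw0
  have hinv : ⅟(conj w) = w := by
    rw [invOf_eq_inv, ← map_inv₀, inv_eq_conj hw, conj_conj]
  have hcomp : eval₂RingHom (starRingEnd ℂ) (conj s) = (starRingEnd ℂ).comp (evalRingHom s) := by
    ext <;> simp
  have key := (eval₂_reflect_eq_zero_iff (RingHom.id ℂ) (conj w) q.natDegree
    (q.map (eval₂RingHom (starRingEnd ℂ) (conj s))) natDegree_map_le).2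
  rw [hinv] at key
  refine key ?_
  rw [hcomp, ← Polynomial.map_map, eval₂_id, eval_map, eval₂_hom, map_evalRingHom_eval, h, map_zero]

theorem exists_mvPolynomial_eval_eq_resultant (q : ℂ[X][X]) :
    ∃ R : MvPolynomial (Fin 2) ℂ, ∀ s t, MvPolynomial.eval ![s, t] R =
      (q.map (evalRingHom s)).resultant (conjReflect q t) q.natDegree q.natDegree := by
  let f : ℂ[X] →+* MvPolynomial (Fin 2) ℂ := eval₂RingHom MvPolynomial.C (MvPolynomial.X 0)
  let g : ℂ[X] →+* MvPolynomial (Fin 2) ℂ :=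
    eval₂RingHom (MvPolynomial.C.comp (starRingEnd ℂ)) (MvPolynomial.X 1)
  refine ⟨(q.map f).resultant ((q.map g).reflect q.natDegree) q.natDegree q.natDegree,
    fun s t => ?_⟩
  have hf : (MvPolynomial.eval ![s, t]).comp f = evalRingHom s := by
    ext <;> simp [f]
  have hg : (MvPolynomial.eval ![s, t]).comp g = eval₂RingHom (starRingEnd ℂ) t := by
    ext <;> simp [g]
  rw [← resultant_map_map, ← reflect_map, Polynomial.map_map, Polynomial.map_map, hf, hg,
    conjReflect]

theorem exists_eval_C_eq_zero_of_resultant {q : ℂ[X][X]} {g : ℂ[X]} (hg : g ≠ 0)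
    (h : ∀ s, (q.map (evalRingHom s)).resultant g q.natDegree g.natDegree = 0) :
    ∃ c, q.eval (C c) = 0 := by
  have hprod : (g.roots.map fun c => q.eval (C c)).prod = 0 := by
    refine Polynomial.funext fun s => ?_
    have hres := h s
    rw [resultant_comm, resultant_eq_prod_eval g (q.map (evalRingHom s)) q.natDegree
      natDegree_map_le (IsAlgClosed.splits g)] at hres
    have hroots : (g.roots.map (q.map (evalRingHom s)).eval).prod = 0 := by
      simpa only [mul_eq_zero, pow_eq_zero_iff', neg_eq_zero, one_ne_zero, leadingCoeff_eq_zero, hg,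
        false_and, false_or] using hres
    rw [eval_multiset_prod, Multiset.map_map, eval_zero, ← hroots]
    congr 1
    exact Multiset.map_congr rfl fun c _ => (map_evalRingHom_eval s c q).symm
  obtain ⟨c, -, hc⟩ := Multiset.mem_map.1 (Multiset.prod_eq_zero_iff.1 hprod)
  exact ⟨c, hc⟩

theorem exists_eval_C_eq_zero_of_forall_root_on_circle {q : ℂ[X][X]} {U : Set ℂ} (hU : IsOpen U)
    (hne : U.Nonempty) (h : ∀ s ∈ U, ∃ w : ℂ, ‖w‖ = 1 ∧ q.evalEval s w = 0) :
    ∃ c : ℂ, q.eval (C c) = 0 := by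
  by_cases hq0 : q.coeff 0 = 0
  · exact ⟨0, by rw [map_zero, ← coeff_zero_eq_eval_zero, hq0]⟩
  obtain ⟨s₀, hs₀⟩ : ∃ s, (q.coeff 0).eval s ≠ 0 := by
    by_contra! h0
    exact hq0 (Polynomial.funext fun s => by rw [h0, eval_zero])
  have hn : q.natDegree ≠ 0 := fun hn => by
    obtain ⟨a, rfl⟩ := natDegree_eq_zero.1 hn
    refine hq0 (Polynomial.eq_zero_of_infinite_isRoot _ ?_)
    obtain ⟨x, hx⟩ := hne
    refine (infinite_of_mem_nhds x (hU.mem_nhds hx)).mono fun s hs => ?_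
    obtain ⟨w, -, hw⟩ := h s hs
    rwa [evalEval_C, ← coeff_C_zero (a := a)] at hw
  obtain ⟨R, hR⟩ := exists_mvPolynomial_eval_eq_resultant q
  have hzero : ∀ s t, MvPolynomial.eval ![s, t] R = 0 :=
    mvPolynomial_eval_eq_zero_of_eval_conj hU hne fun s hs => by
      obtain ⟨w, hw, hqw⟩ := h s hs
      rw [hR]
      exact resultant_eq_zero_of_common_root natDegree_map_le (natDegree_conjReflect_le q _)
        (Or.inl hn) (by rwa [map_evalRingHom_eval]) (eval_conjReflect_eq_zero hw hqw)
  have hlead : (conjReflect q (conj s₀)).coeff q.natDegree ≠ 0 := by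
    rwa [coeff_natDegree_conjReflect, ne_eq, map_eq_zero]
  have hdeg : (conjReflect q (conj s₀)).natDegree = q.natDegree :=
    (natDegree_conjReflect_le q _).antisymm (le_natDegree_of_ne_zero hlead)
  refine exists_eval_C_eq_zero_of_resultant (g := conjReflect q (conj s₀))
    (fun h0 => hlead (by rw [h0, coeff_zero])) fun s => ?_
  rw [hdeg, ← hR, hzero]

theorem exists_forall_evalEval_ne_zero_on_circle {q : ℂ[X][X]}
    (hq : ∀ c : ℂ, ‖c‖ = 1 → q.eval (C c) ≠ 0) {U : Set ℂ} (hU : IsOpen U) (hne : U.Nonempty) :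
    ∃ s ∈ U, ∀ w : ℂ, ‖w‖ = 1 → q.evalEval s w ≠ 0 := by
  induction hn : q.natDegree using Nat.strong_induction_on generalizing q with
  | _ n ih =>
    by_contra! h
    obtain ⟨c, hc⟩ := exists_eval_C_eq_zero_of_forall_root_on_circle hU hne h
    obtain ⟨r, rfl⟩ := dvd_iff_isRoot.2 hc
    have hr : r ≠ 0 := by
      rintro rfl
      exact hq 1 norm_one (by rw [mul_zero, eval_zero])
    have hdeg : r.natDegree < n := by
      rw [← hn, natDegree_mul (X_sub_C_ne_zero _) hr, natDegree_X_sub_C]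
      exact lt_one_add _
    obtain ⟨s, hs, hs'⟩ := ih _ hdeg (fun d hd h0 => hq d hd (by rw [eval_mul, h0, mul_zero])) rfl
    obtain ⟨w, hw, hw'⟩ := h s hs
    rw [evalEval_mul, mul_eq_zero_iff_right (hs' w hw)] at hw'
    have hwc : w = c := by simpa [evalEval, sub_eq_zero] using hw'
    exact hq w hw (hwc ▸ hc)

end ConjugatePolynomials

namespace HardySpace

theorem sub_apply (f g : HardySpace) (x : ℂ × ℂ) : (f - g) x = f x - g x := rfl

theorem torusMean_le_norm_sq (f : HardySpace) {r : ℝ} (hr : r ∈ Ico (0 : ℝ) 1) :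
    torusMean f r ≤ ‖f‖ ^ 2 := by
  have hle : torusMean f r ≤ ⨆ r : Ico (0 : ℝ) 1, torusMean f r :=
    le_ciSup f.bddAbove_torusMean ⟨r, hr⟩
  have hnonneg : 0 ≤ torusMean f r := integral_nonneg fun _ => by positivity
  rwa [norm_def, Real.sq_sqrt (hnonneg.trans hle)]

theorem norm_le_of_torusMean_le {f : HardySpace} {C : ℝ} (hC : 0 ≤ C)
    (h : ∀ r ∈ Ico (0 : ℝ) 1, torusMean f r ≤ C ^ 2) : ‖f‖ ≤ C := by
  have : Nonempty (Ico (0 : ℝ) 1) := ⟨⟨0, left_mem_Ico.2 one_pos⟩⟩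
  rw [norm_def]
  exact (Real.sqrt_le_sqrt (ciSup_le fun r : Ico (0 : ℝ) 1 => h r r.2)).trans (Real.sqrt_sq hC).le

theorem exists_of_torusMean_le {f : ℂ × ℂ → ℂ} (hf : DifferentiableOn ℂ f bidisk) {C : ℝ}
    (hC : 0 ≤ C) (h : ∀ r ∈ Ico (0 : ℝ) 1, torusMean f r ≤ C ^ 2) :
    ∃ g : HardySpace, (∀ x ∈ bidisk, g x = f x) ∧ ‖g‖ ≤ C := by
  have hmean : ∀ r ∈ Ico (0 : ℝ) 1, torusMean (bidisk.indicator f) r ≤ C ^ 2 := fun r hr => by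
    refine le_trans (le_of_eq (integral_congr_ae (ae_of_all _ fun t => ?_))) (h r hr)
    simp only [indicator_of_mem (torusPoint_mem hr hr t)]
  exact ⟨(⟨bidisk.indicator f, hf.congr fun x hx => indicator_of_mem hx f,
    fun x hx => indicator_of_notMem hx f, C ^ 2, hmean⟩ : hardySubmodule),
    fun x hx => indicator_of_mem hx f, norm_le_of_torusMean_le hC hmean⟩

section Multiplier

variable {φ : ℂ × ℂ → ℂ} (hφ : DifferentiableOn ℂ φ bidisk) {C : ℝ}
  (hC : ∀ r ∈ Ico (0 : ℝ) 1, ∀ t, ‖φ (torusPoint r r t)‖ ≤ C)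

include hφ hC

theorem torusMean_mul_le {f : ℂ × ℂ → ℂ} (hf : DifferentiableOn ℂ f bidisk) {r : ℝ}
    (hr : r ∈ Ico (0 : ℝ) 1) : torusMean (fun x => φ x * f x) r ≤ C ^ 2 * torusMean f r := by
  have hcf := continuous_comp_torusPoint hf hr hr
  have hcφ := continuous_comp_torusPoint hφ hr hr
  unfold torusMean
  rw [← integral_const_mul]
  refine integral_mono (integrable_of_continuous ((hcφ.mul hcf).norm.pow 2))
    ((integrable_of_continuous (hcf.norm.pow 2)).const_mul _) fun t => ?_
  simp only [norm_mul, mul_pow]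
  gcongr
  exact hC r hr t

theorem mul_mem_hardySubmodule (f : HardySpace) : (fun x => φ x * f x) ∈ hardySubmodule := by
  refine ⟨hφ.mul f.differentiableOn, fun x hx => mul_eq_zero_of_right _ (f.eq_zero_of_notMem hx),
    C ^ 2 * ‖f‖ ^ 2, fun r hr => (torusMean_mul_le hφ hC f.differentiableOn hr).trans ?_⟩
  gcongr
  exact f.torusMean_le_norm_sq hr

/-- Multiplication on `H²(𝔻²)` by a holomorphic function that is bounded on the tori of equal
radii. -/
def multiplier : HardySpace →L[ℂ] HardySpace :=
  LinearMap.mkContinuous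
    { toFun := fun f => (⟨fun x => φ x * f x, mul_mem_hardySubmodule hφ hC f⟩ : hardySubmodule)
      map_add' := fun f g => ext fun x _ => mul_add _ _ _
      map_smul' := fun c f => ext fun x _ => mul_left_comm _ _ _ } C fun f => by
    have hC0 : 0 ≤ C := (norm_nonneg _).trans (hC 0 (left_mem_Ico.2 one_pos) 0)
    refine norm_le_of_torusMean_le (mul_nonneg hC0 (norm_nonneg f)) fun r hr => ?_
    rw [mul_pow]
    refine (torusMean_mul_le hφ hC f.differentiableOn hr).trans ?_
    gcongr
    exact f.torusMean_le_norm_sq hr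

theorem multiplier_apply (f : HardySpace) (x : ℂ × ℂ) : multiplier hφ hC f x = φ x * f x := rfl

theorem norm_multiplier_le : ‖multiplier hφ hC‖ ≤ C :=
  LinearMap.mkContinuous_norm_le _
    ((norm_nonneg _).trans (hC 0 (left_mem_Ico.2 one_pos) 0)) _

end Multiplier

theorem norm_shiftZ_le : ‖shiftZ‖ ≤ 1 := LinearMap.mkContinuous_norm_le _ zero_le_one _

/-- Multiplication by the coordinate function `w` on `H²(𝔻²)`, the counterpart of `shiftZ`. -/
def shiftW : HardySpace →L[ℂ] HardySpace :=
  multiplier differentiableOn_snd fun _ hr t => (mem_bidisk.1 (torusPoint_mem hr hr t)).2.le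

theorem shiftW_apply (f : HardySpace) (x : ℂ × ℂ) : shiftW f x = x.2 * f x := rfl

theorem norm_shiftW_le : ‖shiftW‖ ≤ 1 := norm_multiplier_le _ _

open Polynomial in
theorem aeval_shiftW_apply (r : ℂ[X]) (f : HardySpace) (x : ℂ × ℂ) :
    (aeval shiftW r) f x = r.eval x.2 * f x := by
  induction r using Polynomial.induction_on generalizing f with
  | C a => simp [smul_apply, Algebra.algebraMap_eq_smul_one]
  | add p q hp hq =>
    rw [map_add, _root_.add_apply, add_apply, hp, hq, eval_add, add_mul]
  | monomial n a h =>
    rw [pow_succ, ← mul_assoc, map_mul, mul_apply_eq_comp, h, aeval_X,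
      shiftW_apply, eval_mul (p := C a * X ^ n), eval_X, mul_assoc]

theorem swap_mem_bidisk {x : ℂ × ℂ} : x.swap ∈ bidisk ↔ x ∈ bidisk := by
  rw [mem_bidisk, mem_bidisk]
  exact and_comm

/-- The function `(z, w) ↦ f(w, z)`. -/
def swap (f : HardySpace) : HardySpace :=
  (⟨fun x => f x.swap,
    f.differentiableOn.comp (f := Prod.swap) (by unfold Prod.swap; fun_prop)
      fun _ hx => swap_mem_bidisk.2 hx,
    fun x hx => f.eq_zero_of_notMem (by rwa [swap_mem_bidisk]), ‖f‖ ^ 2, fun r hr => by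
      refine le_of_eq_of_le ?_ (f.torusMean_le_norm_sq hr)
      unfold torusMean torusMeasure
      rw [← integral_prod_swap]
      rfl⟩ : hardySubmodule)

theorem apply_eq_tsum (f : HardySpace) {x : ℂ × ℂ} (hx : x ∈ bidisk) :
    f x = ∑' k : ℕ × ℕ, taylorCoeff f k * (x.1 ^ k.1 * x.2 ^ k.2) := by
  have hC : ∀ k, ‖taylorCoeff f k‖ ≤ ‖coeffEquiv f‖ :=
    lp.norm_apply_le_norm two_ne_zero (coeffEquiv f)
  have hs : Summable fun k => ‖taylorCoeff (powerSum (taylorCoeff f)) k‖ ^ 2 := by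
    simp_rw [taylorCoeff_powerSum hC]
    exact f.summable_sq
  let g : HardySpace := (⟨powerSum (taylorCoeff f), differentiableOn_powerSum hC,
    fun x hx => indicator_of_notMem hx _, _,
    fun r hr => torusMean_le (differentiableOn_powerSum hC) hs hr⟩ : hardySubmodule)
  have hfg : f = g := coeffEquiv.injective <| by
    ext k
    exact (taylorCoeff_powerSum hC k).symm
  calc f x = powerSum (taylorCoeff f) x := congrArg (· x) hfg
    _ = _ := by rw [powerSum, indicator_of_mem hx]

/-- The orthonormal basis `(zᵐ wⁿ)` of `H²(𝔻²)`. -/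
def monomialBasis : HilbertBasis (ℕ × ℕ) ℂ HardySpace := HilbertBasis.ofRepr coeffIsometry

theorem inner_monomialBasis (k : ℕ × ℕ) (f : HardySpace) :
    inner ℂ (monomialBasis k) f = taylorCoeff f k :=
  (monomialBasis.repr_apply_apply f k).symm

theorem monomialBasis_apply (k : ℕ × ℕ) {x : ℂ × ℂ} (hx : x ∈ bidisk) :
    monomialBasis k x = x.1 ^ k.1 * x.2 ^ k.2 := by
  have hcoeff : ∀ l, taylorCoeff (monomialBasis k) l = if l = k then 1 else 0 := fun l => by
    rw [← inner_monomialBasis, orthonormal_iff_ite.1 monomialBasis.orthonormal]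
  rw [apply_eq_tsum _ hx, tsum_eq_single k fun l hl => by rw [hcoeff, if_neg hl, zero_mul],
    hcoeff, if_pos rfl, one_mul]

instance : TopologicalSpace.SeparableSpace HardySpace := by
  have h : TopologicalSpace.IsSeparable
      (closure (Submodule.span ℂ (range monomialBasis) : Set HardySpace)) :=
    ((countable_range monomialBasis).isSeparable.span (R := ℂ)).closure
  rw [← Submodule.topologicalClosure_coe, monomialBasis.dense_span, Submodule.top_coe] at h
  exact TopologicalSpace.isSeparable_univ_iff.1 h

/-- The constant function `1`. -/
def one : HardySpace := monomialBasis 0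

theorem one_apply {x : ℂ × ℂ} (hx : x ∈ bidisk) : one x = 1 := by
  rw [one, monomialBasis_apply _ hx, Prod.fst_zero, Prod.snd_zero, pow_zero, pow_zero, one_mul]

theorem norm_one : ‖one‖ = 1 := monomialBasis.orthonormal.1 0

theorem apply_zero (f : HardySpace) : f (0, 0) = inner ℂ one f := by
  have h0 : ((0 : ℂ), (0 : ℂ)) ∈ bidisk := by simp [mem_bidisk]
  rw [one, inner_monomialBasis, apply_eq_tsum f h0, tsum_eq_single 0]
  · simp
  · rintro ⟨m, n⟩ hmn
    rcases Nat.eq_zero_or_pos m with rfl | hm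
    · have hn : n ≠ 0 := fun hn => hmn (by rw [hn]; rfl)
      simp [zero_pow hn]
    · simp [zero_pow hm.ne']

theorem norm_apply_zero_le (f : HardySpace) : ‖f (0, 0)‖ ≤ ‖f‖ := by
  simpa only [apply_zero, norm_one, one_mul] using
    norm_inner_le_norm (𝕜 := ℂ) one f

theorem eq_smul_one {f : HardySpace} (hf : ‖f‖ ≤ ‖f (0, 0)‖) :
    f = f (0, 0) • one := by
  have hproj : inner ℂ (f (0, 0) • one) (f - f (0, 0) • one) = 0 := by
    rw [inner_smul_left, inner_sub_right, inner_smul_right, inner_self_eq_norm_sq_to_K,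
      norm_one, ← apply_zero, RCLike.ofReal_one, one_pow, mul_one, sub_self,
      mul_zero]
  have hpyth := norm_add_sq_eq_norm_sq_add_norm_sq_of_inner_eq_zero (𝕜 := ℂ) _ _ hproj
  rw [add_sub_cancel, norm_smul, norm_one, mul_one] at hpyth
  rw [← sub_eq_zero, ← norm_eq_zero]
  nlinarith [norm_nonneg f, norm_nonneg (f - f (0, 0) • one)]

section DifferenceQuotient

open ContinuousLinearMap

theorem shiftZ_monomialBasis (k : ℕ × ℕ) :
    shiftZ (monomialBasis k) = monomialBasis (k.1 + 1, k.2) := by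
  refine ext fun x hx => ?_
  rw [shiftZ_apply, monomialBasis_apply _ hx, monomialBasis_apply _ hx, pow_succ', mul_assoc]

theorem adjoint_shiftZ_shiftZ (f : HardySpace) : adjoint shiftZ (shiftZ f) = f := by
  have hbasis : EqOn (adjoint shiftZ ∘L shiftZ) (ContinuousLinearMap.id ℂ HardySpace)
      (range monomialBasis) := by
    rintro _ ⟨k, rfl⟩
    refine monomialBasis.repr.injective (lp.ext (funext fun l => ?_))
    rw [monomialBasis.repr_apply_apply, monomialBasis.repr_apply_apply, comp_apply,
      adjoint_inner_right, shiftZ_monomialBasis, shiftZ_monomialBasis, id_apply,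
      orthonormal_iff_ite.1 monomialBasis.orthonormal,
      orthonormal_iff_ite.1 monomialBasis.orthonormal]
    simp only [Prod.ext_iff, add_left_inj]
  exact DFunLike.congr_fun (ext_on
    (Submodule.dense_iff_topologicalClosure_eq_top.2 monomialBasis.dense_span) hbasis) f

theorem apply_eq_of_adjoint_shiftZ_eq_zero {f : HardySpace} (hf : adjoint shiftZ f = 0)
    {x y : ℂ × ℂ} (hx : x ∈ bidisk) (hy : y ∈ bidisk) (hxy : x.2 = y.2) : f x = f y := by
  rw [apply_eq_tsum f hx, apply_eq_tsum f hy]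
  refine tsum_congr fun k => ?_
  obtain ⟨_ | m, n⟩ := k
  · rw [hxy, pow_zero, pow_zero]
  · rw [← inner_monomialBasis, ← shiftZ_monomialBasis (m, n), ← adjoint_inner_right, hf,
      inner_zero_right, zero_mul, zero_mul]

theorem fst_mul_adjoint_shiftZ_sub (f : HardySpace) {x y : ℂ × ℂ} (hx : x ∈ bidisk)
    (hy : y ∈ bidisk) (hxy : x.2 = y.2) :
    x.1 * adjoint shiftZ f x - y.1 * adjoint shiftZ f y = f x - f y := by
  have hker : adjoint shiftZ (f - shiftZ (adjoint shiftZ f)) = 0 := by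
    rw [map_sub, adjoint_shiftZ_shiftZ, sub_self]
  have h := apply_eq_of_adjoint_shiftZ_eq_zero hker hx hy hxy
  rw [sub_apply, sub_apply, shiftZ_apply, shiftZ_apply] at h
  linear_combination -h

/-- With `B` the adjoint of `shiftZ`, a backward shift, the difference quotient is
`(1 - a B)⁻¹ B f`. -/
theorem exists_difference_quotient_fst (f : HardySpace) {a : ℂ} (ha : ‖a‖ < 1) :
    ∃ g : HardySpace, ∀ x ∈ bidisk, f x - f (a, x.2) = (x.1 - a) * g x := by
  set B : HardySpace →L[ℂ] HardySpace := adjoint shiftZ with hB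
  have hBnorm : ‖B‖ ≤ 1 := by
    rw [hB, LinearIsometryEquiv.norm_map]
    exact norm_shiftZ_le
  have haB : ‖a • B‖ < 1 := by
    rw [norm_smul]
    exact (mul_le_of_le_one_right (norm_nonneg a) hBnorm).trans_lt ha
  obtain ⟨U, hU⟩ := isUnit_one_sub_of_norm_lt_one haB
  obtain ⟨g, hg⟩ : ∃ g, g - a • B g = B f := by
    refine ⟨(↑U⁻¹ : HardySpace →L[ℂ] HardySpace) (B f), ?_⟩
    have h := congrArg (· (B f)) U.mul_inv
    rwa [hU] at h
  refine ⟨g, fun x hx => ?_⟩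
  have hax : (a, x.2) ∈ bidisk := mem_bidisk.2 ⟨ha, (mem_bidisk.1 hx).2⟩
  have hgx : g x - a * B g x = B f x := congrArg (fun u : HardySpace => u x) hg
  have hga : g (a, x.2) - a * B g (a, x.2) = B f (a, x.2) :=
    congrArg (fun u : HardySpace => u (a, x.2)) hg
  have hBf := fst_mul_adjoint_shiftZ_sub f hx hax rfl
  have hBg := fst_mul_adjoint_shiftZ_sub g hx hax rfl
  rw [← hB] at hBf hBg
  linear_combination -hBf - a * hBg - x.1 * hgx + a * hga

theorem exists_difference_quotient_snd (f : HardySpace) {a : ℂ} (ha : ‖a‖ < 1) :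
    ∃ g : HardySpace, ∀ x ∈ bidisk, f x - f (x.1, a) = (x.2 - a) * g x := by
  obtain ⟨g, hg⟩ := exists_difference_quotient_fst f.swap ha
  exact ⟨g.swap, fun x hx => hg x.swap (swap_mem_bidisk.2 hx)⟩

end DifferenceQuotient

end HardySpace

section BanachOperators

variable {𝕜 E : Type*} [NontriviallyNormedField 𝕜] [NormedAddCommGroup E] [NormedSpace 𝕜 E]

open ContinuousLinearMap

theorem isCompl_range_ker_of_mul_eq_one {A L : E →L[𝕜] E} (h : L * A = 1) :
    IsCompl A.range L.ker := by
  have hLA : ∀ f, L (A f) = f := DFunLike.congr_fun h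
  refine IsCompl.of_eq ((Submodule.eq_bot_iff _).2 ?_) (eq_top_iff.2 fun f _ => ?_)
  · rintro _ ⟨⟨f, rfl⟩, hf⟩
    have hf0 : f = 0 := (hLA f).symm.trans hf
    rw [hf0, map_zero]
  · refine Submodule.mem_sup.2 ⟨A (L f), ⟨L f, rfl⟩, f - A (L f), ?_, add_sub_cancel _ _⟩
    exact (map_sub L f _).trans (sub_eq_zero.2 (hLA _).symm)

theorem ker_eq_bot_of_isUnit_mul {A L : E →L[𝕜] E} (h : IsUnit (L * A)) : A.ker = ⊥ := by
  obtain ⟨B, hB⟩ := h.exists_left_inv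
  exact LinearMap.ker_eq_bot.2 (Function.LeftInverse.injective (g := B * L) (DFunLike.congr_fun hB))

theorem isCompl_range_ker_of_isUnit_mul {A L : E →L[𝕜] E} (h : IsUnit (L * A)) :
    IsCompl A.range L.ker := by
  obtain ⟨U, hU⟩ := h
  have hker : ((↑U⁻¹ : E →L[𝕜] E) * L).ker = L.ker :=
    LinearMap.ker_comp_of_ker_eq_bot _
      (ker_eq_bot_of_isUnit_mul (L := (↑U : E →L[𝕜] E)) (by rw [U.mul_inv]; exact isUnit_one))
  rw [← hker]
  exact isCompl_range_ker_of_mul_eq_one (by rw [mul_assoc, ← hU, U.inv_mul])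

variable [CompleteSpace E]

theorem mem_spectrum_iff {T : E →L[𝕜] E} {l : 𝕜} :
    l ∈ spectrum 𝕜 T ↔ ¬ ((T - l • ContinuousLinearMap.id 𝕜 E).ker = ⊥ ∧
      (T - l • ContinuousLinearMap.id 𝕜 E).range = ⊤) := by
  rw [spectrum.mem_iff, not_iff_not, ← IsUnit.neg_iff, neg_sub, isUnit_iff_bijective,
    Algebra.algebraMap_eq_smul_one]
  exact and_congr LinearMap.ker_eq_bot.symm LinearMap.range_eq_top.symm

variable [CompleteSpace 𝕜]

theorem exists_mul_eq_one {A : E →L[𝕜] E} (hk : A.ker = ⊥) (hA : A.IsFredholm) :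
    ∃ L : E →L[𝕜] E, L * A = 1 :=
  let ⟨L, hL⟩ := HasLeftInverse.of_injective_of_isClosed_range_of_closedComplement_range
    (LinearMap.ker_eq_bot.1 hk) hA.isClosed_range hA.closedComplemented_range
  ⟨L, ContinuousLinearMap.ext hL⟩

theorem isFredholm_of_ker_eq_bot {A : E →L[𝕜] E} (hk : A.ker = ⊥) (hf : A.range.CoFG) :
    A.IsFredholm := by
  obtain ⟨N, hN⟩ := A.range.exists_isCompl
  have hfd : FiniteDimensional 𝕜 N := Module.Finite.iff_fg.2 (hf.fg_of_isCompl hN)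
  have hcl := A.closed_complemented_range_of_isCompl_of_ker_eq_bot N hN
    N.closed_of_finiteDimensional hk
  obtain ⟨K, hK⟩ := A.antilipschitz_of_injective_of_isClosed_range (LinearMap.ker_eq_bot.1 hk) hcl
  exact ⟨(hK.isUniformEmbedding A.uniformContinuous).isEmbedding.isStrictMap, hcl,
    by rw [hk]; infer_instance, hf, by rw [hk]; exact Submodule.closedComplemented_bot⟩

theorem eventually_isFredholm {T : E →L[𝕜] E} {l₀ : 𝕜}
    (hk : (T - l₀ • ContinuousLinearMap.id 𝕜 E).ker = ⊥)
    (hA : (T - l₀ • ContinuousLinearMap.id 𝕜 E).IsFredholm) :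
    ∀ᶠ l in 𝓝 l₀, (T - l • ContinuousLinearMap.id 𝕜 E).IsFredholm ∧
      Module.finrank 𝕜 (E ⧸ (T - l • ContinuousLinearMap.id 𝕜 E).range) =
      Module.finrank 𝕜 (E ⧸ (T - l₀ • ContinuousLinearMap.id 𝕜 E).range) := by
  obtain ⟨L, hL⟩ := exists_mul_eq_one hk hA
  have hcont : Continuous fun l : 𝕜 => L * (T - l • ContinuousLinearMap.id 𝕜 E) := by fun_prop
  have hunit : ∀ᶠ l in 𝓝 l₀, IsUnit (L * (T - l • ContinuousLinearMap.id 𝕜 E)) :=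
    hcont.continuousAt.eventually_mem (Units.isOpen.mem_nhds (hL ▸ isUnit_one))
  -- The ranges of `T - l` near `l₀` have the common complement `ker L`.
  have hcompl₀ := isCompl_range_ker_of_mul_eq_one hL
  have hfd : L.ker.FG := Submodule.CoFG.fg_of_isCompl hcompl₀ hA.finite_coker
  filter_upwards [hunit] with l hl
  have hcompl := isCompl_range_ker_of_isUnit_mul hl
  exact ⟨isFredholm_of_ker_eq_bot (ker_eq_bot_of_isUnit_mul hl)
      (Submodule.FG.cofg_of_isCompl hcompl.symm hfd),
    ((Submodule.quotientEquivOfIsCompl _ _ hcompl).trans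
      (Submodule.quotientEquivOfIsCompl _ _ hcompl₀).symm).finrank_eq⟩

end BanachOperators

section HilbertOperators

variable {𝕜 E : Type*} [RCLike 𝕜] [NormedAddCommGroup E] [InnerProductSpace 𝕜 E] [CompleteSpace E]

open ContinuousLinearMap

theorem adjoint_sub_smul_id (T : E →L[𝕜] E) (l : 𝕜) :
    adjoint (T - l • ContinuousLinearMap.id 𝕜 E) =
      adjoint T - conj l • ContinuousLinearMap.id 𝕜 E := by
  rw [map_sub, LinearIsometryEquiv.map_smulₛₗ, adjoint_id]

theorem eq_smul_of_adjoint_eq_smul {T : E →L[𝕜] E} (hT : ‖T‖ ≤ 1) {l : 𝕜} (hl : 1 ≤ ‖l‖) {f : E}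
    (h : adjoint T f = conj l • f) : T f = l • f := by
  have hinner : inner 𝕜 (T f) (l • f) = ((‖l‖ ^ 2 * ‖f‖ ^ 2 : ℝ) : 𝕜) := by
    rw [← adjoint_inner_right, map_smul, h, smul_smul, inner_smul_right, RCLike.mul_conj,
      inner_self_eq_norm_sq_to_K]
    push_cast
    rfl
  have hTf : ‖T f‖ ^ 2 ≤ ‖f‖ ^ 2 := by
    gcongr
    exact (T.le_of_opNorm_le hT f).trans_eq (one_mul _)
  have hlf : ‖f‖ ^ 2 ≤ ‖l‖ ^ 2 * ‖f‖ ^ 2 :=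
    le_mul_of_one_le_left (by positivity) (one_le_pow₀ hl)
  have hdist : ‖T f - l • f‖ ^ 2 ≤ 0 := by
    rw [@norm_sub_sq 𝕜, hinner, norm_smul, mul_pow, RCLike.ofReal_re]
    linarith
  exact sub_eq_zero.1 (norm_eq_zero.1 (pow_eq_zero_iff two_ne_zero |>.1 (hdist.antisymm
    (by positivity))))

theorem topologicalClosure_range_eq_top {T : E →L[𝕜] E} (hT : ‖T‖ ≤ 1) {l : 𝕜} (hl : 1 ≤ ‖l‖)
    (h : ∀ f, T f = l • f → f = 0) :
    (T - l • ContinuousLinearMap.id 𝕜 E).range.topologicalClosure = ⊤ := by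
  rw [Submodule.topologicalClosure_eq_top_iff, orthogonal_range, adjoint_sub_smul_id,
    Submodule.eq_bot_iff]
  exact fun f hf => h f (eq_smul_of_adjoint_eq_smul hT hl (sub_eq_zero.1 hf))

theorem range_adjoint_eq_top {A : E →L[𝕜] E} (hk : A.ker = ⊥) (hA : A.IsFredholm) :
    (adjoint A).range = ⊤ := by
  obtain ⟨L, hL⟩ := exists_mul_eq_one hk hA
  have hstar : adjoint A * adjoint L = 1 := by
    simpa only [star_mul, star_one, star_eq_adjoint] using congrArg star hL
  exact LinearMap.range_eq_top.2 fun f => ⟨adjoint L f, DFunLike.congr_fun hstar f⟩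

theorem rank_ker_adjoint {A : E →L[𝕜] E} (hA : A.IsFredholm) :
    Module.rank 𝕜 (adjoint A).ker = Module.finrank 𝕜 (E ⧸ A.range) := by
  have := hA.finite_coker
  have : CompleteSpace A.range := hA.isClosed_range.completeSpace_coe
  rw [← orthogonal_range, Module.finrank_eq_rank]
  exact (Submodule.quotientEquivOfIsCompl _ _ (Submodule.isCompl_orthogonal _)).rank_eq.symm

end HilbertOperators

theorem exists_toCircle_eq {u : ℂ} (hu : ‖u‖ = 1) :
    ∃ t : UnitAddCircle, (AddCircle.toCircle t : ℂ) = u := by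
  obtain ⟨t, ht⟩ := (AddCircle.homeomorphCircle (T := 1) one_ne_zero).surjective
    ⟨u, mem_sphere_zero_iff_norm.2 hu⟩
  rw [AddCircle.homeomorphCircle_apply] at ht
  exact ⟨t, by rw [ht]⟩

instance : Nontrivial UnitAddCircle := by
  obtain ⟨s, hs⟩ := exists_toCircle_eq (u := 1) (by simp)
  obtain ⟨t, ht⟩ := exists_toCircle_eq (u := -1) (by simp)
  refine ⟨s, t, fun h => ?_⟩
  rw [h, ht] at hs
  norm_num at hs

instance : NullSingletonClass (AddCircle.haarAddCircle : Measure UnitAddCircle) := by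
  have : (𝓝[≠] (0 : UnitAddCircle)).NeBot :=
    ConnectedSpace.neBot_nhdsWithin_compl_of_nontrivial_of_t1space 0
  infer_instance

instance : torusMeasure.IsOpenPosMeasure := by unfold torusMeasure; infer_instance

instance : torusMeasure.IsAddRightInvariant := by unfold torusMeasure; infer_instance

section Polynomials

open Polynomial

theorem ae_eval_toCircle_ne_zero {P : ℂ[X]} (hP : P ≠ 0) :
    ∀ᵐ t ∂(AddCircle.haarAddCircle : Measure UnitAddCircle),
      P.eval (AddCircle.toCircle t : ℂ) ≠ 0 := by
  have hinj : Function.Injective fun t : UnitAddCircle => (AddCircle.toCircle t : ℂ) :=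
    Subtype.val_injective.comp (AddCircle.injective_toCircle one_ne_zero)
  have hfin : {t : UnitAddCircle | P.IsRoot (AddCircle.toCircle t : ℂ)}.Finite :=
    (finite_setOfPred_isRoot hP).preimage hinj.injOn
  simpa [ae_iff] using hfin.measure_zero _

theorem differentiable_evalEval (p : ℂ[X][X]) :
    Differentiable ℂ fun x : ℂ × ℂ => p.evalEval x.1 x.2 := by
  have hsum : (fun x : ℂ × ℂ => p.evalEval x.1 x.2) =
      fun x => ∑ n ∈ p.support, (p.coeff n).eval x.1 * x.2 ^ n := by
    ext x
    rw [← eval₂_evalRingHom, eval₂_eq_sum, Polynomial.sum]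
    rfl
  rw [hsum]
  exact Differentiable.fun_sum fun n _ =>
    ((p.coeff n).differentiable.comp differentiable_fst).mul (differentiable_snd.pow n)

theorem continuous_evalEval (p : ℂ[X][X]) : Continuous fun x : ℂ × ℂ => p.evalEval x.1 x.2 :=
  (differentiable_evalEval p).continuous

theorem continuous_evalEval_toCircle (p : ℂ[X][X]) :
    Continuous fun t : UnitAddCircle × UnitAddCircle =>
      p.evalEval (AddCircle.toCircle t.1 : ℂ) (AddCircle.toCircle t.2 : ℂ) :=
  (continuous_evalEval p).comp (f := fun t : UnitAddCircle × UnitAddCircle =>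
    ((AddCircle.toCircle t.1 : ℂ), (AddCircle.toCircle t.2 : ℂ))) (by fun_prop)

theorem ae_evalEval_ne_zero {p : ℂ[X][X]} (hp : p ≠ 0) :
    ∀ᵐ t ∂torusMeasure,
      p.evalEval (AddCircle.toCircle t.1 : ℂ) (AddCircle.toCircle t.2 : ℂ) ≠ 0 := by
  have hm : MeasurableSet {t : UnitAddCircle × UnitAddCircle |
      p.evalEval (AddCircle.toCircle t.1 : ℂ) (AddCircle.toCircle t.2 : ℂ) ≠ 0} :=
    (isOpen_ne_fun (continuous_evalEval_toCircle p) continuous_const).measurableSet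
  refine (Measure.ae_prod_mem_iff_ae_ae_mem hm).2 ?_
  filter_upwards [ae_eval_toCircle_ne_zero (leadingCoeff_ne_zero.2 hp)] with s hs
  have hmap : p.map (evalRingHom (AddCircle.toCircle s : ℂ)) ≠ 0 := fun h => hs <| by
    simpa only [coeff_map, coeff_zero, coeff_natDegree, coe_evalRingHom] using
      congrArg (coeff · p.natDegree) h
  filter_upwards [ae_eval_toCircle_ne_zero hmap] with t ht
  rwa [map_evalRingHom_eval] at ht

/-- The restriction of `p` to the line `{(a x, b x)}`. -/
def slicePoly (a b : ℂ) : ℂ[X][X] →+* ℂ[X] :=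
  eval₂RingHom (compRingHom (C a * X)) (C b * X)

theorem eval_slicePoly (a b x : ℂ) (p : ℂ[X][X]) :
    (slicePoly a b p).eval x = p.evalEval (a * x) (b * x) := by
  have : (evalRingHom x).comp (slicePoly a b) = evalEvalRingHom (a * x) (b * x) := by
    ext <;> simp [slicePoly]
  exact DFunLike.congr_fun this p

theorem exists_isCoprime_factorization {K : Type*} [Field K] {P : K[X]} (Q : K[X]) (hP : P ≠ 0) :
    ∃ D P₁ Q₁ : K[X], P = D * P₁ ∧ Q = D * Q₁ ∧ D ≠ 0 ∧ IsCoprime P₁ Q₁ := by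
  classical
  have hD : gcd P Q ≠ 0 := gcd_ne_zero_of_left hP
  exact ⟨gcd P Q, P / gcd P Q, Q / gcd P Q,
    (EuclideanDomain.mul_div_cancel' hD (gcd_dvd_left P Q)).symm,
    (EuclideanDomain.mul_div_cancel' hD (gcd_dvd_right P Q)).symm, hD,
    isCoprime_div_gcd_div_gcd_of_gcd_ne_zero hD⟩

theorem mul_eval_eq_of_mul_eval_mul_eq {D P Q : ℂ[X]} (hD : D ≠ 0) {U : Set ℂ} (hU : IsOpen U)
    {g : ℂ → ℂ} (hg : ContinuousOn g U)
    (h : ∀ x ∈ U, g x * (D * P).eval x = (D * Q).eval x) {x : ℂ} (hx : x ∈ U) :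
    g x * P.eval x = Q.eval x := by
  have hne : ∀ᶠ y in 𝓝[≠] x, D.eval y ≠ 0 :=
    (finite_setOfPred_isRoot hD).eventually_cofinite_notMem.filter_mono (nhdsNE_le_cofinite x)
  have hev : ∀ᶠ y in 𝓝[≠] x, g y * P.eval y = Q.eval y := by
    filter_upwards [hne, nhdsWithin_le_nhds (hU.mem_nhds hx)] with y hy hyU
    have := h y hyU
    rw [eval_mul, eval_mul] at this
    exact mul_left_cancel₀ hy (by linear_combination this)
  have hcont : ContinuousAt (fun y => g y * P.eval y) x :=
    (hg.continuousAt (hU.mem_nhds hx)).mul P.continuous.continuousAt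
  exact tendsto_nhds_unique_of_eventuallyEq (hcont.tendsto.mono_left nhdsWithin_le_nhds)
    (Q.continuous.continuousAt.tendsto.mono_left nhdsWithin_le_nhds) hev

theorem norm_eval_eq_of_norm_eval_mul_eq {D P Q : ℂ[X]} (hD : D ≠ 0)
    (h : ∀ u : ℂ, ‖u‖ = 1 → ‖(D * P).eval u‖ = ‖(D * Q).eval u‖) {u : ℂ} (hu : ‖u‖ = 1) :
    ‖P.eval u‖ = ‖Q.eval u‖ := by
  have hcont (R : ℂ[X]) : Continuous fun t : UnitAddCircle =>
      ‖R.eval (AddCircle.toCircle t : ℂ)‖ :=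
    (R.continuous.comp (Continuous.subtype_val AddCircle.continuous_toCircle)).norm
  have hae : (fun t : UnitAddCircle => ‖P.eval (AddCircle.toCircle t : ℂ)‖)
      =ᵐ[AddCircle.haarAddCircle] fun t => ‖Q.eval (AddCircle.toCircle t : ℂ)‖ := by
    filter_upwards [ae_eval_toCircle_ne_zero hD] with t ht
    have := h (AddCircle.toCircle t : ℂ) (Circle.norm_coe _)
    rw [eval_mul, eval_mul, norm_mul, norm_mul] at this
    exact mul_left_cancel₀ (norm_ne_zero_iff.2 ht) this
  obtain ⟨t, rfl⟩ := exists_toCircle_eq hu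
  exact congrFun ((Continuous.ae_eq_iff_eq _ (hcont P) (hcont Q)).1 hae) t

theorem exists_diffContOnCl_extension {P Q : ℂ[X]} (hP : P ≠ 0) {g : ℂ → ℂ}
    (hg : ContinuousOn g (Metric.ball 0 1))
    (h : ∀ x ∈ Metric.ball (0 : ℂ) 1, g x * P.eval x = Q.eval x)
    (hPQ : ∀ u : ℂ, ‖u‖ = 1 → ‖P.eval u‖ = ‖Q.eval u‖) :
    ∃ G : ℂ → ℂ, DiffContOnCl ℂ G (Metric.ball 0 1) ∧ (∀ x ∈ Metric.ball (0 : ℂ) 1, G x = g x) ∧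
      ∀ u : ℂ, ‖u‖ = 1 → ‖G u‖ = 1 := by
  obtain ⟨D, P₁, Q₁, rfl, rfl, hD, a, b, hab⟩ := exists_isCoprime_factorization Q hP
  have hquot {x} (hx : x ∈ Metric.ball (0 : ℂ) 1) : g x * P₁.eval x = Q₁.eval x :=
    mul_eval_eq_of_mul_eval_mul_eq hD Metric.isOpen_ball hg h hx
  have hnorm {u : ℂ} (hu : ‖u‖ = 1) : ‖P₁.eval u‖ = ‖Q₁.eval u‖ :=
    norm_eval_eq_of_norm_eval_mul_eq hD hPQ hu
  have hne : ∀ x ∈ Metric.closedBall (0 : ℂ) 1, P₁.eval x ≠ 0 := by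
    intro x hx hPx
    have hQx : Q₁.eval x = 0 := by
      rcases (mem_closedBall_zero_iff.1 hx).lt_or_eq with hlt | heq
      · rw [← hquot (mem_ball_zero_iff.2 hlt), hPx, mul_zero]
      · rw [← norm_eq_zero, ← hnorm heq, hPx, norm_zero]
    simpa [hPx, hQx] using congrArg (eval x) hab
  refine ⟨fun x => Q₁.eval x / P₁.eval x, ⟨fun x hx => ?_, ?_⟩, fun x hx => ?_, fun u hu => ?_⟩
  · exact (Q₁.differentiable.differentiableAt.div P₁.differentiable.differentiableAt
      (hne x (Metric.ball_subset_closedBall hx))).differentiableWithinAt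
  · rw [closure_ball _ one_ne_zero]
    exact Q₁.continuous.continuousOn.div P₁.continuous.continuousOn hne
  · rw [div_eq_iff (hne x (Metric.ball_subset_closedBall hx)), hquot hx]
  · rw [norm_div, ← hnorm hu, div_self]
    exact norm_ne_zero_iff.2 (hne u (mem_closedBall_zero_iff.2 hu.le))

end Polynomials

section UnimodularBoundaryValues

variable {G : ℂ → ℂ} (hG : DiffContOnCl ℂ G (Metric.ball 0 1)) (hG1 : ∀ u : ℂ, ‖u‖ = 1 → ‖G u‖ = 1)
include hG hG1

theorem norm_le_one_of_unimodular_boundary {x : ℂ} (hx : x ∈ Metric.ball (0 : ℂ) 1) :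
    ‖G x‖ ≤ 1 := by
  refine Complex.norm_le_of_forall_mem_frontier_norm_le Metric.isBounded_ball hG
    (fun u hu => ?_) (subset_closure hx)
  rw [frontier_ball _ one_ne_zero, mem_sphere_zero_iff_norm] at hu
  exact (hG1 u hu).le

theorem exists_radius_lt_norm_of_unimodular_boundary {d : ℝ} (hd : d < 1) :
    ∃ ρ < 1, ∀ x : ℂ, ρ < ‖x‖ → ‖x‖ < 1 → d < ‖G x‖ := by
  have hcont : ContinuousOn (fun x => ‖G x‖) (Metric.closedBall 0 1) := by
    simpa only [closure_ball _ one_ne_zero] using hG.continuousOn.norm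
  let K : Set ℂ := Metric.closedBall 0 1 ∩ {x | ‖G x‖ ≤ d}
  have hK : IsCompact K := (isCompact_closedBall 0 1).of_isClosed_subset
    (hcont.preimage_isClosed_of_isClosed Metric.isClosed_closedBall isClosed_Iic)
    inter_subset_left
  have hnot {ρ : ℝ} (hmax : ∀ y ∈ K, ‖y‖ ≤ ρ) : ∀ x : ℂ, ρ < ‖x‖ → ‖x‖ < 1 → d < ‖G x‖ :=
    fun x hx hx1 => not_le.1 fun hle =>
      hx.not_ge (hmax x ⟨mem_closedBall_zero_iff.2 hx1.le, hle⟩)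
  rcases K.eq_empty_or_nonempty with hempty | hne
  · exact ⟨0, one_pos, hnot (by simp [hempty])⟩
  · obtain ⟨y, ⟨hy1, hyd⟩, hmax⟩ := hK.exists_isMaxOn hne continuous_norm.continuousOn
    exact ⟨‖y‖, (mem_closedBall_zero_iff.1 hy1).lt_of_ne fun h => hd.not_ge (hG1 y h ▸ hyd),
      hnot hmax⟩

end UnimodularBoundaryValues

section CircleMeans

/-- The mean of `|g|²` over the circle of radius `r` about `0`. -/
def circleMean (g : ℂ → ℂ) (r : ℝ) : ENNReal :=
  ∫⁻ s : UnitAddCircle, ‖g (r * (AddCircle.toCircle s : ℂ))‖ₑ ^ 2 ∂AddCircle.haarAddCircle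

theorem mul_toCircle_mem_ball {r : ℝ} (hr : r ∈ Ico (0 : ℝ) 1) (s : UnitAddCircle) :
    (r : ℂ) * (AddCircle.toCircle s : ℂ) ∈ Metric.ball (0 : ℂ) 1 := by
  simpa [Circle.norm_coe, abs_of_nonneg hr.1] using hr.2

theorem ofReal_integral_sq_norm {X E : Type*} [MeasurableSpace X] [NormedAddCommGroup E]
    {μ : Measure X} {g : X → E} (hg : Integrable (fun x => ‖g x‖ ^ 2) μ) :
    ENNReal.ofReal (∫ x, ‖g x‖ ^ 2 ∂μ) = ∫⁻ x, ‖g x‖ₑ ^ 2 ∂μ := by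
  rw [ofReal_integral_eq_lintegral_ofReal hg (ae_of_all _ fun _ => by positivity)]
  exact lintegral_congr fun x => by rw [ENNReal.ofReal_pow (norm_nonneg _), ofReal_norm]

theorem circleMean_eq_ofReal_torusMean {g : ℂ → ℂ} (hg : DifferentiableOn ℂ g (Metric.ball 0 1))
    {r : ℝ} (hr : r ∈ Ico (0 : ℝ) 1) :
    circleMean g r = ENNReal.ofReal (torusMean (fun x => g x.1) r) := by
  have hc : Continuous fun s : UnitAddCircle => g (r * (AddCircle.toCircle s : ℂ)) :=
    hg.continuousOn.comp_continuous (by fun_prop) (mul_toCircle_mem_ball hr)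
  have hfst : torusMean (fun x => g x.1) r =
      ∫ s : UnitAddCircle, ‖g (r * (AddCircle.toCircle s : ℂ))‖ ^ 2 ∂AddCircle.haarAddCircle := by
    unfold torusMean torusMeasure torusPoint
    simpa using integral_fun_fst (μ := (AddCircle.haarAddCircle : Measure UnitAddCircle))
      (ν := (AddCircle.haarAddCircle : Measure UnitAddCircle))
      fun s : UnitAddCircle => ‖g (r * (AddCircle.toCircle s : ℂ))‖ ^ 2
  rw [hfst, ofReal_integral_sq_norm
    ((hc.norm.pow 2).integrable_of_hasCompactSupport (HasCompactSupport.of_compactSpace _))]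
  rfl

theorem torusMean_mono {f : ℂ × ℂ → ℂ} (hf : DifferentiableOn ℂ f bidisk) {r ρ : ℝ}
    (hr : r ∈ Ico (0 : ℝ) 1) (hρ : ρ ∈ Ico (0 : ℝ) 1) (h : r ≤ ρ) :
    torusMean f r ≤ torusMean f ρ := by
  refine hasSum_le (fun k => ?_) (hasSum_sq_torus hf hr hr) (hasSum_sq_torus hf hρ hρ)
  simp only [norm_mul, norm_pow, Complex.norm_real, Real.norm_eq_abs, abs_of_nonneg hr.1,
    abs_of_nonneg hρ.1]
  have := hr.1
  have := hρ.1
  gcongr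

theorem circleMean_mono {g : ℂ → ℂ} (hg : DifferentiableOn ℂ g (Metric.ball 0 1)) {r ρ : ℝ}
    (hr : r ∈ Ico (0 : ℝ) 1) (hρ : ρ ∈ Ico (0 : ℝ) 1) (h : r ≤ ρ) :
    circleMean g r ≤ circleMean g ρ := by
  have hd : DifferentiableOn ℂ (fun x : ℂ × ℂ => g x.1) bidisk :=
    hg.comp differentiableOn_fst fun x hx => mem_ball_zero_iff.2 (mem_bidisk.1 hx).1
  rw [circleMean_eq_ofReal_torusMean hg hr, circleMean_eq_ofReal_torusMean hg hρ]
  exact ENNReal.ofReal_le_ofReal (torusMean_mono hd hr hρ h)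

theorem mul_circleMean_le {d : NNReal} {G g f : ℂ → ℂ} {r : ℝ} (hr : r ∈ Ico (0 : ℝ) 1)
    (hG : ∀ x : ℂ, ‖x‖ = r → d ≤ ‖G x‖) (hf : ∀ x ∈ Metric.ball (0 : ℂ) 1, f x = G x * g x) :
    (d : ENNReal) ^ 2 * circleMean g r ≤ circleMean f r := by
  unfold circleMean
  rw [← lintegral_const_mul' _ _ (by finiteness)]
  refine lintegral_mono fun s => ?_
  have hd : (d : ENNReal) ≤ ‖G (r * (AddCircle.toCircle s : ℂ))‖ₑ := by
    rw [enorm_eq_nnnorm, ENNReal.coe_le_coe]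
    exact hG _ (by simp [Circle.norm_coe, abs_of_nonneg hr.1])
  rw [hf _ (mul_toCircle_mem_ball hr s), enorm_mul, mul_pow]
  gcongr

theorem circleMean_le_liminf {G g f : ℂ → ℂ} (hG : DiffContOnCl ℂ G (Metric.ball 0 1))
    (hG1 : ∀ u : ℂ, ‖u‖ = 1 → ‖G u‖ = 1) (hg : DifferentiableOn ℂ g (Metric.ball 0 1))
    (hf : ∀ x ∈ Metric.ball (0 : ℂ) 1, f x = G x * g x) {r : ℝ} (hr : r ∈ Ico (0 : ℝ) 1)
    {u : ℕ → ℝ} (hu : ∀ n, u n ∈ Ico (0 : ℝ) 1) (hlim : Tendsto u atTop (𝓝 1)) :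
    circleMean g r ≤ liminf (fun n => circleMean f (u n)) atTop := by
  refine ENNReal.le_of_forall_lt_one_mul_le fun c hc => ?_
  lift c to NNReal using hc.ne_top
  have hsqrt : NNReal.sqrt c < 1 := by
    rw [← NNReal.sqrt_one]
    exact NNReal.sqrt_lt_sqrt.2 (by exact_mod_cast hc)
  obtain ⟨ρ, hρ, hGρ⟩ := exists_radius_lt_norm_of_unimodular_boundary hG hG1
    (d := NNReal.sqrt c) (by exact_mod_cast hsqrt)
  refine le_liminf_of_le (by isBoundedDefault) ?_
  filter_upwards [hlim.eventually (lt_mem_nhds hρ), hlim.eventually (lt_mem_nhds hr.2)]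
    with n hn hrn
  calc (c : ENNReal) * circleMean g r ≤ (c : ENNReal) * circleMean g (u n) := by
        gcongr
        exact circleMean_mono hg hr (hu n) hrn.le
    _ = (NNReal.sqrt c : ENNReal) ^ 2 * circleMean g (u n) := by
        rw [← ENNReal.coe_pow, NNReal.sq_sqrt]
    _ ≤ circleMean f (u n) := mul_circleMean_le (hu n)
        (fun x hx => (hGρ x (hx ▸ hn) (hx ▸ (hu n).2)).le) hf

end CircleMeans

section Slices

/-- The point `(x e^{2πi s}, x e^{2πi t})` of a diagonal slice. -/
def slicePoint (t : UnitAddCircle × UnitAddCircle) (x : ℂ) : ℂ × ℂ :=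
  ((AddCircle.toCircle t.1 : ℂ) * x, (AddCircle.toCircle t.2 : ℂ) * x)

theorem slicePoint_mem (t : UnitAddCircle × UnitAddCircle) {x : ℂ}
    (hx : x ∈ Metric.ball (0 : ℂ) 1) : slicePoint t x ∈ bidisk := by
  rw [mem_bidisk]
  simpa [slicePoint, Circle.norm_coe] using hx

theorem slicePoint_ofReal (t : UnitAddCircle × UnitAddCircle) (r : ℝ) :
    slicePoint t r = torusPoint r r t := by
  simp only [slicePoint, torusPoint, mul_comm]

theorem slicePoint_mul_toCircle (t : UnitAddCircle × UnitAddCircle) (r : ℝ) (s : UnitAddCircle) :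
    slicePoint t (r * (AddCircle.toCircle s : ℂ)) = torusPoint r r (t + (s, s)) := by
  simp only [slicePoint, torusPoint, Prod.fst_add, Prod.snd_add, AddCircle.toCircle_add,
    Circle.coe_mul, mul_left_comm]

variable {f : ℂ × ℂ → ℂ} (hf : DifferentiableOn ℂ f bidisk)
include hf

theorem differentiableOn_slice (t : UnitAddCircle × UnitAddCircle) :
    DifferentiableOn ℂ (f ∘ slicePoint t) (Metric.ball 0 1) :=
  hf.comp (by unfold slicePoint; fun_prop) fun _ hx => slicePoint_mem t hx

theorem continuous_slice {r : ℝ} (hr : r ∈ Ico (0 : ℝ) 1) :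
    Continuous fun x : (UnitAddCircle × UnitAddCircle) × UnitAddCircle =>
      f (slicePoint x.1 (r * (AddCircle.toCircle x.2 : ℂ))) := by
  simp only [slicePoint_mul_toCircle]
  exact (continuous_comp_torusPoint hf hr hr).comp (by fun_prop)

theorem measurable_circleMean_slice {r : ℝ} (hr : r ∈ Ico (0 : ℝ) 1) :
    Measurable fun t => circleMean (f ∘ slicePoint t) r :=
  Measurable.lintegral_prod_right' ((continuous_slice hf hr).measurable.enorm.pow_const 2)

theorem ofReal_torusMean {r : ℝ} (hr : r ∈ Ico (0 : ℝ) 1) :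
    ENNReal.ofReal (torusMean f r) = ∫⁻ t, circleMean (f ∘ slicePoint t) r ∂torusMeasure := by
  have htrans (s : UnitAddCircle) :
      ∫⁻ t, ‖f (torusPoint r r (t + (s, s)))‖ₑ ^ 2 ∂torusMeasure =
        ∫⁻ t, ‖f (torusPoint r r t)‖ₑ ^ 2 ∂torusMeasure :=
    lintegral_add_right_eq_self (fun t => ‖f (torusPoint r r t)‖ₑ ^ 2) (s, s)
  unfold torusMean circleMean
  rw [ofReal_integral_sq_norm
      (integrable_of_continuous ((continuous_comp_torusPoint hf hr hr).norm.pow 2)),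
    lintegral_lintegral_swap
      ((continuous_slice hf hr).measurable.enorm.pow_const 2).aemeasurable]
  simp only [Function.comp_apply, slicePoint_mul_toCircle, htrans, lintegral_const, measure_univ,
    mul_one]

end Slices

section RationalInner

open Polynomial

/-- A presentation `θ = q / p` of `θ` on the bidisk with `|p| = |q|` on `𝕋²`, where `q` has no
factor `w - c` with `|c| = 1`. -/
structure IsInnerQuotient (θ : HardySpace) (p q : ℂ[X][X]) : Prop where
  ne_zero : p ≠ 0
  mul_eq : ∀ x ∈ bidisk, θ x * p.evalEval x.1 x.2 = q.evalEval x.1 x.2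
  norm_eq : ∀ u v : ℂ, ‖u‖ = 1 → ‖v‖ = 1 → ‖p.evalEval u v‖ = ‖q.evalEval u v‖
  eval_ne_zero : ∀ c : ℂ, ‖c‖ = 1 → q.eval (C c) ≠ 0

/-- A polynomial in two variables as a polynomial in the second variable whose coefficients are
polynomials in the first one. -/
def bivariate : MvPolynomial (Fin 2) ℂ →+* ℂ[X][X] :=
  MvPolynomial.eval₂Hom (C.comp C) ![C X, X]

theorem evalEval_bivariate (x y : ℂ) (p : MvPolynomial (Fin 2) ℂ) :
    (bivariate p).evalEval x y = MvPolynomial.eval ![x, y] p := by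
  have : (evalEvalRingHom x y).comp bivariate = MvPolynomial.eval ![x, y] := by
    ext i
    · simp [bivariate]
    · fin_cases i <;> simp [bivariate]
  exact DFunLike.congr_fun this p

theorem bivariate_ne_zero {p : MvPolynomial (Fin 2) ℂ} (hp : p ≠ 0) : bivariate p ≠ 0 := by
  refine fun h0 => hp (MvPolynomial.funext fun x => ?_)
  have hx : x = ![x 0, x 1] := by ext i; fin_cases i <;> rfl
  rw [hx, ← evalEval_bivariate, h0, evalEval_zero, map_zero]

theorem mul_evalEval_eq_of_X_sub_C_mul {f : ℂ × ℂ → ℂ} {p q : ℂ[X][X]} {c : ℂ} (hc : ‖c‖ = 1)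
    (h : ∀ x ∈ bidisk, f x * ((X - C (C c)) * p).evalEval x.1 x.2 =
      ((X - C (C c)) * q).evalEval x.1 x.2) {x : ℂ × ℂ} (hx : x ∈ bidisk) :
    f x * p.evalEval x.1 x.2 = q.evalEval x.1 x.2 := by
  have hxc : x.2 - c ≠ 0 := fun h0 =>
    (mem_bidisk.1 hx).2.ne (by rw [sub_eq_zero.1 h0, hc])
  have hX : (X - C (C c) : ℂ[X][X]).evalEval x.1 x.2 = x.2 - c := by simp [evalEval]
  have := h x hx
  rw [evalEval_mul, evalEval_mul, hX] at this
  exact mul_left_cancel₀ hxc (by linear_combination this)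

theorem exists_quotient_without_common_factor {f : ℂ × ℂ → ℂ} {p q : ℂ[X][X]} (hp : p ≠ 0)
    (h : ∀ x ∈ bidisk, f x * p.evalEval x.1 x.2 = q.evalEval x.1 x.2) :
    ∃ p' q' : ℂ[X][X], p' ≠ 0 ∧
      (∀ x ∈ bidisk, f x * p'.evalEval x.1 x.2 = q'.evalEval x.1 x.2) ∧
      ∀ c : ℂ, ‖c‖ = 1 → p'.eval (C c) = 0 → q'.eval (C c) ≠ 0 := by
  induction hn : p.natDegree using Nat.strong_induction_on generalizing p q with
  | _ n ih =>
    by_cases! hc : ∀ c : ℂ, ‖c‖ = 1 → p.eval (C c) = 0 → q.eval (C c) ≠ 0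
    · exact ⟨p, q, hp, h, hc⟩
    obtain ⟨c, hc1, hpc, hqc⟩ := hc
    obtain ⟨p₁, rfl⟩ := dvd_iff_isRoot.2 hpc
    obtain ⟨q₁, rfl⟩ := dvd_iff_isRoot.2 hqc
    have hp₁ : p₁ ≠ 0 := right_ne_zero_of_mul hp
    rw [natDegree_mul (X_sub_C_ne_zero _) hp₁, natDegree_X_sub_C] at hn
    exact ih p₁.natDegree (by omega) hp₁
      (fun x hx => mul_evalEval_eq_of_X_sub_C_mul hc1 h hx) rfl

theorem tendsto_torusPoint (t : UnitAddCircle × UnitAddCircle) :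
    Tendsto (fun r : ℝ => torusPoint r r t) (𝓝[<] 1)
      (𝓝 ((AddCircle.toCircle t.1 : ℂ), (AddCircle.toCircle t.2 : ℂ))) := by
  have hc : Continuous fun r : ℝ => torusPoint r r t := by
    unfold torusPoint; fun_prop
  simpa [torusPoint] using (hc.tendsto 1).mono_left (nhdsWithin_le_nhds (s := Iio 1))

variable {θ : HardySpace} {p q : ℂ[X][X]}

theorem norm_evalEval_eq (hθ : IsInner θ)
    (h : ∀ x ∈ bidisk, θ x * p.evalEval x.1 x.2 = q.evalEval x.1 x.2) {u v : ℂ} (hu : ‖u‖ = 1)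
    (hv : ‖v‖ = 1) : ‖p.evalEval u v‖ = ‖q.evalEval u v‖ := by
  have hae : (fun t : UnitAddCircle × UnitAddCircle =>
        ‖p.evalEval (AddCircle.toCircle t.1 : ℂ) (AddCircle.toCircle t.2 : ℂ)‖)
      =ᵐ[torusMeasure] fun t =>
        ‖q.evalEval (AddCircle.toCircle t.1 : ℂ) (AddCircle.toCircle t.2 : ℂ)‖ := by
    filter_upwards [hθ] with t ⟨c, hc, hlim⟩
    have hlim_eval (P : ℂ[X][X]) := ((continuous_evalEval P).tendsto _).comp (tendsto_torusPoint t)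
    have heq := tendsto_nhds_unique_of_eventuallyEq (hlim.mul (hlim_eval p)) (hlim_eval q) (by
      filter_upwards [Ico_mem_nhdsLT (zero_lt_one (α := ℝ))] with r hr
      exact h _ (torusPoint_mem hr hr t))
    rw [← heq, norm_mul, hc, one_mul]
  obtain ⟨s, rfl⟩ := exists_toCircle_eq hu
  obtain ⟨t, rfl⟩ := exists_toCircle_eq hv
  exact congrFun ((Continuous.ae_eq_iff_eq torusMeasure (continuous_evalEval_toCircle p).norm
    (continuous_evalEval_toCircle q).norm).1 hae) (s, t)

theorem exists_isInnerQuotient (hθ : IsInner θ) (hr : IsRational θ) :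
    ∃ p q, IsInnerQuotient θ p q := by
  obtain ⟨p₀, q₀, hp₀, h₀⟩ := hr
  obtain ⟨p, q, hp, h, hcop⟩ := exists_quotient_without_common_factor (q := bivariate q₀)
    (bivariate_ne_zero hp₀) (fun x hx => by simpa only [evalEval_bivariate] using h₀ x hx)
  have hnorm (u v : ℂ) (hu : ‖u‖ = 1) (hv : ‖v‖ = 1) : ‖p.evalEval u v‖ = ‖q.evalEval u v‖ :=
    norm_evalEval_eq hθ h hu hv
  refine ⟨p, q, hp, h, hnorm, fun c hc hqc => hcop c hc ?_ hqc⟩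
  by_contra hpc
  obtain ⟨t, ht⟩ := (ae_eval_toCircle_ne_zero hpc).exists
  refine ht (norm_eq_zero.1 ((hnorm _ c (Circle.norm_coe _) hc).trans ?_))
  simp [evalEval, hqc]

namespace IsInnerQuotient

variable (h : IsInnerQuotient θ p q)
include h

/-- Almost every diagonal slice of `θ` is a finite Blaschke product. -/
theorem ae_slice :
    ∀ᵐ t ∂torusMeasure, ∃ G : ℂ → ℂ, DiffContOnCl ℂ G (Metric.ball 0 1) ∧
      (∀ x ∈ Metric.ball (0 : ℂ) 1, G x = θ (slicePoint t x)) ∧ ∀ u : ℂ, ‖u‖ = 1 → ‖G u‖ = 1 := by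
  filter_upwards [ae_evalEval_ne_zero h.ne_zero] with t ht
  refine exists_diffContOnCl_extension (P := slicePoly (AddCircle.toCircle t.1)
    (AddCircle.toCircle t.2) p) (Q := slicePoly (AddCircle.toCircle t.1) (AddCircle.toCircle t.2) q)
    (fun h0 => ht ?_) (differentiableOn_slice θ.differentiableOn t).continuousOn (fun x hx => ?_)
    (fun u hu => ?_)
  · simpa only [eval_slicePoly, mul_one, eval_zero] using congrArg (eval 1) h0
  · simp only [eval_slicePoly]
    exact h.mul_eq _ (slicePoint_mem t hx)
  · simp only [eval_slicePoly]
    exact h.norm_eq _ _ (by simp [Circle.norm_coe, hu]) (by simp [Circle.norm_coe, hu])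

theorem norm_le_one {r : ℝ} (hr : r ∈ Ico (0 : ℝ) 1) (t : UnitAddCircle × UnitAddCircle) :
    ‖θ (torusPoint r r t)‖ ≤ 1 := by
  have hclosed : IsClosed {t | ‖θ (torusPoint r r t)‖ ≤ 1} :=
    isClosed_le (continuous_comp_torusPoint θ.differentiableOn hr hr).norm continuous_const
  have hdense : Dense {t | ‖θ (torusPoint r r t)‖ ≤ 1} := by
    refine Measure.dense_of_ae (μ := torusMeasure) ?_
    filter_upwards [h.ae_slice] with t ⟨G, hG, hGθ, hG1⟩
    have hball : (r : ℂ) ∈ Metric.ball (0 : ℂ) 1 := by simpa [abs_of_nonneg hr.1] using hr.2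
    rw [← slicePoint_ofReal, ← hGθ _ hball]
    exact norm_le_one_of_unimodular_boundary hG hG1 hball
  exact hclosed.closure_subset (hdense t)

theorem exists_div (f : HardySpace) {g : ℂ × ℂ → ℂ} (hg : DifferentiableOn ℂ g bidisk)
    (hfg : ∀ x ∈ bidisk, f x = θ x * g x) :
    ∃ k : HardySpace, (∀ x ∈ bidisk, k x = g x) ∧ ‖k‖ ≤ ‖f‖ := by
  refine HardySpace.exists_of_torusMean_le hg (norm_nonneg f) fun r hr => ?_
  obtain ⟨u, -, hu, hlim⟩ := exists_seq_strictMono_tendsto' (zero_lt_one (α := ℝ))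
  replace hu n : u n ∈ Ico (0 : ℝ) 1 := Ioo_subset_Ico_self (hu n)
  have hslice : ∀ᵐ t ∂torusMeasure, circleMean (g ∘ slicePoint t) r ≤
      liminf (fun n => circleMean (f ∘ slicePoint t) (u n)) atTop := by
    filter_upwards [h.ae_slice] with t ⟨G, hG, hGθ, hG1⟩
    exact circleMean_le_liminf hG hG1 (differentiableOn_slice hg t)
      (fun x hx => by simp [hGθ x hx, hfg _ (slicePoint_mem t hx)]) hr hu hlim
  rw [← ENNReal.ofReal_le_ofReal_iff (by positivity), ofReal_torusMean hg hr]
  calc ∫⁻ t, circleMean (g ∘ slicePoint t) r ∂torusMeasure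
      ≤ ∫⁻ t, liminf (fun n => circleMean (f ∘ slicePoint t) (u n)) atTop ∂torusMeasure :=
        lintegral_mono_ae hslice
    _ ≤ liminf (fun n => ∫⁻ t, circleMean (f ∘ slicePoint t) (u n) ∂torusMeasure) atTop :=
        lintegral_liminf_le fun n => measurable_circleMean_slice f.differentiableOn (hu n)
    _ ≤ ENNReal.ofReal (‖f‖ ^ 2) := by
        refine liminf_le_of_frequently_le' (Frequently.of_forall fun n => ?_)
        rw [← ofReal_torusMean f.differentiableOn (hu n)]
        exact ENNReal.ofReal_le_ofReal (f.torusMean_le_norm_sq (hu n))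

/-- The isometry `f ↦ θ f` of `H²(𝔻²)`. -/
def mulIsometry : HardySpace →ₗᵢ[ℂ] HardySpace where
  toLinearMap := HardySpace.multiplier θ.differentiableOn fun _ hr t => h.norm_le_one hr t
  norm_map' f := by
    let M := HardySpace.multiplier θ.differentiableOn fun _ hr t => h.norm_le_one hr t
    obtain ⟨k, hk, hkn⟩ := h.exists_div (M f) f.differentiableOn fun x _ => rfl
    rw [HardySpace.ext hk] at hkn
    have hM : ‖M f‖ ≤ 1 * ‖f‖ := M.le_of_opNorm_le (HardySpace.norm_multiplier_le _ _) f
    exact le_antisymm (hM.trans_eq (one_mul _)) hkn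

theorem mulIsometry_apply (f : HardySpace) (x : ℂ × ℂ) : h.mulIsometry f x = θ x * f x := rfl

theorem isClosed_multiples : IsClosed (multiples θ : Set HardySpace) := by
  have hrange : (multiples θ : Set HardySpace) = range h.mulIsometry := by
    ext f
    constructor
    · rintro ⟨g, hg⟩
      exact ⟨g, HardySpace.ext fun x hx => (hg x hx).symm⟩
    · rintro ⟨g, rfl⟩
      exact ⟨g, fun _ _ => rfl⟩
  rw [hrange]
  exact h.mulIsometry.isometry.isClosedEmbedding.isClosed_range

theorem norm_le : ‖θ‖ ≤ 1 := by
  have hθ : h.mulIsometry HardySpace.one = θ := HardySpace.ext fun x hx => by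
    rw [h.mulIsometry_apply, HardySpace.one_apply hx, mul_one]
  rw [← hθ, LinearIsometry.norm_map, HardySpace.norm_one]

end IsInnerQuotient

end RationalInner

section Sections

theorem mk_mem_bidisk {z w : ℂ} (hz : ‖z‖ < 1) (hw : ‖w‖ < 1) : (z, w) ∈ bidisk :=
  mem_bidisk.2 ⟨hz, hw⟩

theorem differentiableOn_section_snd {f : ℂ × ℂ → ℂ} (hf : DifferentiableOn ℂ f bidisk) {l : ℂ}
    (hl : ‖l‖ < 1) : DifferentiableOn ℂ (fun w => f (l, w)) (Metric.ball 0 1) :=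
  hf.comp (by fun_prop) fun _ hw => mk_mem_bidisk hl (mem_ball_zero_iff.1 hw)

theorem differentiableOn_section_fst {f : ℂ × ℂ → ℂ} (hf : DifferentiableOn ℂ f bidisk) {w : ℂ}
    (hw : ‖w‖ < 1) : DifferentiableOn ℂ (fun z => f (z, w)) (Metric.ball 0 1) :=
  hf.comp (by fun_prop) fun _ hz => mk_mem_bidisk (mem_ball_zero_iff.1 hz) hw

theorem eqOn_of_sub_mul_eq {F G : ℂ → ℂ} {U : Set ℂ} (hU : IsOpen U) (hF : ContinuousOn F U)
    (hG : ContinuousOn G U) {a : ℂ} (h : ∀ w ∈ U, (w - a) * F w = (w - a) * G w) :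
    EqOn F G U := by
  intro w hw
  rcases eq_or_ne w a with rfl | hwa
  · refine tendsto_nhds_unique_of_eventuallyEq (l := 𝓝[≠] w)
      ((hF.continuousAt (hU.mem_nhds hw)).tendsto.mono_left nhdsWithin_le_nhds)
      ((hG.continuousAt (hU.mem_nhds hw)).tendsto.mono_left nhdsWithin_le_nhds) ?_
    filter_upwards [self_mem_nhdsWithin, nhdsWithin_le_nhds (hU.mem_nhds hw)] with y hy hyU
    exact mul_left_cancel₀ (sub_ne_zero.2 hy) (h y hyU)
  · exact mul_left_cancel₀ (sub_ne_zero.2 hwa) (h w hw)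

namespace HardySpace

theorem eq_of_fst_sub_mul_eq {f g : HardySpace} {l : ℂ}
    (h : ∀ x ∈ bidisk, (x.1 - l) * f x = (x.1 - l) * g x) : f = g := by
  refine ext fun x hx => ?_
  obtain ⟨hx1, hx2⟩ := mem_bidisk.1 hx
  exact eqOn_of_sub_mul_eq Metric.isOpen_ball
    (differentiableOn_section_fst f.differentiableOn hx2).continuousOn
    (differentiableOn_section_fst g.differentiableOn hx2).continuousOn
    (fun z hz => h (z, x.2) (mk_mem_bidisk (mem_ball_zero_iff.1 hz) hx2)) (mem_ball_zero_iff.2 hx1)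

theorem shiftZ_sub_smul_apply (f : HardySpace) (l : ℂ) (x : ℂ × ℂ) :
    (shiftZ f - l • f) x = (x.1 - l) * f x := by
  rw [sub_apply, smul_apply, shiftZ_apply, sub_mul]

end HardySpace

end Sections

section BlaschkeFactor

/-- The Blaschke factor with zero `l`. -/
def blaschke (l z : ℂ) : ℂ := (z - l) / (1 - conj l * z)

variable {l : ℂ} (hl : ‖l‖ < 1)
include hl

theorem one_sub_conj_mul_ne_zero {z : ℂ} (hz : ‖z‖ ≤ 1) : 1 - conj l * z ≠ 0 := by
  refine sub_ne_zero.2 fun h => ?_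
  have hlt : ‖conj l * z‖ < 1 := by
    rw [norm_mul, RCLike.norm_conj]
    exact mul_lt_one_of_nonneg_of_lt_one_left (norm_nonneg l) hl hz
  rw [← h, norm_one] at hlt
  exact hlt.false

theorem blaschke_eq_zero_iff {z : ℂ} (hz : ‖z‖ ≤ 1) : blaschke l z = 0 ↔ z = l := by
  rw [blaschke, div_eq_zero_iff, or_iff_left (one_sub_conj_mul_ne_zero hl hz), sub_eq_zero]

theorem norm_blaschke_eq_one {u : ℂ} (hu : ‖u‖ = 1) : ‖blaschke l u‖ = 1 := by
  have hden : 1 - conj l * u = u * conj (u - l) := by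
    rw [map_sub, mul_sub, Complex.mul_conj', hu]
    push_cast
    ring
  have hne := one_sub_conj_mul_ne_zero hl hu.le
  rw [blaschke, hden, norm_div, norm_mul, hu, one_mul, RCLike.norm_conj]
  rw [hden] at hne
  exact div_self (norm_ne_zero_iff.2 ((map_ne_zero _).1 (right_ne_zero_of_mul hne)))

theorem differentiableOn_blaschke : DifferentiableOn ℂ (blaschke l) (Metric.closedBall 0 1) :=
  DifferentiableOn.div (by fun_prop) (by fun_prop)
    fun _ hz => one_sub_conj_mul_ne_zero hl (mem_closedBall_zero_iff.1 hz)

theorem norm_blaschke_le_one {z : ℂ} (hz : z ∈ Metric.ball (0 : ℂ) 1) : ‖blaschke l z‖ ≤ 1 :=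
  norm_le_one_of_unimodular_boundary ((differentiableOn_blaschke hl).diffContOnCl_ball subset_rfl)
    (fun _ => norm_blaschke_eq_one hl) hz

/-- The Blaschke factor in the variable `z`, as an element of `H²(𝔻²)`. -/
def blaschkeFst : HardySpace :=
  HardySpace.multiplier (φ := fun x => blaschke l x.1)
    ((differentiableOn_blaschke hl).comp (by fun_prop)
      fun _ hx => mem_closedBall_zero_iff.2 (mem_bidisk.1 hx).1.le)
    (fun _ hr t => norm_blaschke_le_one hl
      (mem_ball_zero_iff.2 (mem_bidisk.1 (torusPoint_mem hr hr t)).1)) HardySpace.one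

theorem blaschkeFst_apply {x : ℂ × ℂ} (hx : x ∈ bidisk) : blaschkeFst hl x = blaschke l x.1 := by
  rw [blaschkeFst, HardySpace.multiplier_apply, HardySpace.one_apply hx, mul_one]

theorem isInner_blaschkeFst : IsInner (blaschkeFst hl) := by
  refine ae_of_all _ fun t => ⟨_, norm_blaschke_eq_one hl (Circle.norm_coe t.1.toCircle), ?_⟩
  have hfst := (continuous_fst.tendsto _).comp (tendsto_torusPoint t)
  refine ((hfst.sub_const l).div ((hfst.const_mul (conj l)).const_sub 1)
    (one_sub_conj_mul_ne_zero hl (Circle.norm_coe t.1.toCircle).le)).congr' ?_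
  filter_upwards [Ico_mem_nhdsLT (zero_lt_one (α := ℝ))] with r hr
  exact (blaschkeFst_apply hl (torusPoint_mem hr hr t)).symm

theorem not_isConst_blaschkeFst : ¬ IsConst (blaschkeFst hl) := by
  rintro ⟨c, hc⟩
  obtain ⟨m, hm, hml⟩ := (infinite_of_mem_nhds l
    (Metric.isOpen_ball.mem_nhds (mem_ball_zero_iff.2 hl))).nontrivial.exists_ne l
  have hval {z : ℂ} (hz : ‖z‖ < 1) : blaschke l z = c := by
    have hx := mk_mem_bidisk hz (w := 0) (by simp)
    rw [← hc _ hx, blaschkeFst_apply hl hx]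
  have hzero : blaschke l l = 0 := (blaschke_eq_zero_iff hl hl.le).2 rfl
  have hm1 : ‖m‖ < 1 := mem_ball_zero_iff.1 hm
  exact hml ((blaschke_eq_zero_iff hl hm1.le).1 ((hval hm1).trans ((hval hl).symm.trans hzero)))

theorem exists_eq_blaschkeFst_mul {f : HardySpace}
    (h : ∀ w ∈ Metric.ball (0 : ℂ) 1, f (l, w) = 0) :
    ∃ g : HardySpace, ∀ x ∈ bidisk, f x = blaschkeFst hl x * g x := by
  obtain ⟨g, hg⟩ := HardySpace.exists_difference_quotient_fst f hl
  refine ⟨g - conj l • HardySpace.shiftZ g, fun x hx => ?_⟩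
  obtain ⟨hx1, hx2⟩ := mem_bidisk.1 hx
  have hfg : f x = (x.1 - l) * g x := by
    rw [← hg x hx, h x.2 (mem_ball_zero_iff.2 hx2), sub_zero]
  have hgx : (g - conj l • HardySpace.shiftZ g) x = (1 - conj l * x.1) * g x := by
    rw [HardySpace.sub_apply, HardySpace.smul_apply, HardySpace.shiftZ_apply]
    ring
  rw [hfg, hgx, blaschkeFst_apply hl hx, blaschke, ← mul_assoc,
    div_mul_cancel₀ _ (one_sub_conj_mul_ne_zero hl hx1.le)]

omit hl in
theorem IsInner.of_mul_left {φ ψ θ : HardySpace} (hφ : IsInner φ) (hθ : IsInner θ)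
    (h : ∀ x ∈ bidisk, θ x = φ x * ψ x) : IsInner ψ := by
  filter_upwards [hφ, hθ] with t ⟨d, hd, hd'⟩ ⟨c, hc, hc'⟩
  have hd0 : d ≠ 0 := norm_ne_zero_iff.1 (by rw [hd]; exact one_ne_zero)
  refine ⟨c / d, by rw [norm_div, hc, hd, div_one], (hc'.div hd' hd0).congr' ?_⟩
  filter_upwards [Ico_mem_nhdsLT (zero_lt_one (α := ℝ)), hd'.eventually_ne hd0] with r hr hr'
  rw [Pi.div_apply, h _ (torusPoint_mem hr hr t), mul_div_cancel_left₀ _ hr']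

theorem exists_section_ne_zero {θ : HardySpace} (hθ : IsInner θ) (hz : ¬ HasInnerFactorInZ θ) :
    ∃ w ∈ Metric.ball (0 : ℂ) 1, θ (l, w) ≠ 0 := by
  by_contra! h
  obtain ⟨ψ, hψ⟩ := exists_eq_blaschkeFst_mul hl h
  exact hz ⟨blaschkeFst hl, ψ, isInner_blaschkeFst hl, (isInner_blaschkeFst hl).of_mul_left hθ hψ,
    not_isConst_blaschkeFst hl, ⟨blaschke l, fun _ => blaschkeFst_apply hl⟩, hψ⟩

end BlaschkeFactor

section CompressedShift

open Polynomial

variable {θ : HardySpace} {p q : ℂ[X][X]}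

/-- The operator `S_z - l` on `K_θ`. -/
abbrev shiftSub (θ : HardySpace) (l : ℂ) : quotientModule θ →L[ℂ] quotientModule θ :=
  compressedShift θ - l • ContinuousLinearMap.id ℂ (quotientModule θ)

/-- The orthogonal projection of `H²(𝔻²)` onto `K_θ`. -/
abbrev projK (θ : HardySpace) : HardySpace →L[ℂ] quotientModule θ :=
  (quotientModule θ).orthogonalProjectionOnto

/-- The functions whose restriction to the line `z = l` is a multiple of that of `θ`. For
`|l| < 1` this is `θ H²(𝔻²) + (z - l) H²(𝔻²)`. -/
def lineMultiples (θ : HardySpace) (l : ℂ) : Submodule ℂ HardySpace where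
  carrier := {f | ∃ g : HardySpace, ∀ w ∈ Metric.ball (0 : ℂ) 1, f (l, w) = θ (l, w) * g (l, w)}
  zero_mem' := ⟨0, fun w _ => by rw [HardySpace.zero_apply, mul_zero]⟩
  add_mem' := by
    rintro f g ⟨f', hf⟩ ⟨g', hg⟩
    exact ⟨f' + g', fun w hw => by
      rw [HardySpace.add_apply, HardySpace.add_apply, hf w hw, hg w hw, mul_add]⟩
  smul_mem' := by
    rintro c f ⟨f', hf⟩
    exact ⟨c • f', fun w hw => by
      rw [HardySpace.smul_apply, HardySpace.smul_apply, hf w hw, mul_left_comm]⟩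

theorem eq_zero_of_mem_multiples (k : quotientModule θ) (hk : (k : HardySpace) ∈ multiples θ) :
    k = 0 :=
  Subtype.ext (inner_self_eq_zero.1 (k.2 _ hk))

theorem shiftZ_sub_mem_multiples {f : HardySpace} (hf : f ∈ multiples θ) (l : ℂ) :
    HardySpace.shiftZ f - l • f ∈ multiples θ := by
  obtain ⟨g, hg⟩ := hf
  refine ⟨HardySpace.shiftZ g - l • g, fun x hx => ?_⟩
  rw [HardySpace.shiftZ_sub_smul_apply, HardySpace.shiftZ_sub_smul_apply, hg x hx, mul_left_comm]

theorem shiftSub_apply (l : ℂ) (k : quotientModule θ) :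
    shiftSub θ l k = projK θ (HardySpace.shiftZ k - l • (k : HardySpace)) := by
  rw [map_sub, map_smul, Submodule.orthogonalProjectionOnto_mem_subspace_eq_self]
  rfl

namespace IsInnerQuotient

variable (h : IsInnerQuotient θ p q)
include h

theorem projK_eq_zero_iff {f : HardySpace} : projK θ f = 0 ↔ f ∈ multiples θ := by
  rw [Submodule.orthogonalProjectionOnto_eq_zero_iff, quotientModule,
    Submodule.orthogonal_orthogonal_eq_closure,
    h.isClosed_multiples.submodule_topologicalClosure_eq]

theorem sub_projK_mem (f : HardySpace) : f - (projK θ f : HardySpace) ∈ multiples θ := by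
  rw [← h.projK_eq_zero_iff, map_sub, Submodule.orthogonalProjectionOnto_mem_subspace_eq_self,
    sub_self]

theorem shiftSub_projK (l : ℂ) (f : HardySpace) :
    shiftSub θ l (projK θ f) = projK θ (HardySpace.shiftZ f - l • f) := by
  have hmem := h.projK_eq_zero_iff.2 (shiftZ_sub_mem_multiples (h.sub_projK_mem f) l)
  rw [shiftSub_apply, eq_comm, ← sub_eq_zero, ← hmem]
  simp only [map_sub, smul_sub]
  abel

theorem projK_mem_range_iff {l : ℂ} (hl : ‖l‖ < 1) (f : HardySpace) :
    projK θ f ∈ (shiftSub θ l).range ↔ f ∈ lineMultiples θ l := by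
  constructor
  · rintro ⟨k, hk : shiftSub θ l k = projK θ f⟩
    rw [shiftSub_apply, eq_comm, ← sub_eq_zero, ← map_sub, h.projK_eq_zero_iff] at hk
    obtain ⟨g, hg⟩ := hk
    refine ⟨g, fun w hw => ?_⟩
    rw [← hg _ (mk_mem_bidisk hl (mem_ball_zero_iff.1 hw)), HardySpace.sub_apply,
      HardySpace.shiftZ_sub_smul_apply, sub_self, zero_mul, sub_zero]
  · rintro ⟨g, hg⟩
    obtain ⟨k, hk⟩ := HardySpace.exists_difference_quotient_fst (f - h.mulIsometry g) hl
    have hf : f - h.mulIsometry g = HardySpace.shiftZ k - l • k := by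
      refine HardySpace.ext fun x hx => ?_
      rw [HardySpace.shiftZ_sub_smul_apply, ← hk x hx, HardySpace.sub_apply _ _ (l, x.2),
        h.mulIsometry_apply, hg x.2 (mem_ball_zero_iff.2 (mem_bidisk.1 hx).2), sub_self, sub_zero]
    have hθg : projK θ (h.mulIsometry g) = 0 :=
      h.projK_eq_zero_iff.2 ⟨g, fun x _ => h.mulIsometry_apply g x⟩
    exact ⟨projK θ k, (h.shiftSub_projK l k).trans (by rw [← hf, map_sub, hθg, sub_zero])⟩

theorem ker_shiftSub_eq_bot {l : ℂ} (hl : ‖l‖ < 1)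
    (hne : ∃ w ∈ Metric.ball (0 : ℂ) 1, θ (l, w) ≠ 0) : (shiftSub θ l).ker = ⊥ := by
  refine (Submodule.eq_bot_iff _).2 fun k (hk : shiftSub θ l k = 0) => ?_
  rw [shiftSub_apply, h.projK_eq_zero_iff] at hk
  obtain ⟨g, hg⟩ := hk
  simp only [HardySpace.shiftZ_sub_smul_apply] at hg
  have hgl : ∀ w ∈ Metric.ball (0 : ℂ) 1, g (l, w) = 0 := by
    refine (AnalyticOnNhd.eq_zero_or_eq_zero_of_mul_eq_zero
      ((differentiableOn_section_snd θ.differentiableOn hl).analyticOnNhd Metric.isOpen_ball)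
      ((differentiableOn_section_snd g.differentiableOn hl).analyticOnNhd Metric.isOpen_ball)
      (fun w hw => ?_) (convex_ball _ _).isPreconnected).resolve_left (by push Not; exact hne)
    rw [← hg _ (mk_mem_bidisk hl (mem_ball_zero_iff.1 hw)), sub_self, zero_mul]
  obtain ⟨g₁, hg₁⟩ := HardySpace.exists_difference_quotient_fst g hl
  have hkg : (k : HardySpace) = h.mulIsometry g₁ :=
    HardySpace.eq_of_fst_sub_mul_eq (l := l) fun x hx => by
      rw [hg x hx, h.mulIsometry_apply, mul_left_comm, ← hg₁ x hx,
        hgl _ (mem_ball_zero_iff.2 (mem_bidisk.1 hx).2), sub_zero]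
  exact eq_zero_of_mem_multiples k ⟨g₁, fun x _ => by rw [hkg, h.mulIsometry_apply]⟩

end IsInnerQuotient

theorem norm_compressedShift_le : ‖compressedShift θ‖ ≤ 1 := by
  refine ContinuousLinearMap.opNorm_le_bound _ zero_le_one fun k => ?_
  calc ‖projK θ (HardySpace.shiftZ k)‖ ≤ ‖HardySpace.shiftZ (k : HardySpace)‖ :=
        Submodule.norm_orthogonalProjectionOnto_apply_le _ _
    _ ≤ 1 * ‖k‖ := HardySpace.shiftZ.le_of_opNorm_le HardySpace.norm_shiftZ_le _

theorem eq_zero_of_compressedShift_eq_smul {l : ℂ} (hl : 1 ≤ ‖l‖) {k : quotientModule θ}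
    (hk : compressedShift θ k = l • k) : k = 0 := by
  have hP : (quotientModule θ).starProjection (HardySpace.shiftZ k) = l • (k : HardySpace) :=
    congrArg Subtype.val hk
  -- The projection does not decrease the norm of `z k`, so it fixes `z k`.
  have hmem : HardySpace.shiftZ k ∈ quotientModule θ := by
    refine ((quotientModule θ).mem_iff_norm_starProjection _).2
      (((quotientModule θ).norm_starProjection_apply_le _).antisymm ?_)
    calc ‖HardySpace.shiftZ (k : HardySpace)‖ ≤ 1 * ‖(k : HardySpace)‖ :=
          HardySpace.shiftZ.le_of_opNorm_le HardySpace.norm_shiftZ_le _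
      _ ≤ ‖l‖ * ‖(k : HardySpace)‖ := by gcongr
      _ = ‖(quotientModule θ).starProjection (HardySpace.shiftZ k)‖ := by rw [hP, norm_smul]
  rw [Submodule.starProjection_eq_self_iff.2 hmem] at hP
  refine Subtype.ext (HardySpace.ext fun x hx => ?_)
  have hx0 : (x.1 - l) * (k : HardySpace) x = 0 := by
    rw [← HardySpace.shiftZ_sub_smul_apply, hP, sub_self, HardySpace.zero_apply]
  exact (mul_eq_zero.1 hx0).resolve_left
    (sub_ne_zero.2 (ne_of_apply_ne norm ((mem_bidisk.1 hx).1.trans_le hl).ne))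

theorem norm_lt_one_of_mem_spectrum_of_notMem_essentialSpectrum {l : ℂ}
    (hs : l ∈ spectrum ℂ (compressedShift θ)) (he : l ∉ essentialSpectrum (compressedShift θ)) :
    ‖l‖ < 1 := by
  by_contra! hl
  have hF : (shiftSub θ l).IsFredholm := not_not.1 he
  have hinj {k : quotientModule θ} := eq_zero_of_compressedShift_eq_smul hl (k := k)
  refine mem_spectrum_iff.1 hs
    ⟨(Submodule.eq_bot_iff _).2 fun k hk => hinj (sub_eq_zero.1 hk), ?_⟩
  rw [← topologicalClosure_range_eq_top norm_compressedShift_le hl fun k => hinj]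
  exact hF.isClosed_range.submodule_topologicalClosure_eq.symm

end CompressedShift

section ZeroCount

open Polynomial

theorem analyticOrderAt_eval {𝕜 : Type*} [NontriviallyNormedField 𝕜] {b : 𝕜[X]} (hb : b ≠ 0)
    (w : 𝕜) : analyticOrderAt (fun z => b.eval z) w = b.rootMultiplicity w := by
  obtain ⟨c, hc, hcw⟩ := exists_eq_pow_rootMultiplicity_mul_and_not_dvd b hb w
  refine (AnalyticAt.analyticOrderAt_eq_natCast (AnalyticOnNhd.eval_polynomial b w trivial)).2
    ⟨fun z => c.eval z, AnalyticOnNhd.eval_polynomial c w trivial,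
      fun h => hcw (dvd_iff_isRoot.2 h), Eventually.of_forall fun z => ?_⟩
  conv_lhs => rw [hc]
  rw [eval_mul, eval_pow, eval_sub, eval_X, eval_C, smul_eq_mul]

theorem hasZeroCount_of_eval_eq_mul {g u : ℂ → ℂ} {b : ℂ[X]} (hb : b ≠ 0)
    (hg : DifferentiableOn ℂ g (Metric.ball 0 1)) (hu : DifferentiableOn ℂ u (Metric.ball 0 1))
    (h : ∀ w ∈ Metric.ball (0 : ℂ) 1, b.eval w = g w * u w)
    (hu0 : ∀ w ∈ Metric.ball (0 : ℂ) 1, u w ≠ 0)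
    (hroots : ∀ w, b.IsRoot w → w ∈ Metric.ball (0 : ℂ) 1) : HasZeroCount g b.natDegree := by
  classical
  have hmem (w : ℂ) : w ∈ b.roots.toFinset ↔ w ∈ Metric.ball (0 : ℂ) 1 ∧ g w = 0 := by
    rw [Multiset.mem_toFinset, mem_roots hb]
    refine ⟨fun hw => ⟨hroots w hw, ?_⟩, fun ⟨hw, hgw⟩ => by rw [IsRoot, h w hw, hgw, zero_mul]⟩
    exact (mul_eq_zero.1 ((h w (hroots w hw)).symm.trans hw)).resolve_right (hu0 w (hroots w hw))
  have horder : ∀ w ∈ b.roots.toFinset, analyticOrderAt g w = (b.roots.count w : ℕ∞) := by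
    intro w hw
    have hwb := (hmem w).1 hw |>.1
    have hnhds := Metric.isOpen_ball.mem_nhds hwb
    have hu_order : analyticOrderAt u w = 0 :=
      (hu.analyticAt hnhds).analyticOrderAt_eq_zero.2 (hu0 w hwb)
    have hbg : (fun z => b.eval z) =ᶠ[𝓝 w] g * u := by
      filter_upwards [hnhds] with z hz using h z hz
    rw [count_roots, ← analyticOrderAt_eval hb, analyticOrderAt_congr hbg,
      analyticOrderAt_mul (hg.analyticAt hnhds) (hu.analyticAt hnhds), hu_order, add_zero]
  refine ⟨b.roots.toFinset, hmem, ?_⟩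
  rw [Finset.sum_congr rfl horder, ← Nat.cast_sum, Multiset.toFinset_sum_count_eq,
    IsAlgClosed.card_roots_eq_natDegree]

/-- The polynomials in `w`, as elements of `H²(𝔻²)`. -/
def ofPoly : ℂ[X] →ₗ[ℂ] HardySpace where
  toFun r := aeval HardySpace.shiftW r HardySpace.one
  map_add' r s := by rw [map_add, add_apply]
  map_smul' c r := by rw [map_smul, smul_apply, RingHom.id_apply]

theorem ofPoly_apply (r : ℂ[X]) {x : ℂ × ℂ} (hx : x ∈ bidisk) : ofPoly r x = r.eval x.2 :=
  (HardySpace.aeval_shiftW_apply r _ x).trans (by rw [HardySpace.one_apply hx, mul_one])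

theorem ofPoly_mul (r s : ℂ[X]) : ofPoly (r * s) = aeval HardySpace.shiftW r (ofPoly s) :=
  DFunLike.congr_fun (map_mul (aeval HardySpace.shiftW) r s) HardySpace.one

variable {θ : HardySpace} {l : ℂ}

theorem aeval_shiftW_mem_lineMultiples (r : ℂ[X]) {f : HardySpace} (hf : f ∈ lineMultiples θ l) :
    aeval HardySpace.shiftW r f ∈ lineMultiples θ l := by
  obtain ⟨g, hg⟩ := hf
  exact ⟨aeval HardySpace.shiftW r g, fun w hw => by
    rw [HardySpace.aeval_shiftW_apply, HardySpace.aeval_shiftW_apply, hg w hw, mul_left_comm]⟩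

/-- The polynomials in `w` that belong to `lineMultiples θ l`. -/
def polyIdeal (θ : HardySpace) (l : ℂ) : Ideal ℂ[X] where
  __ := ((lineMultiples θ l).comap ofPoly).toAddSubmonoid
  smul_mem' r s hs := by
    change ofPoly (r * s) ∈ lineMultiples θ l
    rw [ofPoly_mul]
    exact aeval_shiftW_mem_lineMultiples r hs

theorem mem_polyIdeal_iff_ofPoly_mem {r : ℂ[X]} :
    r ∈ polyIdeal θ l ↔ ofPoly r ∈ lineMultiples θ l := Iff.rfl

theorem mem_polyIdeal_iff (hl : ‖l‖ < 1) {r : ℂ[X]} : r ∈ polyIdeal θ l ↔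
    ∃ g : HardySpace, ∀ w ∈ Metric.ball (0 : ℂ) 1, r.eval w = θ (l, w) * g (l, w) := by
  refine exists_congr fun g => forall₂_congr fun w hw => ?_
  rw [ofPoly_apply r (mk_mem_bidisk hl (mem_ball_zero_iff.1 hw))]

theorem mem_polyIdeal_of_X_sub_C_mul (hl : ‖l‖ < 1) {m : ℂ} (hm : ‖m‖ < 1) {c : ℂ[X]}
    {k : HardySpace} (hkm : k (l, m) = 0)
    (hk : ∀ w ∈ Metric.ball (0 : ℂ) 1, ((X - C m) * c).eval w = θ (l, w) * k (l, w)) :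
    c ∈ polyIdeal θ l := by
  obtain ⟨k₁, hk₁⟩ := HardySpace.exists_difference_quotient_snd k hm
  refine (mem_polyIdeal_iff hl).2 ⟨k₁, eqOn_of_sub_mul_eq (a := m) Metric.isOpen_ball
    c.continuous.continuousOn ((differentiableOn_section_snd θ.differentiableOn hl).mul
      (differentiableOn_section_snd k₁.differentiableOn hl)).continuousOn fun w hw => ?_⟩
  have hkw : k (l, w) = (w - m) * k₁ (l, w) := by
    simpa only [hkm, sub_zero] using hk₁ (l, w) (mk_mem_bidisk hl (mem_ball_zero_iff.1 hw))
  have hcw := hk w hw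
  rw [eval_mul, eval_sub, eval_X, eval_C, hkw, mul_left_comm] at hcw
  exact hcw

/-- The map `f ↦ P f + Ran (S_z - l)`. -/
def cokerMap (θ : HardySpace) (l : ℂ) :
    HardySpace →L[ℂ] (quotientModule θ ⧸ (shiftSub θ l).range) :=
  (shiftSub θ l).range.mkQL ∘L projK θ

theorem cokerMap_surjective (θ : HardySpace) (l : ℂ) : Function.Surjective (cokerMap θ l) := by
  intro y
  obtain ⟨k, rfl⟩ := (shiftSub θ l).range.mkQ_surjective y
  exact ⟨k, congrArg (shiftSub θ l).range.mkQ
    (Submodule.orthogonalProjectionOnto_mem_subspace_eq_self k)⟩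

theorem map_cokerMap_eq_top (hF : (shiftSub θ l).IsFredholm) {W : Submodule ℂ HardySpace}
    (hW : W.topologicalClosure = ⊤) : W.map (cokerMap θ l).toLinearMap = ⊤ := by
  have := hF.finite_coker
  have : IsClosed ((shiftSub θ l).range : Set (quotientModule θ)) := hF.isClosed_range
  have hclosed : IsClosed ((W.map (cokerMap θ l).toLinearMap).comap
      (cokerMap θ l).toLinearMap : Set HardySpace) :=
    (Submodule.closed_of_finiteDimensional (W.map (cokerMap θ l).toLinearMap)).preimage
      (cokerMap θ l).continuous
  have htop := W.topologicalClosure_minimal (W.le_comap_map _) hclosed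
  rw [hW, top_le_iff] at htop
  rw [← Submodule.map_comap_eq_of_surjective (f := (cokerMap θ l).toLinearMap)
    (cokerMap_surjective θ l) (W.map _), htop, Submodule.map_top, LinearMap.range_eq_top]
  exact cokerMap_surjective θ l

theorem eq_zero_of_shiftW_eq_smul {m : ℂ} (hm : 1 ≤ ‖m‖) {f : HardySpace}
    (hf : HardySpace.shiftW f = m • f) : f = 0 := by
  refine HardySpace.ext fun x hx => ?_
  have hx0 : (x.2 - m) * f x = 0 := by
    rw [sub_mul, ← HardySpace.shiftW_apply, hf, HardySpace.smul_apply, sub_self]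
  exact (mul_eq_zero.1 hx0).resolve_left
    (sub_ne_zero.2 (ne_of_apply_ne norm ((mem_bidisk.1 hx).2.trans_le hm).ne))

namespace IsInnerQuotient

variable {p q : ℂ[X][X]} (h : IsInnerQuotient θ p q) (hl : ‖l‖ < 1)
include h hl

theorem cokerMap_eq_zero_iff {f : HardySpace} : cokerMap θ l f = 0 ↔ f ∈ lineMultiples θ l :=
  (Submodule.Quotient.mk_eq_zero _).trans (h.projK_mem_range_iff hl f)

theorem cokerMap_eq_cokerMap_iff {f g : HardySpace} :
    cokerMap θ l f = cokerMap θ l g ↔ f - g ∈ lineMultiples θ l := by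
  rw [← sub_eq_zero, ← map_sub, h.cokerMap_eq_zero_iff hl]

theorem ker_cokerMap_comp_ofPoly : ((cokerMap θ l).toLinearMap ∘ₗ ofPoly).ker =
    (polyIdeal θ l).restrictScalars ℂ :=
  Submodule.ext fun _ => h.cokerMap_eq_zero_iff hl

variable (hF : (shiftSub θ l).IsFredholm)
include hF

-- Monomials span a dense subspace, and `z` acts on the cokernel as the scalar `l`.
theorem cokerMap_comp_ofPoly_surjective :
    Function.Surjective ((cokerMap θ l).toLinearMap ∘ₗ ofPoly) := by
  rw [← LinearMap.range_eq_top, eq_top_iff,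
    ← map_cokerMap_eq_top hF HardySpace.monomialBasis.dense_span, Submodule.map_span,
    Submodule.span_le]
  rintro _ ⟨_, ⟨⟨m, n⟩, rfl⟩, rfl⟩
  refine ⟨C (l ^ m) * X ^ n, (h.cokerMap_eq_cokerMap_iff hl).2 ⟨0, fun w hw => ?_⟩⟩
  have hx := mk_mem_bidisk hl (mem_ball_zero_iff.1 hw)
  rw [HardySpace.sub_apply, ofPoly_apply _ hx, HardySpace.monomialBasis_apply _ hx,
    HardySpace.zero_apply, eval_mul, eval_C, eval_X_pow, sub_self, mul_zero]

theorem exists_generator_polyIdeal : ∃ b : ℂ[X], b ≠ 0 ∧ polyIdeal θ l = Ideal.span {b} ∧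
    b.natDegree = Module.finrank ℂ (quotientModule θ ⧸ (shiftSub θ l).range) := by
  have hfin := hF.finite_coker
  obtain ⟨b, hb⟩ := IsPrincipalIdealRing.principal (polyIdeal θ l)
  have hker := h.ker_cokerMap_comp_ofPoly hl
  refine ⟨b, ?_, hb, ?_⟩
  · rintro rfl
    have hinj : Function.Injective ((cokerMap θ l).toLinearMap ∘ₗ ofPoly) := by
      rw [← LinearMap.ker_eq_bot, hker, hb, Submodule.span_zero_singleton,
        Submodule.restrictScalars_bot]
    exact Polynomial.not_finite (R := ℂ) (Module.Finite.of_injective _ hinj)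
  · rw [← finrank_quotient_span_eq_natDegree (f := b), Ideal.span, ← hb]
    exact ((Submodule.Quotient.restrictScalarsEquiv ℂ (polyIdeal θ l)).symm.trans
      ((Submodule.quotEquivOfEq _ _ hker.symm).trans (LinearMap.quotKerEquivOfSurjective _
        (h.cokerMap_comp_ofPoly_surjective hl hF)))).finrank_eq

theorem exists_X_sub_C_mul_sub_one_mem_polyIdeal {m : ℂ} (hm : 1 ≤ ‖m‖) :
    ∃ s : ℂ[X], (X - C m) * s - 1 ∈ polyIdeal θ l := by
  have htop := map_cokerMap_eq_top hF (topologicalClosure_range_eq_top HardySpace.norm_shiftW_le hm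
    fun f => eq_zero_of_shiftW_eq_smul hm)
  have hA : aeval HardySpace.shiftW (X - C m) =
      HardySpace.shiftW - m • ContinuousLinearMap.id ℂ HardySpace := by
    rw [map_sub, aeval_X, aeval_C, Algebra.algebraMap_eq_smul_one]
    rfl
  rw [← hA] at htop
  obtain ⟨_, ⟨g, rfl⟩, hg⟩ := htop ▸ Submodule.mem_top (x := cokerMap θ l (ofPoly 1))
  obtain ⟨s, hs⟩ := h.cokerMap_comp_ofPoly_surjective hl hF (cokerMap θ l g)
  refine ⟨s, mem_polyIdeal_iff_ofPoly_mem.2 ?_⟩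
  have hsplit : ofPoly ((X - C m) * s - 1) = aeval HardySpace.shiftW (X - C m) (ofPoly s - g) +
      (aeval HardySpace.shiftW (X - C m) g - ofPoly 1) := by
    rw [map_sub, map_sub, ofPoly_mul, sub_add_sub_cancel]
  rw [hsplit]
  exact add_mem (aeval_shiftW_mem_lineMultiples _ ((h.cokerMap_eq_cokerMap_iff hl).1 hs))
    ((h.cokerMap_eq_cokerMap_iff hl).1 hg)

theorem hasZeroCount : HasZeroCount (fun w => θ (l, w))
    (Module.finrank ℂ (quotientModule θ ⧸ (shiftSub θ l).range)) := by
  obtain ⟨b, hb, hspan, hdeg⟩ := h.exists_generator_polyIdeal hl hF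
  have hI (r : ℂ[X]) : r ∈ polyIdeal θ l ↔ b ∣ r := hspan ▸ Ideal.mem_span_singleton
  obtain ⟨k, hk⟩ := (mem_polyIdeal_iff hl).1 ((hI b).2 dvd_rfl)
  rw [← hdeg]
  refine hasZeroCount_of_eval_eq_mul hb (differentiableOn_section_snd θ.differentiableOn hl)
    (differentiableOn_section_snd k.differentiableOn hl) hk (fun m hm hkm => ?_) fun m hm => ?_
  · -- A zero of `k` would allow a linear factor of `b` to be removed.
    obtain ⟨c, rfl⟩ := dvd_iff_isRoot.2 (by rw [IsRoot, hk m hm, hkm, mul_zero] : b.IsRoot m)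
    have hc0 : c ≠ 0 := right_ne_zero_of_mul hb
    have hcI := mem_polyIdeal_of_X_sub_C_mul hl (mem_ball_zero_iff.1 hm) hkm hk
    have hle := natDegree_le_of_dvd ((hI c).1 hcI) hc0
    rw [natDegree_mul (X_sub_C_ne_zero _) hc0, natDegree_X_sub_C] at hle
    omega
  · by_contra hmb
    obtain ⟨s, hs⟩ := h.exists_X_sub_C_mul_sub_one_mem_polyIdeal hl hF (m := m)
      (not_lt.1 fun hlt => hmb (mem_ball_zero_iff.2 hlt))
    have hroot := hm.dvd ((hI _).1 hs)
    simp at hroot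

end IsInnerQuotient

end ZeroCount

section ParametricIntegral

variable {α E F : Type*} [MeasurableSpace α] {μ : Measure α}
  [NormedAddCommGroup E] [NormedSpace ℂ E] [NormedAddCommGroup F] [NormedSpace ℂ F]
  {G : E → α → F} {U : Set E} {x₀ : E}

theorem aestronglyMeasurable_fderiv_apply (hU : U ∈ 𝓝 x₀)
    (hm : ∀ x ∈ U, AEStronglyMeasurable (G x) μ)
    (hd : ∀ᵐ t ∂μ, DifferentiableAt ℂ (fun x => G x t) x₀) (v : E) :
    AEStronglyMeasurable (fun t => fderiv ℂ (fun x => G x t) x₀ v) μ := by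
  have hnorm : Tendsto (fun n : ℕ => ‖(n : ℂ)‖) atTop atTop := by
    simpa using tendsto_natCast_atTop_atTop (R := ℝ)
  have hlim : Tendsto (fun n : ℕ => x₀ + (n : ℂ)⁻¹ • v) atTop (𝓝 x₀) := by
    simpa using
      (tendsto_const_nhds (x := x₀)).add ((tendsto_inv_atTop_nhds_zero_nat (𝕜 := ℂ)).smul_const v)
  obtain ⟨N, hN⟩ := eventually_atTop.1 (hlim.eventually hU)
  refine aestronglyMeasurable_of_tendsto_ae atTop
    (f := fun n t => ((n + N : ℕ) : ℂ) • (G (x₀ + ((n + N : ℕ) : ℂ)⁻¹ • v) t - G x₀ t))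
    (fun n => ((hm _ (hN _ (Nat.le_add_left N n))).sub (hm _ (mem_of_mem_nhds hU))).const_smul _) ?_
  filter_upwards [hd] with t ht
  exact ht.hasFDerivAt.lim v (hnorm.comp (tendsto_add_atTop_nat N))

theorem aestronglyMeasurable_fderiv [FiniteDimensional ℂ E] (hU : U ∈ 𝓝 x₀)
    (hm : ∀ x ∈ U, AEStronglyMeasurable (G x) μ)
    (hd : ∀ᵐ t ∂μ, DifferentiableAt ℂ (fun x => G x t) x₀) :
    AEStronglyMeasurable (fun t => fderiv ℂ (fun x => G x t) x₀) μ := by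
  let b := Module.finBasis ℂ E
  have hsum : (fun t => fderiv ℂ (fun x => G x t) x₀) = fun t =>
      ∑ i, (b.coord i).toContinuousLinearMap.smulRight (fderiv ℂ (fun x => G x t) x₀ (b i)) := by
    ext t v
    conv_lhs => rw [← b.sum_repr v]
    simp only [map_sum, map_smul, sum_apply, ContinuousLinearMap.smulRight_apply,
      LinearMap.coe_toContinuousLinearMap', Module.Basis.coord_apply]
  rw [hsum]
  exact Finset.aestronglyMeasurable_fun_sum _ fun i _ =>
    (ContinuousLinearMap.smulRightL ℂ E F (b.coord i).toContinuousLinearMap).continuous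
      |>.comp_aestronglyMeasurable (aestronglyMeasurable_fderiv_apply hU hm hd (b i))

theorem differentiableAt_integral_of_norm_le [FiniteDimensional ℂ E] [IsFiniteMeasure μ]
    [NormedSpace ℝ F] {M : ℝ}
    (hU : U ∈ 𝓝 x₀) (hm : ∀ x ∈ U, AEStronglyMeasurable (G x) μ)
    (hd : ∀ᵐ t ∂μ, DifferentiableOn ℂ (fun x => G x t) U)
    (hM : ∀ᵐ t ∂μ, ∀ x ∈ U, ‖G x t‖ ≤ M) :
    DifferentiableAt ℂ (fun x => ∫ t, G x t ∂μ) x₀ := by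
  obtain ⟨r, hr, hball⟩ := Metric.mem_nhds_iff.1 hU
  have hd₀ : ∀ᵐ t ∂μ, DifferentiableAt ℂ (fun x => G x t) x₀ :=
    hd.mono fun t ht => ht.differentiableAt hU
  have hGint : Integrable (G x₀) μ := Integrable.of_bound (hm x₀ (mem_of_mem_nhds hU)) M
    (hM.mono fun t ht => ht x₀ (mem_of_mem_nhds hU))
  -- The Schwarz lemma turns the uniform bound into a uniform Lipschitz bound.
  have hlip : ∀ᵐ t ∂μ, ∀ x ∈ Metric.ball x₀ r, ‖G x t - G x₀ t‖ ≤ (M + M) / r * ‖x - x₀‖ := by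
    filter_upwards [hd, hM] with t hdt hMt x hx
    rw [← dist_eq_norm, ← dist_eq_norm]
    refine Complex.dist_le_div_mul_dist_of_mapsTo_ball (f := fun x => G x t)
      (hdt.mono hball) (fun y hy => ?_) hx
    rw [Metric.mem_closedBall, dist_eq_norm]
    exact norm_sub_le_of_le (hMt y (hball hy)) (hMt x₀ (mem_of_mem_nhds hU))
  exact (hasFDerivAt_integral_of_dominated_loc_of_lip' (𝕜 := ℂ) (F := G)
    (Metric.ball_mem_nhds x₀ hr) (fun x hx => hm x (hball hx)) hGint
    (aestronglyMeasurable_fderiv hU hm hd₀) hlip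
    (integrable_const _) (hd₀.mono fun t ht => ht.hasFDerivAt)).2.differentiableAt

end ParametricIntegral

section CauchyIntegral

variable {F : ℂ × ℂ → ℂ} {U : Set ℂ} {c : ℂ} {R : ℝ}

/-- The Cauchy integral of `F` in its second variable over the circle `|ζ - c| = R`. -/
def cauchyIntegralSnd (c : ℂ) (R : ℝ) (F : ℂ × ℂ → ℂ) (x : ℂ × ℂ) : ℂ :=
  (2 * Real.pi * Complex.I : ℂ)⁻¹ • ∮ ζ in C(c, R), (ζ - x.2)⁻¹ • F (x.1, ζ)

theorem continuousOn_cauchyKernel (hR : 0 ≤ R) (hF : ContinuousOn F (U ×ˢ Metric.sphere c R)) :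
    ContinuousOn (fun y : (ℂ × ℂ) × ℝ =>
      deriv (circleMap c R) y.2 • (circleMap c R y.2 - y.1.2)⁻¹ • F (y.1.1, circleMap c R y.2))
      ((U ×ˢ Metric.ball c R) ×ˢ univ) := by
  have hζ (c : ℂ) : Continuous fun y : (ℂ × ℂ) × ℝ => circleMap c R y.2 :=
    (continuous_circleMap c R).comp continuous_snd
  have hF' : ContinuousOn (fun y : (ℂ × ℂ) × ℝ => F (y.1.1, circleMap c R y.2))
      ((U ×ˢ Metric.ball c R) ×ˢ univ) :=
    hF.comp (continuous_fst.fst.prodMk (hζ c)).continuousOn fun y hy =>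
      ⟨hy.1.1, circleMap_mem_sphere c hR y.2⟩
  have hinv : ContinuousOn (fun y : (ℂ × ℂ) × ℝ => (circleMap c R y.2 - y.1.2)⁻¹)
      ((U ×ˢ Metric.ball c R) ×ˢ univ) :=
    ((hζ c).sub continuous_fst.snd).continuousOn.inv₀ fun y hy h =>
      circleMap_ne_mem_ball hy.1.2 y.2 (sub_eq_zero.1 h)
  simp only [deriv_circleMap]
  exact ((hζ 0).mul continuous_const).continuousOn.smul (hinv.smul hF')

theorem differentiableOn_cauchyIntegralSnd (hU : IsOpen U) (hR : 0 ≤ R)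
    (hF : ContinuousOn F (U ×ˢ Metric.sphere c R))
    (hd : ∀ ζ ∈ Metric.sphere c R, DifferentiableOn ℂ (fun z => F (z, ζ)) U) :
    DifferentiableOn ℂ (cauchyIntegralSnd c R F) (U ×ˢ Metric.ball c R) := by
  intro x₀ hx₀
  have hcont := continuousOn_cauchyKernel hR hF
  obtain ⟨K, hK, hKU, hKc⟩ :=
    local_compact_nhds ((hU.prod Metric.isOpen_ball).mem_nhds hx₀)
  obtain ⟨M, hM⟩ := (hKc.prod isCompact_Icc).exists_bound_of_continuousOn
    (hcont.mono (prod_mono hKU (subset_univ _)))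
  refine DifferentiableAt.differentiableWithinAt (DifferentiableAt.fun_const_smul ?_ _)
  simp only [circleIntegral, intervalIntegral.integral_of_le Real.two_pi_pos.le]
  refine differentiableAt_integral_of_norm_le hK (M := M) (fun x hx => ?_) (ae_of_all _ fun t => ?_)
    (ae_restrict_of_forall_mem measurableSet_Ioc
      fun t ht x hx => hM (x, t) ⟨hx, Ioc_subset_Icc_self ht⟩)
  · have hx' : Continuous fun t => deriv (circleMap c R) t •
        (circleMap c R t - x.2)⁻¹ • F (x.1, circleMap c R t) :=
      hcont.comp_continuous (f := fun t : ℝ => (x, t)) (by fun_prop) fun t => ⟨hKU hx, mem_univ t⟩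
    exact hx'.aestronglyMeasurable
  · have hζ := circleMap_mem_sphere c hR t
    refine DifferentiableOn.fun_const_smul (DifferentiableOn.fun_smul
      (DifferentiableOn.fun_inv (by fun_prop) fun x hx h => ?_)
      ((hd _ hζ).comp differentiableOn_fst fun x hx => (hKU hx).1)) _
    exact circleMap_ne_mem_ball (hKU hx).2 t (sub_eq_zero.1 h)

theorem cauchyIntegralSnd_eq {h : ℂ → ℂ} (hR : 0 ≤ R)
    (hh : DifferentiableOn ℂ h (Metric.closedBall c R)) {x : ℂ × ℂ} (hx : x.2 ∈ Metric.ball c R)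
    (hF : ∀ ζ ∈ Metric.sphere c R, F (x.1, ζ) = h ζ) : cauchyIntegralSnd c R F x = h x.2 := by
  have hcongr : ∮ ζ in C(c, R), (ζ - x.2)⁻¹ • F (x.1, ζ) = ∮ ζ in C(c, R), (ζ - x.2)⁻¹ • h ζ :=
    circleIntegral.integral_congr hR fun ζ hζ => by simp only [hF ζ hζ]
  rw [cauchyIntegralSnd, hcongr, hh.circleIntegral_sub_inv_smul hx,
    inv_smul_smul₀ Complex.two_pi_I_ne_zero]

end CauchyIntegral

section Division

variable {f θ : ℂ × ℂ → ℂ} {D : Set ℂ}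

theorem eventually_ne_zero_of_exists_ne_zero {F : ℂ → ℂ} {U : Set ℂ} (hF : DifferentiableOn ℂ F U)
    (hU : IsOpen U) (hUc : IsPreconnected U) (hne : ∃ w ∈ U, F w ≠ 0) {a : ℂ} (ha : a ∈ U) :
    ∀ᶠ w in 𝓝[≠] a, F w ≠ 0 := by
  refine (hF.analyticAt (hU.mem_nhds ha)).eventually_eq_zero_or_eventually_ne_zero.resolve_left
    fun h => ?_
  obtain ⟨w, hw, hFw⟩ := hne
  exact hFw ((hF.analyticOnNhd hU).eqOn_zero_of_preconnected_of_eventuallyEq_zero hUc ha h hw)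

theorem exists_ball_prod_sphere_subset (hθ : DifferentiableOn ℂ θ bidisk) {x₀ : ℂ × ℂ}
    (hx₀ : x₀ ∈ bidisk) (hne : ∃ w ∈ Metric.ball (0 : ℂ) 1, θ (x₀.1, w) ≠ 0) :
    ∃ δ > 0, ∃ ε > 0, Metric.ball x₀.1 δ ×ˢ Metric.closedBall x₀.2 ε ⊆ bidisk ∧
      ∀ x ∈ Metric.ball x₀.1 δ ×ˢ Metric.sphere x₀.2 ε, θ x ≠ 0 := by
  obtain ⟨hl, hw⟩ := mem_bidisk.1 hx₀
  rw [← mem_ball_zero_iff] at hw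
  have hisol := eventually_ne_zero_of_exists_ne_zero (differentiableOn_section_snd hθ hl)
    Metric.isOpen_ball (convex_ball 0 1).isPreconnected hne hw
  obtain ⟨ε, hε, hball⟩ := Metric.nhds_basis_closedBall.eventually_iff.1
    ((eventually_nhdsWithin_iff.1 hisol).and (Metric.isOpen_ball.mem_nhds hw))
  have hsub : {x₀.1} ×ˢ Metric.sphere x₀.2 ε ⊆ bidisk ∩ θ ⁻¹' {0}ᶜ := by
    rintro ⟨l, w⟩ ⟨rfl, hw⟩
    obtain ⟨hne, hw1⟩ := hball (Metric.sphere_subset_closedBall hw)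
    exact ⟨mk_mem_bidisk hl (mem_ball_zero_iff.1 hw1), hne (Metric.ne_of_mem_sphere hw hε.ne')⟩
  obtain ⟨V, W, hV, -, hlV, hSW, hVW⟩ := generalized_tube_lemma isCompact_singleton
    (isCompact_sphere x₀.2 ε)
    (hθ.continuousOn.isOpen_inter_preimage isOpen_bidisk isOpen_compl_singleton) hsub
  obtain ⟨δ, hδ, hδV⟩ := Metric.mem_nhds_iff.1 (hV.mem_nhds (hlV rfl))
  have hsphere : ∀ x ∈ Metric.ball x₀.1 δ ×ˢ Metric.sphere x₀.2 ε, x ∈ bidisk ∧ θ x ≠ 0 :=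
    fun x hx => hVW ⟨hδV hx.1, hSW hx.2⟩
  obtain ⟨ζ, hζ⟩ := (NormedSpace.sphere_nonempty (x := x₀.2)).2 hε.le
  exact ⟨δ, hδ, ε, hε, fun x hx => mk_mem_bidisk (mem_bidisk.1 (hsphere (x.1, ζ) ⟨hx.1, hζ⟩).1).1
    (mem_ball_zero_iff.1 (hball hx.2).2), fun x hx => (hsphere x hx).2⟩

theorem exists_local_quotient (hf : DifferentiableOn ℂ f bidisk)
    (hθ : DifferentiableOn ℂ θ bidisk) (hD : Metric.ball 0 1 ⊆ closure D)
    (hdiv : ∀ l ∈ D, ‖l‖ < 1 → ∃ h : ℂ → ℂ, DifferentiableOn ℂ h (Metric.ball 0 1) ∧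
      ∀ w ∈ Metric.ball (0 : ℂ) 1, f (l, w) = θ (l, w) * h w)
    {x₀ : ℂ × ℂ} (hx₀ : x₀ ∈ bidisk) (hne : ∃ w ∈ Metric.ball (0 : ℂ) 1, θ (x₀.1, w) ≠ 0) :
    ∃ O ∈ 𝓝 x₀, ∃ H : ℂ × ℂ → ℂ, DifferentiableOn ℂ H O ∧ EqOn f (fun x => θ x * H x) O := by
  obtain ⟨δ, hδ, ε, hε, hsub, hsphere⟩ := exists_ball_prod_sphere_subset hθ hx₀ hne
  have hS : Metric.ball x₀.1 δ ×ˢ Metric.sphere x₀.2 ε ⊆ bidisk :=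
    (prod_mono_right Metric.sphere_subset_closedBall).trans hsub
  have hO : Metric.ball x₀.1 δ ×ˢ Metric.ball x₀.2 ε ⊆ bidisk :=
    (prod_mono_right Metric.ball_subset_closedBall).trans hsub
  have hH : DifferentiableOn ℂ (cauchyIntegralSnd x₀.2 ε fun x => f x / θ x)
      (Metric.ball x₀.1 δ ×ˢ Metric.ball x₀.2 ε) := by
    refine differentiableOn_cauchyIntegralSnd Metric.isOpen_ball hε.le
      ((hf.continuousOn.mono hS).div (hθ.continuousOn.mono hS) hsphere) fun ζ hζ => ?_
    have hmaps : MapsTo (fun z => (z, ζ)) (Metric.ball x₀.1 δ) bidisk := fun z hz => hS ⟨hz, hζ⟩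
    exact (hf.comp (by fun_prop) hmaps).fun_div (hθ.comp (by fun_prop) hmaps)
      fun z hz => hsphere (z, ζ) ⟨hz, hζ⟩
  refine ⟨_, prod_mem_nhds (Metric.ball_mem_nhds _ hδ) (Metric.ball_mem_nhds _ hε), _, hH,
    EqOn.of_subset_closure (s := (Metric.ball x₀.1 δ ∩ D) ×ˢ Metric.ball x₀.2 ε) ?_
    (hf.continuousOn.mono hO) ((hθ.continuousOn.mono hO).mul hH.continuousOn)
    (prod_mono_left inter_subset_left) ?_⟩
  · rintro x ⟨⟨hx₁, hxD⟩, hx₂⟩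
    have hmem : ∀ w ∈ Metric.closedBall x₀.2 ε, ‖x.1‖ < 1 ∧ w ∈ Metric.ball (0 : ℂ) 1 :=
      fun w hw => (mem_bidisk.1 (hsub (mk_mem_prod hx₁ hw))).imp_right mem_ball_zero_iff.2
    have hx := hmem x.2 (Metric.ball_subset_closedBall hx₂)
    obtain ⟨h, hh, hfh⟩ := hdiv x.1 hxD hx.1
    have hcauchy : cauchyIntegralSnd x₀.2 ε (fun x => f x / θ x) x = h x.2 :=
      cauchyIntegralSnd_eq hε.le (hh.mono fun w hw => (hmem w hw).2) hx₂ fun ζ hζ => by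
        rw [hfh ζ (hmem ζ (Metric.sphere_subset_closedBall hζ)).2,
          mul_div_cancel_left₀ _ (hsphere (x.1, ζ) ⟨hx₁, hζ⟩)]
    simp only [hcauchy]
    exact hfh x.2 hx.2
  · rw [closure_prod_eq]
    refine prod_mono (fun l hl => Metric.isOpen_ball.inter_closure ⟨hl, hD ?_⟩) subset_closure
    exact mem_ball_zero_iff.2 (mem_bidisk.1 (hO (mk_mem_prod hl (Metric.mem_ball_self hε)))).1

theorem mem_closure_ne_zero (hθ : DifferentiableOn ℂ θ bidisk) {x : ℂ × ℂ} (hx : x ∈ bidisk)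
    (hne : ∃ w ∈ Metric.ball (0 : ℂ) 1, θ (x.1, w) ≠ 0) : x ∈ closure {x | θ x ≠ 0} := by
  obtain ⟨hl, hw⟩ := mem_bidisk.1 hx
  have hisol := eventually_ne_zero_of_exists_ne_zero (differentiableOn_section_snd hθ hl)
    Metric.isOpen_ball (convex_ball 0 1).isPreconnected hne (mem_ball_zero_iff.2 hw)
  have hline : Tendsto (fun w => (x.1, w)) (𝓝 x.2) (𝓝 x) :=
    Continuous.tendsto (by fun_prop) x.2
  exact mem_closure_iff_frequently.2
    (hline.frequently (hisol.frequently.filter_mono nhdsWithin_le_nhds))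

theorem exists_quotient (hf : DifferentiableOn ℂ f bidisk)
    (hθ : DifferentiableOn ℂ θ bidisk) (hD : Metric.ball 0 1 ⊆ closure D)
    (hdiv : ∀ l ∈ D, ‖l‖ < 1 → ∃ h : ℂ → ℂ, DifferentiableOn ℂ h (Metric.ball 0 1) ∧
      ∀ w ∈ Metric.ball (0 : ℂ) 1, f (l, w) = θ (l, w) * h w)
    (hne : ∀ l : ℂ, ‖l‖ < 1 → ∃ w ∈ Metric.ball (0 : ℂ) 1, θ (l, w) ≠ 0) :
    ∃ h : ℂ × ℂ → ℂ, DifferentiableOn ℂ h bidisk ∧ ∀ x ∈ bidisk, f x = θ x * h x := by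
  let h := extendFrom {x | θ x ≠ 0} fun x => f x / θ x
  have hlocal : ∀ x ∈ bidisk, ∃ H : ℂ × ℂ → ℂ, DifferentiableAt ℂ H x ∧
      h =ᶠ[𝓝 x] H ∧ f x = θ x * H x := by
    intro x hx
    obtain ⟨O, hO, H, hH, hfH⟩ := exists_local_quotient hf hθ hD hdiv hx
      (hne x.1 (mem_bidisk.1 hx).1)
    refine ⟨H, hH.differentiableAt hO, ?_, hfH (mem_of_mem_nhds hO)⟩
    filter_upwards [isOpen_bidisk.mem_nhds hx, eventually_mem_nhds_iff.2 hO] with y hy hyO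
    refine extendFrom_eq (mem_closure_ne_zero hθ hy (hne y.1 (mem_bidisk.1 hy).1)) ?_
    refine ((hH.continuousOn.continuousAt hyO).continuousWithinAt (s := {x | θ x ≠ 0})).congr' ?_
    filter_upwards [self_mem_nhdsWithin, mem_nhdsWithin_of_mem_nhds hyO] with z hz hzO
    rw [hfH hzO, mul_div_cancel_left₀ _ hz]
  refine ⟨h, fun x hx => ?_, fun x hx => ?_⟩ <;> obtain ⟨H, hH, hhH, hfH⟩ := hlocal x hx
  · exact (hH.congr_of_eventuallyEq hhH).differentiableWithinAt
  · rw [hhH.self_of_nhds, hfH]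

end Division

section FredholmPoints

open Polynomial

variable {θ : HardySpace} {p q : ℂ[X][X]} {l : ℂ}

theorem coFG_of_le_sup {K V : Type*} [DivisionRing K] [AddCommGroup V] [Module K V]
    {S T F : Submodule K V} (hS : S.CoFG) (hF : F.FG) (h : S ≤ T ⊔ F) : T.CoFG := by
  have hsup : (T ⊔ F).CoFG := hS.of_le h
  have : Module.Finite K ((V ⧸ T) ⧸ F.map T.mkQ) :=
    Module.Finite.equiv (Submodule.quotientQuotientEquivQuotientSup T F).symm
  have : Module.Finite K (F.map T.mkQ) := Module.Finite.iff_fg.2 (hF.map _)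
  exact Module.Finite.of_submodule_quotient (F.map T.mkQ)

theorem exists_mul_snd_sub {a : ℂ} (ha : 1 < ‖a‖) (k : HardySpace) :
    ∃ g : HardySpace, ∀ x ∈ bidisk, k x = (x.2 - a) * g x := by
  have hbound : ∀ x ∈ bidisk, ‖a‖ - 1 ≤ ‖x.2 - a‖ := fun x hx => by
    rw [norm_sub_rev]
    exact (sub_le_sub_left (mem_bidisk.1 hx).2.le _).trans (norm_sub_norm_le _ _)
  have hne : ∀ x ∈ bidisk, x.2 - a ≠ 0 := fun x hx =>
    norm_pos_iff.1 ((sub_pos.2 ha).trans_le (hbound x hx))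
  have hdiff : DifferentiableOn ℂ (fun x : ℂ × ℂ => (x.2 - a)⁻¹) bidisk :=
    DifferentiableOn.fun_inv (by fun_prop) hne
  have hinv : ∀ r ∈ Ico (0 : ℝ) 1, ∀ t, ‖((torusPoint r r t).2 - a)⁻¹‖ ≤ (‖a‖ - 1)⁻¹ :=
    fun r hr t => by
      rw [norm_inv]
      exact inv_anti₀ (sub_pos.2 ha) (hbound _ (torusPoint_mem hr hr t))
  refine ⟨HardySpace.multiplier hdiff hinv k, fun x hx => ?_⟩
  rw [HardySpace.multiplier_apply, mul_inv_cancel_left₀ (hne x hx)]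

theorem exists_eq_add_mul_sub (hl : ‖l‖ < 1) {a : ℂ} (ha : ‖a‖ ≠ 1) (k : HardySpace) :
    ∃ (c : ℂ) (g : HardySpace), ∀ w ∈ Metric.ball (0 : ℂ) 1,
      k (l, w) = c + (w - a) * g (l, w) := by
  rcases ha.lt_or_gt with ha | ha
  · obtain ⟨g, hg⟩ := k.exists_difference_quotient_snd ha
    exact ⟨k (l, a), g, fun w hw => by
      rw [← hg (l, w) (mk_mem_bidisk hl (mem_ball_zero_iff.1 hw)), add_sub_cancel]⟩
  · obtain ⟨g, hg⟩ := exists_mul_snd_sub ha k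
    exact ⟨0, g, fun w hw => by
      rw [zero_add, hg (l, w) (mk_mem_bidisk hl (mem_ball_zero_iff.1 hw))]⟩

theorem coFG_lineMultiples_ofPoly_X_sub_C_mul (hl : ‖l‖ < 1) {a : ℂ} (ha : ‖a‖ ≠ 1) {s : ℂ[X]}
    (hs : (lineMultiples (ofPoly s) l).CoFG) :
    (lineMultiples (ofPoly ((X - C a) * s)) l).CoFG := by
  refine coFG_of_le_sup hs (Submodule.fg_span_singleton (ofPoly s)) ?_
  rintro f ⟨k, hk⟩
  obtain ⟨c, g, hg⟩ := exists_eq_add_mul_sub hl ha k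
  rw [← sub_add_cancel f (c • ofPoly s)]
  refine Submodule.add_mem_sup ⟨g, fun w hw => ?_⟩
    (Submodule.smul_mem _ _ (Submodule.mem_span_singleton_self _))
  rw [HardySpace.sub_apply, HardySpace.smul_apply, hk w hw, hg w hw, ofPoly_mul,
    HardySpace.aeval_shiftW_apply, eval_sub, eval_X, eval_C]
  ring

theorem coFG_lineMultiples_ofPoly (hl : ‖l‖ < 1) {s : ℂ[X]}
    (hs : ∀ w : ℂ, ‖w‖ = 1 → s.eval w ≠ 0) : (lineMultiples (ofPoly s) l).CoFG := by
  have hs0 : s ≠ 0 := fun h => hs 1 norm_one (by rw [h, eval_zero])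
  have hprod : ∀ m : Multiset ℂ, (∀ a ∈ m, ‖a‖ ≠ 1) →
      (lineMultiples (ofPoly (m.map fun a => X - C a).prod) l).CoFG := by
    intro m
    induction m using Multiset.induction_on with
    | empty =>
      refine fun _ => Submodule.CoFG.of_le (fun f _ => ⟨f, fun w hw => ?_⟩) Submodule.CoFG.top
      rw [Multiset.map_zero, Multiset.prod_zero,
        ofPoly_apply _ (mk_mem_bidisk hl (mem_ball_zero_iff.1 hw)), eval_one, one_mul]
    | cons a m ih =>
      intro hm
      rw [Multiset.map_cons, Multiset.prod_cons]
      exact coFG_lineMultiples_ofPoly_X_sub_C_mul hl (hm a (Multiset.mem_cons_self a m))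
        (ih fun b hb => hm b (Multiset.mem_cons_of_mem hb))
  refine (hprod s.roots fun a ha h => hs a h (isRoot_of_mem_roots ha)).of_le ?_
  rintro f ⟨g, hg⟩
  refine ⟨s.leadingCoeff⁻¹ • g, fun w hw => ?_⟩
  have hx := mk_mem_bidisk hl (mem_ball_zero_iff.1 hw)
  have hsw := congrArg (eval w) (IsAlgClosed.splits s).eq_prod_roots
  rw [eval_mul, eval_C] at hsw
  rw [hg w hw, ofPoly_apply _ hx, ofPoly_apply _ hx, HardySpace.smul_apply, hsw]
  field_simp [leadingCoeff_ne_zero.2 hs0]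

namespace IsInnerQuotient

variable (h : IsInnerQuotient θ p q)
include h

theorem lineMultiples_ofPoly_le (hl : ‖l‖ < 1) :
    lineMultiples (ofPoly (q.map (evalRingHom l))) l ≤ lineMultiples θ l := by
  rintro f ⟨k, hk⟩
  refine ⟨aeval HardySpace.shiftW (p.map (evalRingHom l)) k, fun w hw => ?_⟩
  have hx := mk_mem_bidisk hl (mem_ball_zero_iff.1 hw)
  rw [hk w hw, ofPoly_apply _ hx, HardySpace.aeval_shiftW_apply, map_evalRingHom_eval,
    map_evalRingHom_eval, ← h.mul_eq _ hx, mul_assoc]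

theorem isFredholm_shiftSub (hl : ‖l‖ < 1) (hne : ∃ w ∈ Metric.ball (0 : ℂ) 1, θ (l, w) ≠ 0)
    (hq : ∀ w : ℂ, ‖w‖ = 1 → q.evalEval l w ≠ 0) : (shiftSub θ l).IsFredholm := by
  have hline : (lineMultiples θ l).CoFG :=
    (coFG_lineMultiples_ofPoly hl fun w hw => by
      rw [map_evalRingHom_eval]; exact hq w hw).of_le (h.lineMultiples_ofPoly_le hl)
  have hker : (cokerMap θ l).ker = lineMultiples θ l :=
    Submodule.ext fun f => h.cokerMap_eq_zero_iff hl
  rw [← hker] at hline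
  exact isFredholm_of_ker_eq_bot (h.ker_shiftSub_eq_bot hl hne) (Module.Finite.equiv
    ((cokerMap θ l).toLinearMap.quotKerEquivOfSurjective (cokerMap_surjective θ l)))

theorem ball_subset_closure_isFredholm
    (hne : ∀ l : ℂ, ‖l‖ < 1 → ∃ w ∈ Metric.ball (0 : ℂ) 1, θ (l, w) ≠ 0) :
    Metric.ball 0 1 ⊆ closure {l : ℂ | (shiftSub θ l).IsFredholm} := by
  refine fun l hl => mem_closure_iff.2 fun U hU hlU => ?_
  obtain ⟨s, ⟨hsU, hs⟩, hsq⟩ := exists_forall_evalEval_ne_zero_on_circle h.eval_ne_zero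
    (hU.inter Metric.isOpen_ball) ⟨l, hlU, hl⟩
  rw [mem_ball_zero_iff] at hs
  exact ⟨s, hsU, h.isFredholm_shiftSub hs (hne s hs) hsq⟩

end IsInnerQuotient

end FredholmPoints

section Components

variable {ι : Type*} {Ω : Set ℂ} {Ωc : ι → Set ℂ}

theorem conjSet_connectedComponentIn {x : ℂ} (hx : x ∈ Ω) :
    conjSet (connectedComponentIn Ω x) = connectedComponentIn (conjSet Ω) (conj x) :=
  Complex.conjCLE.toHomeomorph.image_connectedComponentIn hx

namespace EnumeratesComponents

variable (h : EnumeratesComponents Ω Ωc)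
include h

protected theorem conjSet :
    EnumeratesComponents (conjSet Ω) fun i => HardyBidisk.conjSet (Ωc i) := by
  refine ⟨(Set.image_injective.2 (starRingEnd ℂ).injective).comp h.1, ?_⟩
  have hrange : range (fun i => HardyBidisk.conjSet (Ωc i)) = HardyBidisk.conjSet '' range Ωc :=
    range_comp _ _
  rw [hrange, h.2]
  ext C
  constructor
  · rintro ⟨_, ⟨x, hx, rfl⟩, rfl⟩
    exact ⟨conj x, mem_image_of_mem _ hx, conjSet_connectedComponentIn hx⟩
  · rintro ⟨_, ⟨x, hx, rfl⟩, rfl⟩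
    exact ⟨_, ⟨x, hx, rfl⟩, conjSet_connectedComponentIn hx⟩

theorem exists_eq_connectedComponentIn (i : ι) : ∃ x ∈ Ω, Ωc i = connectedComponentIn Ω x :=
  h.2.subset (mem_range_self i)

theorem subset (i : ι) : Ωc i ⊆ Ω := by
  obtain ⟨x, -, hx⟩ := h.exists_eq_connectedComponentIn i
  exact hx ▸ connectedComponentIn_subset Ω x

theorem nonempty (i : ι) : (Ωc i).Nonempty := by
  obtain ⟨x, hxΩ, hx⟩ := h.exists_eq_connectedComponentIn i
  exact ⟨x, hx ▸ mem_connectedComponentIn hxΩ⟩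

theorem isPreconnected (i : ι) : IsPreconnected (Ωc i) := by
  obtain ⟨x, -, hx⟩ := h.exists_eq_connectedComponentIn i
  exact hx ▸ isPreconnected_connectedComponentIn

end EnumeratesComponents

end Components

section FredholmDomain

open ContinuousLinearMap

variable {H : Type*} [NormedAddCommGroup H] [InnerProductSpace ℂ H] {T : H →L[ℂ] H} {l : ℂ}

/-- The points of the spectrum at which `T - l` is Fredholm: `σ(T) \ σ_e(T)`. -/
abbrev fredholmDomain (T : H →L[ℂ] H) : Set ℂ := spectrum ℂ T \ essentialSpectrum T

/-- The codimension of the range of `T - l`, with value `0` if it is infinite. -/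
abbrev defect (T : H →L[ℂ] H) (l : ℂ) : ℕ :=
  Module.finrank ℂ (H ⧸ (T - l • ContinuousLinearMap.id ℂ H).range)

theorem isFredholm_of_mem_fredholmDomain (hl : l ∈ fredholmDomain T) :
    (T - l • ContinuousLinearMap.id ℂ H).IsFredholm :=
  not_not.1 hl.2

variable [CompleteSpace H]

theorem defect_pos (hl : l ∈ fredholmDomain T)
    (hk : (T - l • ContinuousLinearMap.id ℂ H).ker = ⊥) : 0 < defect T l := by
  have := (isFredholm_of_mem_fredholmDomain hl).finite_coker
  have hrange : (T - l • ContinuousLinearMap.id ℂ H).range ≠ ⊤ := fun h =>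
    mem_spectrum_iff.1 hl.1 ⟨hk, h⟩
  have := Submodule.Quotient.nontrivial_iff.2 hrange
  exact Module.finrank_pos

theorem eventually_mem_fredholmDomain (hl : l ∈ fredholmDomain T)
    (hk : (T - l • ContinuousLinearMap.id ℂ H).ker = ⊥) :
    ∀ᶠ m in 𝓝 l, m ∈ fredholmDomain T ∧ defect T m = defect T l := by
  filter_upwards [eventually_isFredholm hk (isFredholm_of_mem_fredholmDomain hl)] with m hm
  refine ⟨⟨mem_spectrum_iff.2 fun h => ?_, not_not.2 hm.1⟩, hm.2⟩
  have := Submodule.Quotient.subsingleton_iff.2 h.2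
  exact (defect_pos hl hk).ne (Module.finrank_zero_of_subsingleton.symm.trans hm.2)

theorem topologicalClosure_iSup_ker_adjoint_eq_top {Ω : Set ℂ}
    (hcl : ∀ l ∈ Ω, IsClosed ((T - l • ContinuousLinearMap.id ℂ H).range : Set H))
    (hrange : ∀ f, (∀ l ∈ Ω, f ∈ (T - l • ContinuousLinearMap.id ℂ H).range) → f = 0) :
    (⨆ l ∈ conjSet Ω,
      (adjoint T - l • ContinuousLinearMap.id ℂ H).ker).topologicalClosure = ⊤ := by
  rw [Submodule.topologicalClosure_eq_top_iff, Submodule.eq_bot_iff]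
  refine fun f hf => hrange f fun l hl => ?_
  have hle : (adjoint (T - l • ContinuousLinearMap.id ℂ H)).ker ≤
      ⨆ m ∈ conjSet Ω, (adjoint T - m • ContinuousLinearMap.id ℂ H).ker := by
    rw [adjoint_sub_smul_id]
    exact le_iSup₂_of_le (conj l) (mem_image_of_mem _ hl) le_rfl
  have hf' := Submodule.orthogonal_le hle hf
  rwa [← orthogonal_range, Submodule.orthogonal_orthogonal_eq_closure,
    (hcl l hl).submodule_topologicalClosure_eq] at hf'

variable (hk : ∀ l ∈ fredholmDomain T, (T - l • ContinuousLinearMap.id ℂ H).ker = ⊥)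
include hk

theorem isOpen_fredholmDomain : IsOpen (fredholmDomain T) :=
  isOpen_iff_mem_nhds.2 fun l hl =>
    (eventually_mem_fredholmDomain hl (hk l hl)).mono fun _ hm => hm.1

theorem continuousOn_defect : ContinuousOn (defect T) (fredholmDomain T) := fun l hl =>
  (continuousAt_const.congr ((eventually_mem_fredholmDomain hl (hk l hl)).mono
    fun _ hm => hm.2.symm)).continuousWithinAt

variable {ι : Type*} {Ωc : ι → Set ℂ}

theorem exists_defect_eq (hΩc : EnumeratesComponents (fredholmDomain T) Ωc) :
    ∃ α : ι → ℕ, ∀ i, ∀ l ∈ Ωc i, defect T l = α i := by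
  choose x hx using hΩc.nonempty
  exact ⟨fun i => defect T (x i), fun i l hl => (hΩc.isPreconnected i).constant
    ((continuousOn_defect hk).mono (hΩc.subset i)) hl (hx i)⟩

theorem generalizedCowenDouglas_adjoint [TopologicalSpace.SeparableSpace H] [Nontrivial H]
    (hrange : ∀ f, (∀ l ∈ fredholmDomain T, f ∈ (T - l • ContinuousLinearMap.id ℂ H).range) →
      f = 0)
    (hΩc : EnumeratesComponents (fredholmDomain T) Ωc) {α : ι → ℕ}
    (hα : ∀ i, ∀ l ∈ Ωc i, defect T l = α i) :
    GeneralizedCowenDouglas (conjSet (fredholmDomain T)) (fun i => conjSet (Ωc i)) α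
      (adjoint T) where
  complete := inferInstance
  separable := inferInstance
  isOpen := Complex.conjCLE.toHomeomorph.isOpenMap _ (isOpen_fredholmDomain hk)
  isBounded := Complex.conjLIE.lipschitz.isBounded_image
    ((spectrum.isBounded T).subset sdiff_subset)
  nonempty := by
    refine Nonempty.image _ (nonempty_iff_ne_empty.2 fun hempty => ?_)
    obtain ⟨f, hf⟩ := exists_ne (0 : H)
    exact hf (hrange f (hempty ▸ fun l hl => hl.elim))
  components := hΩc.conjSet
  index_pos i := by
    obtain ⟨l, hl⟩ := hΩc.nonempty i
    exact hα i l hl ▸ defect_pos (hΩc.subset i hl) (hk l (hΩc.subset i hl))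
  range_eq := by
    rintro _ ⟨l, hl, rfl⟩
    rw [← adjoint_sub_smul_id]
    exact range_adjoint_eq_top (hk l hl) (isFredholm_of_mem_fredholmDomain hl)
  span_ker := topologicalClosure_iSup_ker_adjoint_eq_top
    (fun _ hl => (isFredholm_of_mem_fredholmDomain hl).isClosed_range) hrange
  rank_ker := by
    rintro i _ ⟨l, hl, rfl⟩
    rw [← adjoint_sub_smul_id,
      rank_ker_adjoint (isFredholm_of_mem_fredholmDomain (hΩc.subset i hl)), ← hα i l hl]

end FredholmDomain

namespace IsInnerQuotient

open Polynomial

variable {θ : HardySpace} {p q : ℂ[X][X]} (h : IsInnerQuotient θ p q)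
include h

theorem isConst_of_one_mem_multiples (h1 : HardySpace.one ∈ multiples θ) : IsConst θ := by
  obtain ⟨g, hg⟩ := h1
  obtain ⟨k, hk, hknorm⟩ := h.exists_div HardySpace.one g.differentiableOn hg
  have h0 : ((0 : ℂ), (0 : ℂ)) ∈ bidisk := mk_mem_bidisk (by simp) (by simp)
  have hprod : ‖θ (0, 0)‖ * ‖k (0, 0)‖ = 1 := by
    rw [← norm_mul, hk _ h0, ← hg _ h0, HardySpace.one_apply h0, norm_one]
  have hk0 : ‖k (0, 0)‖ ≤ 1 :=
    k.norm_apply_zero_le.trans (hknorm.trans HardySpace.norm_one.le)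
  have hθ0 : 1 ≤ ‖θ (0, 0)‖ := hprod.ge.trans (mul_le_of_le_one_right (norm_nonneg _) hk0)
  have hθ := HardySpace.eq_smul_one (h.norm_le.trans hθ0)
  refine ⟨θ (0, 0), fun x hx => ?_⟩
  conv_lhs => rw [hθ]
  rw [HardySpace.smul_apply, HardySpace.one_apply hx, mul_one]

theorem nontrivial_quotientModule (hconst : ¬ IsConst θ) : Nontrivial (quotientModule θ) := by
  by_contra hsub
  rw [not_nontrivial_iff_subsingleton] at hsub
  exact hconst (h.isConst_of_one_mem_multiples
    (h.projK_eq_zero_iff.1 (Subsingleton.elim (projK θ HardySpace.one) 0)))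

theorem eq_zero_of_forall_mem_range
    (hne : ∀ l : ℂ, ‖l‖ < 1 → ∃ w ∈ Metric.ball (0 : ℂ) 1, θ (l, w) ≠ 0) (k : quotientModule θ)
    (hk : ∀ l ∈ fredholmDomain (compressedShift θ), k ∈ (shiftSub θ l).range) : k = 0 := by
  have hrange : ∀ l, (shiftSub θ l).IsFredholm → k ∈ (shiftSub θ l).range := fun l hF => by
    by_cases hs : l ∈ spectrum ℂ (compressedShift θ)
    · exact hk l ⟨hs, not_not.2 hF⟩
    · rw [mem_spectrum_iff, not_not] at hs
      exact hs.2 ▸ Submodule.mem_top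
  have hdiv : ∀ l ∈ {l : ℂ | (shiftSub θ l).IsFredholm}, ‖l‖ < 1 → ∃ g : ℂ → ℂ,
      DifferentiableOn ℂ g (Metric.ball 0 1) ∧
        ∀ w ∈ Metric.ball (0 : ℂ) 1, (k : HardySpace) (l, w) = θ (l, w) * g w := fun l hF hl => by
    have hmem := hrange l hF
    rw [← Submodule.orthogonalProjectionOnto_mem_subspace_eq_self (K := quotientModule θ) k,
      h.projK_mem_range_iff hl] at hmem
    obtain ⟨g, hg⟩ := hmem
    exact ⟨_, differentiableOn_section_snd g.differentiableOn hl, hg⟩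
  obtain ⟨g, hg, hkg⟩ := exists_quotient (k : HardySpace).differentiableOn θ.differentiableOn
    (h.ball_subset_closure_isFredholm hne) hdiv hne
  obtain ⟨g', hg', -⟩ := h.exists_div k hg hkg
  exact eq_zero_of_mem_multiples k ⟨g', fun x hx => by rw [hg' x hx]; exact hkg x hx⟩

end IsInnerQuotient

end HardyBidisk

end

theorem theorem4p7 (θ : HardySpace) (hinner : IsInner θ) (hrat : IsRational θ)
    (hconst : ¬ IsConst θ) (hz : ¬ HasInnerFactorInZ θ)
    (Ω : Set ℂ) (hΩ : Ω = spectrum ℂ (compressedShift θ) \ essentialSpectrum (compressedShift θ))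
    {ι : Type*} (Ωc : ι → Set ℂ) (hΩc : EnumeratesComponents Ω Ωc) :
    ∃ α : ι → ℕ,
      (∀ i, ∀ l ∈ Ωc i, HasZeroCount (fun w => θ (l, w)) (α i)) ∧
      GeneralizedCowenDouglas (conjSet Ω) (fun i => conjSet (Ωc i)) α
        (ContinuousLinearMap.adjoint (compressedShift θ)) := by
  subst hΩ
  obtain ⟨p, q, h⟩ := exists_isInnerQuotient hinner hrat
  have hne (l : ℂ) (hl : ‖l‖ < 1) : ∃ w ∈ Metric.ball (0 : ℂ) 1, θ (l, w) ≠ 0 :=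
    exists_section_ne_zero hl hinner hz
  have hnorm (l : ℂ) (hl : l ∈ fredholmDomain (compressedShift θ)) : ‖l‖ < 1 :=
    norm_lt_one_of_mem_spectrum_of_notMem_essentialSpectrum hl.1 hl.2
  have hker : ∀ l ∈ fredholmDomain (compressedShift θ), (shiftSub θ l).ker = ⊥ := fun l hl =>
    h.ker_shiftSub_eq_bot (hnorm l hl) (hne l (hnorm l hl))
  have := h.nontrivial_quotientModule hconst
  obtain ⟨α, hα⟩ := exists_defect_eq hker hΩc
  refine ⟨α, fun i l hl => hα i l hl ▸ ?_, generalizedCowenDouglas_adjoint hker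
    (h.eq_zero_of_forall_mem_range hne) hΩc hα⟩
  have hlΩ := hΩc.subset i hl
  exact h.hasZeroCount (hnorm l hlΩ) (isFredholm_of_mem_fredholmDomain hlΩ)
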